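/- Let $H$ be a finite dimensional Hopf algebra over a field $\Bbbk$, let $A$ be a left $H$-module algebra, and let $B=A\#H$ be the smash product, i.e. $A\otimes H$ with $(a\otimes h)(b\otimes l)=\sum a(h_{(1)}\cdot b)\otimes h_{(2)}l$. For a $B$-module $N$ and an $H$-module $V$, the algebra $B$ acts on $N\otimes V$ by $(a\otimes h)(n\otimes v)=\sum (a\otimes h_{(1)})n\otimes h_{(2)}v$; in particular this defines the $B$-modules $A\otimes V$ and $N\otimes H$. A $B$-module is called acyclic if its restriction to $H$ is zero in the stable category of $H$-modules, i.e. the category of $H$-modules modulo the maps that factor through a projective (equivalently, injective) module. The homotopy category of $B$-modules is the category of $B$-modules modulo the maps that factor through a module $N\otimes H$. Then there are endofunctors $M\mapsto\mathbf{a}M$ and $M\mapsto\tilde{\mathbf{p}}M$ of the category of $B$-modules and, for each $B$-module $M$, a short exact sequence of $B$-modules, natural in $M$, $$0\to M\to \mathbf{a}M\to\tilde{\mathbf{p}}M\to 0,$$ which splits as a sequence of $A$-modules, such that $\mathbf{a}M$ is acyclic and $P=\tilde{\mathbf{p}}M$ has a filtration $F_0\subset F_1\subset F_2\subset\cdots\subset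 P$ by $B$-submodules with $P=\bigcup_r F_r$, with every inclusion $F_r\subset F_{r+1}$ split over $A$, and with $F_0$ and all the quotients $F_{r+1}/F_r$ isomorphic to (possibly empty) direct sums of $B$-modules $A\otimes V$, where the $V$ are indecomposable $H$-modules. In particular, $\tilde{\mathbf{p}}M$ has property (P), that is, it is isomorphic in the homotopy category of $B$-modules to a $B$-module with such a filtration. The same holds in the graded case: if $H$ is moreover a $\mathbb{Z}$-graded Hopf algebra and $A$ is a $\mathbb{Z}$-graded algebra whose $H$-action is compatible with the gradings, then the statement holds for the category of $\mathbb{Z}$-graded $B$-modules and degree preserving maps, where all modules (including $N$, $V$ and the projective ones), submodules and splittings are graded, and indecomposable means indecomposable as a graded $H$-module. -/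

import Mathlib

set_option linter.unusedSectionVars false
open CategoryTheory
open scoped TensorProduct DirectSum ModuleCat

universe u

noncomputable section

namespace Hopfological

section ModuleAlgebra

variable (k : Type u) [Field k] (H : Type u) [Ring H] [HopfAlgebra k H]

/-- The diagonal action of `H` on `M ⊗ N`: `h (m ⊗ n) = ∑ h₁ m ⊗ h₂ n`. -/
def diagAct (M N : Type u) [AddCommGroup M] [Module k M] [Module H M] [IsScalarTower k H M]
    [AddCommGroup N] [Module k N] [Module H N] [IsScalarTower k H N] :
    H →ₐ[k] Module.End k (M ⊗[k] N) :=
  (Module.endTensorEndAlgHom (R := k) (S := k) (A := k) (M := M) (N := N)).comp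
    ((Algebra.TensorProduct.map (Algebra.lsmul k k M) (Algebra.lsmul k k N)).comp
      (Bialgebra.comulAlgHom k H))

variable {k H} in
theorem diagAct_tmul {M N : Type u} [AddCommGroup M] [Module k M] [Module H M]
    [IsScalarTower k H M] [AddCommGroup N] [Module k N] [Module H N] [IsScalarTower k H N]
    (h : H) (m : M) (n : N) :
    diagAct k H M N h (m ⊗ₜ n) =
      TensorProduct.map ((Algebra.lsmul k k M).toLinearMap.flip m)
        ((Algebra.lsmul k k N).toLinearMap.flip n) (Coalgebra.comul (R := k) h) := by
  let r := Coalgebra.Repr.arbitrary k h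
  simp [diagAct, ← r.eq, Module.endTensorEndAlgHom_apply]

variable {k H} in
theorem diagAct_repr {M N : Type u} [AddCommGroup M] [Module k M] [Module H M]
    [IsScalarTower k H M] [AddCommGroup N] [Module k N] [Module H N] [IsScalarTower k H N]
    (h : H) (m : M) (n : N) {ι : Type*} (r : Coalgebra.Repr k h ι) :
    diagAct k H M N h (m ⊗ₜ n) = ∑ i ∈ r.index, (r.left i • m) ⊗ₜ[k] (r.right i • n) := by
  rw [diagAct_tmul, ← r.eq]; simp

/-- `A` is a left `H`-module algebra: `h (a b) = ∑ (h₁ a) (h₂ b)` and `h 1 = ε(h) 1`. -/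
class ModuleAlgebra (A : Type u) [Ring A] [Algebra k A] [Module H A] [IsScalarTower k H A] :
    Prop where
  smul_mul : ∀ (h : H) (a b : A),
    h • (a * b) = LinearMap.mul' k A (diagAct k H A A h (a ⊗ₜ[k] b))
  smul_one : ∀ h : H, h • (1 : A) = algebraMap k A (Coalgebra.counit h)

variable (A : Type u) [Ring A] [Algebra k A] [Module H A] [IsScalarTower k H A]

/-- The underlying vector space `A ⊗ H` of the smash product algebra `A # H`. -/
def SmashProduct : Type u := A ⊗[k] H

instance : AddCommGroup (SmashProduct k H A) := inferInstanceAs (AddCommGroup (A ⊗[k] H))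
instance : Module k (SmashProduct k H A) := inferInstanceAs (Module k (A ⊗[k] H))

namespace SmashProduct

/-- The element `a ⊗ h` of `A # H`. -/
def mk (a : A) (h : H) : SmashProduct k H A := a ⊗ₜ[k] h

/-- Left multiplication in `A # H`: `(a ⊗ h) (b ⊗ l) = ∑ a (h₁ b) ⊗ h₂ l`. -/
def mulLeft : SmashProduct k H A →ₗ[k] Module.End k (SmashProduct k H A) :=
  (TensorProduct.lift
    ((LinearMap.mul k (Module.End k (A ⊗[k] H))).compl₁₂
      ((LinearMap.rTensorHom (M := H) (N := A) (P := A)).comp (LinearMap.mul k A))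
      (diagAct k H A H).toLinearMap) : A ⊗[k] H →ₗ[k] Module.End k (A ⊗[k] H))

instance : Mul (SmashProduct k H A) := ⟨fun x y => mulLeft k H A x y⟩
instance : One (SmashProduct k H A) := ⟨mk k H A 1 1⟩

variable {k H A}

theorem induction {p : SmashProduct k H A → Prop} (x : SmashProduct k H A) (zero : p 0)
    (mk : ∀ a h, p (mk k H A a h)) (add : ∀ x y, p x → p y → p (x + y)) : p x :=
  TensorProduct.induction_on x zero mk add

theorem mul_def (x y : SmashProduct k H A) : x * y = mulLeft k H A x y := rfl

theorem mk_mul_mk (a b : A) (h l : H) {ι : Type*} (r : Coalgebra.Repr k h ι) :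
    mk k H A a h * mk k H A b l =
      ∑ i ∈ r.index, mk k H A (a * r.left i • b) (r.right i * l) := by
  change (LinearMap.rTensor H (LinearMap.mul k A a)) (diagAct k H A H h (b ⊗ₜ l)) = _
  rw [diagAct_repr h b l r, map_sum]
  rfl

/-- The linear map `a ⊗ h ↦ f a * g h`. -/
def liftLin {E : Type*} [Ring E] [Algebra k E] (f : A →ₐ[k] E) (g : H →ₐ[k] E) :
    SmashProduct k H A →ₗ[k] E :=
  (TensorProduct.lift ((LinearMap.mul k E).compl₁₂ f.toLinearMap g.toLinearMap) :
    A ⊗[k] H →ₗ[k] E)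

theorem liftLin_mk {E : Type*} [Ring E] [Algebra k E] (f : A →ₐ[k] E) (g : H →ₐ[k] E)
    (a : A) (h : H) : liftLin f g (mk k H A a h) = f a * g h := rfl

/-- The commutation rule `g h * f b = ∑ f (h₁ b) * g h₂`. -/
def Compat {E : Type*} [Ring E] [Algebra k E] (f : A →ₐ[k] E) (g : H →ₐ[k] E) : Prop :=
  ∀ (h : H) (b : A), g h * f b =
    TensorProduct.lift ((LinearMap.mul k E).compl₁₂
      (f.toLinearMap.comp ((Algebra.lsmul k k A).toLinearMap.flip b)) g.toLinearMap)
      (Coalgebra.comul (R := k) h)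

theorem Compat.eq {E : Type*} [Ring E] [Algebra k E] {f : A →ₐ[k] E} {g : H →ₐ[k] E}
    (c : Compat f g) (h : H) (b : A) {ι : Type*} (r : Coalgebra.Repr k h ι) :
    g h * f b = ∑ i ∈ r.index, f (r.left i • b) * g (r.right i) := by
  rw [c h b, ← r.eq]; simp

theorem liftLin_mul {E : Type*} [Ring E] [Algebra k E] {f : A →ₐ[k] E} {g : H →ₐ[k] E}
    (c : Compat f g) (x y : SmashProduct k H A) :
    liftLin f g (x * y) = liftLin f g x * liftLin f g y := by
  induction x using induction with
  | zero => simp [mul_def]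
  | add x x' hx hx' => simp only [mul_def, map_add, LinearMap.add_apply, add_mul] at *; rw [hx, hx']
  | mk a h =>
    induction y using induction with
    | zero => simp [mul_def]
    | add x x' hx hx' => simp only [mul_def, map_add, mul_add] at *; rw [hx, hx']
    | mk b l =>
      let r := Coalgebra.Repr.arbitrary k h
      rw [mk_mul_mk a b h l r, map_sum]
      simp only [liftLin_mk, map_mul]
      rw [mul_assoc, ← mul_assoc (g h), c.eq h b r, Finset.sum_mul, Finset.mul_sum]
      simp only [mul_assoc]

variable (k H A) in
/-- `x ↦ (a ⊗ 1) x`. -/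
def leftA : A →ₐ[k] Module.End k (A ⊗[k] H) :=
  (Module.endTensorEndAlgHom (R := k) (S := k) (A := k) (M := A) (N := H)).comp
    ((Algebra.TensorProduct.includeLeft).comp (Algebra.lmul k A))

theorem mulLeft_eq (x : SmashProduct k H A) :
    mulLeft k H A x = liftLin (leftA k H A) (diagAct k H A H) x := by
  induction x using induction with
  | zero => rw [map_zero, map_zero]; rfl
  | add x x' hx hx' => rw [map_add, map_add, hx, hx']; rfl
  | mk a h => rfl

variable [ModuleAlgebra k H A]

theorem smul_mul_repr (h : H) (a b : A) {ι : Type*} (r : Coalgebra.Repr k h ι) :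
    h • (a * b) = ∑ i ∈ r.index, (r.left i • a) * (r.right i • b) := by
  rw [ModuleAlgebra.smul_mul (k := k), diagAct_repr h a b r]; simp

theorem compat_left : Compat (leftA k H A) (diagAct k H A H) := by
  intro h b
  refine TensorProduct.ext' fun x l => ?_
  let r := Coalgebra.Repr.arbitrary k h
  let a₁ := fun i => Coalgebra.Repr.arbitrary k (r.left i)
  let a₂ := fun i => Coalgebra.Repr.arbitrary k (r.right i)
  have key := Coalgebra.sum_tmul_tmul_eq r a₁ a₂
  let T : H ⊗[k] (H ⊗[k] H) →ₗ[k] A ⊗[k] H :=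
    (LinearMap.rTensor H (LinearMap.mul' k A)) ∘ₗ
      (TensorProduct.assoc k A A H).symm.toLinearMap ∘ₗ
      TensorProduct.map ((Algebra.lsmul k k A).toLinearMap.flip b)
        (TensorProduct.map ((Algebra.lsmul k k A).toLinearMap.flip x)
        ((Algebra.lsmul k k H).toLinearMap.flip l))
  have key2 := congrArg T key
  rw [← r.eq]
  have e1 : ∀ i, (r.left i) • (b * x) = _ := fun i => smul_mul_repr (r.left i) b x (a₁ i)
  have e2 : ∀ i, diagAct k H A H (r.right i) (x ⊗ₜ l) = _ := fun i => diagAct_repr _ x l (a₂ i)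
  simp only [map_sum, T, LinearMap.comp_apply, TensorProduct.map_tmul, LinearEquiv.coe_coe,
    TensorProduct.assoc_symm_tmul, LinearMap.rTensor_tmul, LinearMap.mul'_apply] at key2
  have l1 : ∀ b : A, ∀ x l, leftA k H A b (x ⊗ₜ l) = (b * x) ⊗ₜ l := fun _ _ _ => by
    simp [leftA, Module.endTensorEndAlgHom_apply]
  rw [Module.End.mul_apply, l1, diagAct_repr h _ l r]
  simp only [e1, TensorProduct.sum_tmul]
  simp [l1, LinearMap.sum_apply, e2]
  simpa using key2

theorem one_eq : (1 : SmashProduct k H A) = mk k H A 1 1 := rfl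

theorem leftA_tmul (b x : A) (l : H) : leftA k H A b (x ⊗ₜ l) = (b * x) ⊗ₜ l := by
  simp [leftA, Module.endTensorEndAlgHom_apply]

theorem mulLeft_mul (x y : SmashProduct k H A) :
    mulLeft k H A (x * y) = mulLeft k H A x * mulLeft k H A y := by
  rw [mulLeft_eq, mulLeft_eq, mulLeft_eq]
  exact liftLin_mul (E := Module.End k (A ⊗[k] H)) compat_left x y

instance : Ring (SmashProduct k H A) where
  __ := (inferInstance : AddCommGroup (SmashProduct k H A))
  mul_assoc x y z := by
    change mulLeft k H A (x * y) z = _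
    rw [mulLeft_mul]; rfl
  one_mul x := by
    change mulLeft k H A 1 x = x
    rw [mulLeft_eq, one_eq, liftLin_mk, map_one, map_one]
    rfl
  mul_one x := by
    induction x using induction with
    | zero => rw [mul_def, map_zero]; rfl
    | add x y hx hy =>
      rw [mul_def, map_add, LinearMap.add_apply, ← mul_def, ← mul_def, hx, hy]
    | mk a h =>
      change mk k H A a h * mk k H A 1 1 = _
      let r := Coalgebra.Repr.arbitrary k h
      rw [mk_mul_mk a 1 h 1 r]
      have e := congrArg (fun z => TensorProduct.map (LinearMap.mulLeft k a ∘ₗ Algebra.linearMap k A)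
        (LinearMap.id (M := H)) z) (Coalgebra.sum_counit_tmul_eq r)
      simp only [map_sum, TensorProduct.map_tmul] at e
      simp only [ModuleAlgebra.smul_one (k := k), mul_one]
      refine e.trans ?_
      change (a * algebraMap k A 1) ⊗ₜ[k] h = a ⊗ₜ[k] h
      rw [map_one, mul_one]
  left_distrib x y z := by simp only [mul_def, map_add]
  right_distrib x y z := by simp only [mul_def, map_add, LinearMap.add_apply]
  zero_mul x := by simp only [mul_def, map_zero, LinearMap.zero_apply]
  mul_zero x := by simp only [mul_def, map_zero]

instance : Algebra k (SmashProduct k H A) :=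
  Algebra.ofModule
    (fun c x y => by simp only [mul_def, map_smul, LinearMap.smul_apply])
    (fun c x y => by simp only [mul_def, map_smul])

/-- The algebra map `A # H → E`, `a ⊗ h ↦ f a * g h`, of a compatible pair. -/
def lift {E : Type*} [Ring E] [Algebra k E] (f : A →ₐ[k] E) (g : H →ₐ[k] E) (c : Compat f g) :
    SmashProduct k H A →ₐ[k] E :=
  AlgHom.ofLinearMap (liftLin f g) (by rw [one_eq, liftLin_mk, map_one, map_one, one_mul])
    (liftLin_mul c)

theorem lift_mk {E : Type*} [Ring E] [Algebra k E] (f : A →ₐ[k] E) (g : H →ₐ[k] E)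
    (c : Compat f g) (a : A) (h : H) : lift f g c (mk k H A a h) = f a * g h := rfl

variable (k H A)

/-- The inclusion `A → A # H`, `a ↦ a ⊗ 1`. -/
def inclA : A →ₐ[k] SmashProduct k H A :=
  AlgHom.ofLinearMap ((TensorProduct.mk k A H).flip 1) rfl (fun a b => by
    change mk k H A (a * b) 1 = mk k H A a 1 * mk k H A b 1
    rw [mk_mul_mk a b 1 1 ⟨{()}, fun _ => 1, fun _ => 1, by
      simp [Algebra.TensorProduct.one_def]⟩]
    simp)

/-- The inclusion `H → A # H`, `h ↦ 1 ⊗ h`. -/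
def inclH : H →ₐ[k] SmashProduct k H A :=
  AlgHom.ofLinearMap (TensorProduct.mk k A H 1) rfl (fun h l => by
    change mk k H A 1 (h * l) = mk k H A 1 h * mk k H A 1 l
    let r := Coalgebra.Repr.arbitrary k h
    rw [mk_mul_mk 1 1 h l r]
    have e := congrArg (fun z => TensorProduct.map (Algebra.linearMap k A)
        (LinearMap.mulRight k l) z) (Coalgebra.sum_counit_tmul_eq r)
    simp only [map_sum, TensorProduct.map_tmul] at e
    simp only [ModuleAlgebra.smul_one (k := k), one_mul]
    refine Eq.trans ?_ e.symm
    change (1 : A) ⊗ₜ[k] (h * l) = (algebraMap k A 1) ⊗ₜ[k] (h * l)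
    rw [map_one])

theorem inclA_apply (a : A) : inclA k H A a = mk k H A a 1 := rfl
theorem inclH_apply (h : H) : inclH k H A h = mk k H A 1 h := rfl

theorem inclA_mul_inclH (a : A) (h : H) : inclA k H A a * inclH k H A h = mk k H A a h := by
  rw [inclA_apply, inclH_apply,
    mk_mul_mk a 1 1 h ⟨{()}, fun _ => 1, fun _ => 1, by
      simp [Algebra.TensorProduct.one_def]⟩]
  simp

variable {k H A} in
theorem inclH_mul_inclA (h : H) (b : A) {ι : Type*} (r : Coalgebra.Repr k h ι) :
    inclH k H A h * inclA k H A b = ∑ i ∈ r.index, mk k H A (r.left i • b) (r.right i) := by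
  rw [inclA_apply, inclH_apply, mk_mul_mk 1 b h 1 r]
  simp

/-- The map `h ↦ ∑ (1 ⊗ h₁) ⊗ h₂`. -/
def coactH : H →ₐ[k] SmashProduct k H A ⊗[k] H :=
  (Algebra.TensorProduct.map (inclH k H A) (AlgHom.id k H)).comp (Bialgebra.comulAlgHom k H)

variable {k H A} in
theorem coactH_repr (h : H) {ι : Type*} (r : Coalgebra.Repr k h ι) :
    coactH k H A h = ∑ i ∈ r.index, inclH k H A (r.left i) ⊗ₜ[k] r.right i := by
  simp [coactH, ← r.eq]

theorem compat_coact :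
    Compat ((Algebra.TensorProduct.includeLeft : SmashProduct k H A →ₐ[k]
      SmashProduct k H A ⊗[k] H).comp (inclA k H A)) (coactH k H A) := by
  intro h b
  let r := Coalgebra.Repr.arbitrary k h
  let a₁ := fun i => Coalgebra.Repr.arbitrary k (r.left i)
  let a₂ := fun i => Coalgebra.Repr.arbitrary k (r.right i)
  have key := Coalgebra.sum_tmul_tmul_eq r a₁ a₂
  let T : H ⊗[k] (H ⊗[k] H) →ₗ[k] SmashProduct k H A ⊗[k] H :=
    (TensorProduct.assoc k A H H).symm.toLinearMap ∘ₗ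
      TensorProduct.map ((Algebra.lsmul k k A).toLinearMap.flip b) LinearMap.id
  have hT : ∀ p q s, T (p ⊗ₜ (q ⊗ₜ s)) = mk k H A (p • b) q ⊗ₜ s := fun _ _ _ => rfl
  have key2 := congrArg T key
  simp only [map_sum, hT] at key2
  have e1 : ∀ i, inclH k H A (r.left i) * inclA k H A b = _ :=
    fun i => inclH_mul_inclA (r.left i) b (a₁ i)
  have e2 : ∀ i, coactH k H A (r.right i) = _ := fun i => coactH_repr _ (a₂ i)
  rw [coactH_repr h r, Finset.sum_mul]
  conv_rhs => rw [← r.eq]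
  simp only [AlgHom.comp_apply, Algebra.TensorProduct.includeLeft_apply,
    Algebra.TensorProduct.tmul_mul_tmul, e1, mul_one, TensorProduct.sum_tmul, map_sum,
    TensorProduct.lift.tmul, LinearMap.compl₁₂_apply, LinearMap.comp_apply, AlgHom.toLinearMap_apply,
    LinearMap.mul_apply', LinearMap.flip_apply, Algebra.lsmul_coe, e2, one_mul,
    inclA_mul_inclH]
  exact key2

/-- The coaction `A # H → (A # H) ⊗ H`, `a ⊗ h ↦ ∑ (a ⊗ h₁) ⊗ h₂`. -/
def coaction : SmashProduct k H A →ₐ[k] SmashProduct k H A ⊗[k] H :=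
  lift _ _ (compat_coact k H A)

theorem coaction_repr (a : A) (h : H) {ι : Type*} (r : Coalgebra.Repr k h ι) :
    coaction k H A (mk k H A a h) = ∑ i ∈ r.index, mk k H A a (r.left i) ⊗ₜ[k] r.right i := by
  rw [coaction, lift_mk, coactH_repr h r, Finset.mul_sum]
  simp [inclA_mul_inclH]

theorem compat_reg : Compat (Algebra.lmul k A) (Algebra.lsmul k k A : H →ₐ[k] _) := by
  intro h b
  let r := Coalgebra.Repr.arbitrary k h
  ext x
  rw [← r.eq]
  simp [smul_mul_repr h b x r, LinearMap.sum_apply]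

/-- The action of `A # H` on `A`: `(a ⊗ h) x = a (h x)`. -/
def regAct : SmashProduct k H A →ₐ[k] Module.End k A := lift _ _ (compat_reg k H A)

theorem regAct_mk (a : A) (h : H) (x : A) : regAct k H A (mk k H A a h) x = a * h • x := rfl

end SmashProduct

variable [ModuleAlgebra k H A]

/-- For a module `M` over `B = A # H` and an `H`-module `V`, the action of `B` on `M ⊗ V` through
the coaction: `(a ⊗ h) (m ⊗ v) = ∑ (a ⊗ h₁) m ⊗ h₂ v`. -/
def tensorAct (M V : Type u) [AddCommGroup M] [Module k M] [Module (SmashProduct k H A) M]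
    [IsScalarTower k (SmashProduct k H A) M]
    [AddCommGroup V] [Module k V] [Module H V] [IsScalarTower k H V] :
    SmashProduct k H A →ₐ[k] Module.End k (M ⊗[k] V) :=
  (Module.endTensorEndAlgHom (R := k) (S := k) (A := k) (M := M) (N := V)).comp
    ((Algebra.TensorProduct.map (Algebra.lsmul k k M) (Algebra.lsmul k k V)).comp
      (SmashProduct.coaction k H A))

end ModuleAlgebra

section StableCategory

/-- Two morphisms are identified if their difference factors through a projective object. -/
def stableRel (C : Type*) [Category* C] [Preadditive C] : HomRel C := fun X Y f g =>
  ∃ (Q : C) (_ : Projective Q) (s : X ⟶ Q) (t : Q ⟶ Y), f - g = s ≫ t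

/-- The stable category of `C`. For modules over a self-injective algebra such as `H` the projective
objects are also the injective ones. -/
abbrev StableCategory (C : Type*) [Category* C] [Preadditive C] := CategoryTheory.Quotient (stableRel C)

end StableCategory

section Ungraded

variable (k : Type u) [Field k] (H : Type u) [Ring H] [HopfAlgebra k H]
  (A : Type u) [Ring A] [Algebra k A] [Module H A] [IsScalarTower k H A] [ModuleAlgebra k H A]

/-- The category of left modules over the smash product `A # H`. -/
abbrev BMod := ModuleCat.{u} (SmashProduct k H A)

variable {k H A} in
/-- The `A # H`-module `M ⊗ V`. -/
def tensorObj (M : BMod k H A) (V : ModuleCat.{u} H) : BMod k H A :=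
  letI : Module (SmashProduct k H A) (M ⊗[k] V) :=
    Module.compHom _ (tensorAct k H A M V).toRingHom
  ModuleCat.of (SmashProduct k H A) (M ⊗[k] V)

/-- `A` as an `A # H`-module: `(a ⊗ h) x = a (h x)`. -/
def regA : BMod k H A :=
  letI : Module (SmashProduct k H A) A := Module.compHom _ (SmashProduct.regAct k H A).toRingHom
  ModuleCat.of (SmashProduct k H A) A

/-- The `A # H`-module `A ⊗ V`. -/
abbrev freeObj (V : ModuleCat.{u} H) : BMod k H A := tensorObj (regA k H A) V

/-- Two morphisms of `A # H`-modules are homotopic if their difference factors through a module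
`N ⊗ H`. -/
def homotopyRel : HomRel (BMod k H A) := fun X Y f g =>
  ∃ (N : BMod k H A) (s : X ⟶ tensorObj N (ModuleCat.of H H))
    (t : tensorObj N (ModuleCat.of H H) ⟶ Y), f - g = s ≫ t

/-- The homotopy category of `A # H`-modules. -/
abbrev HomotopyCat := CategoryTheory.Quotient (homotopyRel k H A)

variable {k H A}

/-- Restriction of `A # H`-modules to `H`. -/
abbrev resH : BMod k H A ⥤ ModuleCat.{u} H :=
  ModuleCat.restrictScalars (SmashProduct.inclH k H A).toRingHom

/-- A map is a quasi-isomorphism if it becomes invertible in the stable category of `H`-modules. -/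
def IsQuasiIso {M N : BMod k H A} (f : M ⟶ N) : Prop :=
  IsIso ((CategoryTheory.Quotient.functor (stableRel (ModuleCat.{u} H))).map (resH.map f))

/-- `M` is acyclic if `0 ⟶ M` is a quasi-isomorphism. -/
def IsAcyclic (M : BMod k H A) : Prop :=
  IsQuasiIso (0 : ModuleCat.of (SmashProduct k H A) PUnit.{u + 1} ⟶ M)

/-- An additive map between `A # H`-modules is `A`-linear. -/
def IsALinear {X Y : Type u} [AddCommGroup X] [Module (SmashProduct k H A) X]
    [AddCommGroup Y] [Module (SmashProduct k H A) Y] (s : X →+ Y) : Prop :=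
  ∀ (a : A) (x : X), s (SmashProduct.inclA k H A a • x) = SmashProduct.inclA k H A a • s x

/-- An `H`-module is indecomposable if it is nonzero and not a direct sum of two nonzero
submodules. -/
def IsIndecomposable (V : ModuleCat.{u} H) : Prop :=
  Nontrivial V ∧ ∀ p q : Submodule H V, IsCompl p q → p = ⊥ ∨ q = ⊥

variable (k H A) in
/-- `X` is isomorphic to a direct sum of modules `A ⊗ V` with `V` an indecomposable `H`-module. -/
def IsSumOfFree (X : Type u) [AddCommGroup X] [Module (SmashProduct k H A) X] : Prop :=
  ∃ (J : Type u) (V : J → ModuleCat.{u} H), (∀ j, IsIndecomposable (V j)) ∧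
    Nonempty (X ≃ₗ[SmashProduct k H A] ⨁ j, freeObj k H A (V j))

/-- `P` has an exhaustive filtration `F 0 ≤ F 1 ≤ ⋯` by submodules with `A`-split inclusions such
that `F 0` and all `F (r + 1) / F r` are direct sums of modules `A ⊗ V`, `V` indecomposable. -/
def HasPFiltration (P : BMod k H A) : Prop :=
  ∃ (F : ℕ → Submodule (SmashProduct k H A) P) (hF : ∀ r, F r ≤ F (r + 1)),
    (∀ x : P, ∃ r, x ∈ F r) ∧
    (∀ r, ∃ s : F (r + 1) →+ F r, IsALinear (k := k) (H := H) (A := A) s ∧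
      ∀ x : F r, s (Submodule.inclusion (hF r) x) = x) ∧
    IsSumOfFree k H A (F 0) ∧
    ∀ r, IsSumOfFree k H A (F (r + 1) ⧸ (F r).submoduleOf (F (r + 1)))

/-- Property (P): being isomorphic in the homotopy category to a module with a filtration as in
`HasPFiltration`. -/
def PropertyP (M : BMod k H A) : Prop :=
  ∃ P : BMod k H A, HasPFiltration P ∧
    Nonempty ((CategoryTheory.Quotient.functor (homotopyRel k H A)).obj M ≅
      (CategoryTheory.Quotient.functor (homotopyRel k H A)).obj P)

/-- `0 ⟶ X ⟶ Y ⟶ Z ⟶ 0` is a short exact sequence of `A # H`-modules that splits over `A`. -/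
def IsASplitShortExact {X Y Z : BMod k H A} (f : X ⟶ Y) (g : Y ⟶ Z) : Prop :=
  Function.Injective f ∧ Function.Exact f g ∧ Function.Surjective g ∧
    ∃ s : Y →+ X, IsALinear (k := k) (H := H) (A := A) s ∧ ∀ x, s (f x) = x

end Ungraded

section GradedModules

/-- The degree `n` part of `M ⊗ N`: the span of the `x ⊗ y` with `x` of degree `i`, `y` of degree
`j` and `i + j = n`. -/
def tensorDeg (k : Type u) [Field k] {M N : Type u} [AddCommGroup M] [Module k M]
    [AddCommGroup N] [Module k N] (P : ℤ → Set M) (Q : ℤ → Set N) (n : ℤ) :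
    Submodule k (M ⊗[k] N) :=
  Submodule.span k {z | ∃ i j, i + j = n ∧ ∃ x ∈ P i, ∃ y ∈ Q j, x ⊗ₜ[k] y = z}

/-- A `ℤ`-graded module over an algebra `R` with homogeneous parts `𝓡`. -/
structure GrMod {k : Type u} [Field k] {R : Type u} [Ring R] [Algebra k R]
    (𝓡 : ℤ → Submodule k R) where
  toMod : ModuleCat.{u} R
  deg : ℤ → AddSubgroup toMod
  internal : DirectSum.IsInternal deg
  smul_mem : ∀ {i j : ℤ} {r : R} {m : toMod}, r ∈ 𝓡 i → m ∈ deg j → r • m ∈ deg (i + j)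

namespace GrMod

variable {k : Type u} [Field k] {R : Type u} [Ring R] [Algebra k R] {𝓡 : ℤ → Submodule k R}

/-- The degree preserving module homomorphisms. -/
def homs (M N : GrMod 𝓡) : AddSubgroup (M.toMod ⟶ N.toMod) where
  carrier := {f | ∀ i, ∀ m ∈ M.deg i, f m ∈ N.deg i}
  add_mem' hf hg i m hm := add_mem (hf i m hm) (hg i m hm)
  zero_mem' i _ _ := zero_mem (N.deg i)
  neg_mem' hf i m hm := neg_mem (hf i m hm)

instance : Category (GrMod 𝓡) where
  Hom M N := homs M N
  id M := ⟨𝟙 M.toMod, fun _ _ hm => hm⟩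
  comp f g := ⟨f.1 ≫ g.1, fun i m hm => g.2 i _ (f.2 i m hm)⟩

instance (M N : GrMod 𝓡) : AddCommGroup (M ⟶ N) := inferInstanceAs (AddCommGroup (homs M N))

instance : Preadditive (GrMod 𝓡) where
  add_comp _ _ _ _ _ _ := Subtype.ext (Preadditive.add_comp _ _ _ _ _ _)
  comp_add _ _ _ _ _ _ := Subtype.ext (Preadditive.comp_add _ _ _ _ _ _)

/-- Restriction along a degree preserving ring homomorphism. -/
def restrict {S : Type u} [Ring S] [Algebra k S] {𝓢 : ℤ → Submodule k S} (φ : S →+* R)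
    (hφ : ∀ i, ∀ s ∈ 𝓢 i, φ s ∈ 𝓡 i) : GrMod 𝓡 ⥤ GrMod 𝓢 where
  obj M :=
    { toMod := (ModuleCat.restrictScalars φ).obj M.toMod
      deg := M.deg
      internal := M.internal
      smul_mem := fun hr hm => M.smul_mem (hφ _ _ hr) hm }
  map f := ⟨(ModuleCat.restrictScalars φ).map f.1, f.2⟩

/-- A submodule is homogeneous if it is generated by homogeneous elements. -/
def IsHomogeneous (M : GrMod 𝓡) (p : Submodule R M.toMod) : Prop :=
  ∀ x ∈ p, x ∈ AddSubgroup.closure {y | y ∈ p ∧ ∃ i, y ∈ M.deg i}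

/-- A graded module is indecomposable if it is nonzero and not a direct sum of two nonzero graded
submodules. -/
def IsIndecomposable (V : GrMod 𝓡) : Prop :=
  Nontrivial V.toMod ∧ ∀ p q : Submodule R V.toMod, V.IsHomogeneous p → V.IsHomogeneous q →
    IsCompl p q → p = ⊥ ∨ q = ⊥

theorem isInternal_of {M : Type u} [AddCommGroup M] (D : ℤ → AddSubgroup M) (E : M →+ (ℤ →₀ M))
    (hE : ∀ i, ∀ x ∈ D i, E x = Finsupp.single i x)
    (hD : ∀ x, x ∈ AddSubgroup.closure {y | ∃ i, y ∈ D i}) : DirectSum.IsInternal D := by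
  constructor
  · rw [injective_iff_map_eq_zero]
    intro f hf
    have key : ∀ f : ⨁ i, D i, ∀ i, E (DirectSum.coeAddMonoidHom D f) i = f i := by
      intro f i
      induction f using DirectSum.induction_on with
      | zero => simp
      | of j x =>
        rw [DirectSum.coeAddMonoidHom_of, hE j x x.2]
        by_cases h : j = i
        · subst h; simp
        · rw [Finsupp.single_eq_of_ne (Ne.symm h), DirectSum.of_eq_of_ne _ _ _ (Ne.symm h)]; rfl
      | add f g hf hg => simp [hf, hg]
    ext i
    rw [← key f i, hf]; simp
  · intro x
    have := hD x
    induction this using AddSubgroup.closure_induction with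
    | mem x hx =>
      obtain ⟨i, hi⟩ := hx
      exact ⟨DirectSum.of (fun i => D i) i ⟨x, hi⟩, DirectSum.coeAddMonoidHom_of _ _ _⟩
    | zero => exact ⟨0, map_zero _⟩
    | add x y _ _ hx hy =>
      obtain ⟨f, rfl⟩ := hx; obtain ⟨g, rfl⟩ := hy
      exact ⟨f + g, map_add _ _ _⟩
    | neg x _ hx =>
      obtain ⟨f, rfl⟩ := hx
      exact ⟨-f, map_neg _ _⟩

/-- The zero module. -/
def zero (𝓡 : ℤ → Submodule k R) : GrMod 𝓡 where
  toMod := ModuleCat.of R PUnit.{u + 1}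
  deg _ := ⊥
  internal := isInternal_of _ 0 (fun _ _ _ => Finsupp.ext fun _ => Subsingleton.elim _ _)
    (fun x => by rw [Subsingleton.elim x 0]; exact zero_mem _)
  smul_mem _ _ := rfl

theorem mem_closure (M : GrMod 𝓡) (x : M.toMod) :
    x ∈ AddSubgroup.closure {y | ∃ i, y ∈ M.deg i} := by
  obtain ⟨f, rfl⟩ := M.internal.2 x
  induction f using DirectSum.induction_on with
  | zero => simp
  | of i x => rw [DirectSum.coeAddMonoidHom_of]; exact AddSubgroup.subset_closure ⟨i, x.2⟩
  | add f g hf hg => rw [map_add]; exact add_mem hf hg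

theorem algebraMap_smul_mem [SetLike.GradedOne 𝓡] (M : GrMod 𝓡) (c : k) {i : ℤ} {x : M.toMod}
    (hx : x ∈ M.deg i) : c • x ∈ M.deg i := by
  have h : algebraMap k R c ∈ 𝓡 0 := by
    rw [Algebra.algebraMap_eq_smul_one]; exact Submodule.smul_mem _ _ SetLike.GradedOne.one_mem
  have := M.smul_mem h hx
  rwa [zero_add, algebraMap_smul] at this

theorem exists_components [SetLike.GradedOne 𝓡] (M : GrMod 𝓡) :
    ∃ E : M.toMod →ₗ[k] (ℤ →₀ M.toMod), ∀ i, ∀ x ∈ M.deg i, E x = Finsupp.single i x := by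
  let e := AddEquiv.ofBijective _ M.internal
  let E : M.toMod →+ (ℤ →₀ M.toMod) :=
    (DirectSum.toAddMonoid fun i => (Finsupp.singleAddHom i).comp (M.deg i).subtype).comp
      e.symm.toAddMonoidHom
  have hE : ∀ i, ∀ x ∈ M.deg i, E x = Finsupp.single i x := by
    intro i x hx
    have : e.symm x = DirectSum.of (fun i => M.deg i) i ⟨x, hx⟩ := by
      rw [AddEquiv.symm_apply_eq]
      exact (DirectSum.coeAddMonoidHom_of M.deg i ⟨x, hx⟩).symm
    change DirectSum.toAddMonoid _ (e.symm x) = _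
    rw [this, DirectSum.toAddMonoid_of]; rfl
  refine ⟨{ E with map_smul' := ?_ }, hE⟩
  intro c x
  change E (c • x) = c • E x
  induction M.mem_closure x using AddSubgroup.closure_induction with
  | mem x hx =>
    obtain ⟨i, hi⟩ := hx
    rw [hE i x hi, hE i _ (M.algebraMap_smul_mem c hi), Finsupp.smul_single]
  | zero => simp
  | add x y _ _ hx hy => rw [smul_add, map_add, map_add, hx, hy, smul_add]
  | neg x _ hx => rw [smul_neg, map_neg, map_neg, hx, smul_neg]

theorem tensorDeg_internal {S : Type u} [Ring S] [Algebra k S] {𝓢 : ℤ → Submodule k S}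
    [SetLike.GradedOne 𝓡] [SetLike.GradedOne 𝓢] (M : GrMod 𝓡) (V : GrMod 𝓢) :
    DirectSum.IsInternal fun n =>
      (tensorDeg k (fun i => (M.deg i : Set M.toMod)) (fun i => (V.deg i : Set V.toMod))
        n).toAddSubgroup := by
  obtain ⟨E, hE⟩ := M.exists_components
  obtain ⟨E', hE'⟩ := V.exists_components
  let T : M.toMod ⊗[k] V.toMod →ₗ[k] (ℤ →₀ M.toMod ⊗[k] V.toMod) :=
    Finsupp.lmapDomain _ k (fun p : ℤ × ℤ => p.1 + p.2) ∘ₗ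
      (finsuppTensorFinsupp k k M.toMod V.toMod ℤ ℤ).toLinearMap ∘ₗ TensorProduct.map E E'
  refine isInternal_of _ T.toAddMonoidHom ?_ ?_
  · intro n z hz
    change T z = Finsupp.single n z
    refine Submodule.span_induction (p := fun z _ => T z = Finsupp.single n z) ?_ ?_ ?_ ?_ hz
    · rintro _ ⟨i, j, rfl, x, hx, y, hy, rfl⟩
      simp [T, hE i x hx, hE' j y hy, Finsupp.mapDomain_single]
    · simp
    · intro x y _ _ hx hy; rw [map_add, hx, hy, Finsupp.single_add]
    · intro c x _ hx; rw [map_smul, hx, Finsupp.smul_single]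
  · intro z
    induction z using TensorProduct.induction_on with
    | zero => exact zero_mem _
    | add x y hx hy => exact add_mem hx hy
    | tmul x y =>
      induction M.mem_closure x using AddSubgroup.closure_induction with
      | zero => rw [TensorProduct.zero_tmul]; exact zero_mem _
      | add x y _ _ hx hy => rw [TensorProduct.add_tmul]; exact add_mem hx hy
      | neg x _ hx => rw [TensorProduct.neg_tmul]; exact neg_mem hx
      | mem x hx =>
        obtain ⟨i, hi⟩ := hx
        induction V.mem_closure y using AddSubgroup.closure_induction with
        | zero => rw [TensorProduct.tmul_zero]; exact zero_mem _
        | add x y _ _ hx hy => rw [TensorProduct.tmul_add]; exact add_mem hx hy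
        | neg x _ hx => rw [TensorProduct.tmul_neg]; exact neg_mem hx
        | mem y hy =>
          obtain ⟨j, hj⟩ := hy
          exact AddSubgroup.subset_closure
            ⟨i + j, Submodule.subset_span ⟨i, j, rfl, x, hi, y, hj, rfl⟩⟩

end GrMod

end GradedModules

section Graded

variable {k : Type u} [Field k] {H : Type u} [Ring H] [HopfAlgebra k H]

/-- The grading `𝓗` makes `H` a graded Hopf algebra: all structure maps preserve degrees (for the
algebra structure this is `GradedAlgebra 𝓗`). -/
class IsGradedHopf (𝓗 : ℤ → Submodule k H) [GradedAlgebra 𝓗] : Prop where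
  comul_mem : ∀ n, ∀ h ∈ 𝓗 n, Coalgebra.comul (R := k) h ∈
    tensorDeg k (fun i => (𝓗 i : Set H)) (fun i => (𝓗 i : Set H)) n
  counit_eq_zero : ∀ n, n ≠ 0 → ∀ h ∈ 𝓗 n, Coalgebra.counit (R := k) h = 0
  antipode_mem : ∀ n, ∀ h ∈ 𝓗 n, HopfAlgebra.antipode k h ∈ 𝓗 n

variable {A : Type u} [Ring A] [Algebra k A] [Module H A]

/-- The action of `H` on `A` is compatible with the gradings. -/
class IsGradedAction (𝓗 : ℤ → Submodule k H) (𝓐 : ℤ → Submodule k A) : Prop where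
  smul_mem : ∀ i j, ∀ h ∈ 𝓗 i, ∀ a ∈ 𝓐 j, h • a ∈ 𝓐 (i + j)

variable [IsScalarTower k H A] [ModuleAlgebra k H A]

/-- The degree `n` part of `A # H`: the span of the `a ⊗ h` with `deg a + deg h = n`. -/
def smashDeg (𝓗 : ℤ → Submodule k H) (𝓐 : ℤ → Submodule k A) (n : ℤ) :
    Submodule k (SmashProduct k H A) :=
  Submodule.span k {z | ∃ i j, i + j = n ∧ ∃ a ∈ 𝓐 i, ∃ h ∈ 𝓗 j, SmashProduct.mk k H A a h = z}

variable (𝓗 : ℤ → Submodule k H) [GradedAlgebra 𝓗] (𝓐 : ℤ → Submodule k A) [GradedAlgebra 𝓐]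

theorem mk_mem_smashDeg {i j : ℤ} {a : A} {h : H} (ha : a ∈ 𝓐 i) (hh : h ∈ 𝓗 j) :
    SmashProduct.mk k H A a h ∈ smashDeg 𝓗 𝓐 (i + j) :=
  Submodule.subset_span ⟨i, j, rfl, a, ha, h, hh, rfl⟩

theorem smashDeg_induction {n : ℤ} {p : SmashProduct k H A → Prop} (zero : p 0)
    (mk : ∀ i j, i + j = n → ∀ a ∈ 𝓐 i, ∀ h ∈ 𝓗 j, p (SmashProduct.mk k H A a h))
    (add : ∀ x y, p x → p y → p (x + y)) (smul : ∀ (c : k) x, p x → p (c • x))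
    {b : SmashProduct k H A} (hb : b ∈ smashDeg 𝓗 𝓐 n) : p b := by
  refine Submodule.span_induction (p := fun z _ => p z) ?_ zero (fun x y _ _ => add x y)
    (fun c x _ => smul c x) hb
  rintro _ ⟨i, j, hij, a, ha, h, hh, rfl⟩
  exact mk i j hij a ha h hh

instance : SetLike.GradedOne (smashDeg 𝓗 𝓐) :=
  ⟨mk_mem_smashDeg (i := 0) (j := 0) 𝓗 𝓐 SetLike.GradedOne.one_mem SetLike.GradedOne.one_mem⟩

theorem inclA_mem (i : ℤ) (a : A) (ha : a ∈ 𝓐 i) :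
    SmashProduct.inclA k H A a ∈ smashDeg 𝓗 𝓐 i := by
  simpa [SmashProduct.inclA_apply] using mk_mem_smashDeg 𝓗 𝓐 ha (SetLike.GradedOne.one_mem (A := 𝓗))

theorem inclH_mem (i : ℤ) (h : H) (hh : h ∈ 𝓗 i) :
    SmashProduct.inclH k H A h ∈ smashDeg 𝓗 𝓐 i := by
  simpa [SmashProduct.inclH_apply] using mk_mem_smashDeg 𝓗 𝓐 (SetLike.GradedOne.one_mem (A := 𝓐)) hh

theorem coaction_mem [IsGradedHopf 𝓗] (n : ℤ) (b : SmashProduct k H A)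
    (hb : b ∈ smashDeg 𝓗 𝓐 n) :
    SmashProduct.coaction k H A b ∈
      tensorDeg k (fun i => (smashDeg 𝓗 𝓐 i : Set (SmashProduct k H A)))
        (fun i => (𝓗 i : Set H)) n := by
  refine smashDeg_induction 𝓗 𝓐 (p := fun b => SmashProduct.coaction k H A b ∈
    tensorDeg k (fun i => (smashDeg 𝓗 𝓐 i : Set (SmashProduct k H A)))
      (fun i => (𝓗 i : Set H)) n) ?_ ?_ ?_ ?_ hb
  · rw [map_zero]; exact zero_mem _
  · rintro i j rfl a ha h hh
    let T : H ⊗[k] H →ₗ[k] SmashProduct k H A ⊗[k] H :=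
      LinearMap.rTensor H (TensorProduct.mk k A H a : H →ₗ[k] SmashProduct k H A)
    have hT : SmashProduct.coaction k H A (SmashProduct.mk k H A a h) =
        T (Coalgebra.comul (R := k) h) := by
      let r := Coalgebra.Repr.arbitrary k h
      rw [SmashProduct.coaction_repr k H A a h r, ← r.eq, map_sum]; rfl
    rw [hT]
    refine Submodule.span_induction (p := fun z _ => T z ∈ _) ?_ ?_ ?_ ?_
      (IsGradedHopf.comul_mem j h hh)
    · rintro _ ⟨i', j', rfl, x, hx, y, hy, rfl⟩
      exact Submodule.subset_span
        ⟨i + i', j', add_assoc _ _ _, _, mk_mem_smashDeg 𝓗 𝓐 ha hx, y, hy, rfl⟩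
    · rw [map_zero]; exact zero_mem _
    · intro x y _ _ hx hy; rw [map_add]; exact add_mem hx hy
    · intro c x _ hx; rw [map_smul]; exact Submodule.smul_mem _ _ hx
  · intro x y hx hy; rw [map_add]; exact add_mem hx hy
  · intro c x hx; rw [map_smul]; exact Submodule.smul_mem _ _ hx

/-- The category of graded `A # H`-modules. -/
abbrev GrBMod := GrMod (smashDeg 𝓗 𝓐)

theorem tensorAct_mem [IsGradedHopf 𝓗] (M : GrBMod 𝓗 𝓐) (V : GrMod 𝓗) {i j : ℤ}
    {b : SmashProduct k H A} {z : M.toMod ⊗[k] V.toMod} (hb : b ∈ smashDeg 𝓗 𝓐 i)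
    (hz : z ∈ tensorDeg k (fun i => (M.deg i : Set M.toMod))
      (fun i => (V.deg i : Set V.toMod)) j) :
    tensorAct k H A M.toMod V.toMod b z ∈ tensorDeg k (fun i => (M.deg i : Set M.toMod))
      (fun i => (V.deg i : Set V.toMod)) (i + j) := by
  let D := tensorDeg k (fun i => (M.deg i : Set M.toMod)) (fun i => (V.deg i : Set V.toMod))
  let Φ : SmashProduct k H A ⊗[k] H →ₗ[k] Module.End k (M.toMod ⊗[k] V.toMod) :=
    ((Module.endTensorEndAlgHom (R := k) (S := k) (A := k) (M := M.toMod)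
      (N := V.toMod)).comp
      (Algebra.TensorProduct.map (Algebra.lsmul k k M.toMod)
        (Algebra.lsmul k k V.toMod))).toLinearMap
  have hΦ : ∀ b h x y, Φ (b ⊗ₜ h) (x ⊗ₜ y) = (b • x) ⊗ₜ (h • y) := fun _ _ _ _ => by
    simp [Φ, Module.endTensorEndAlgHom_apply]
  change Φ (SmashProduct.coaction k H A b) z ∈ D (i + j)
  refine Submodule.span_induction (p := fun w _ => Φ w z ∈ D (i + j)) ?_ ?_ ?_ ?_
    (coaction_mem 𝓗 𝓐 i b hb)
  · rintro _ ⟨i₁, i₂, rfl, b, hb, h, hh, rfl⟩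
    refine Submodule.span_induction (p := fun z _ => Φ (b ⊗ₜ h) z ∈ D (i₁ + i₂ + j))
      ?_ ?_ ?_ ?_ hz
    · rintro _ ⟨j₁, j₂, rfl, x, hx, y, hy, rfl⟩
      rw [hΦ]
      exact Submodule.subset_span ⟨i₁ + j₁, i₂ + j₂, by ring, _, M.smul_mem hb hx, _,
        V.smul_mem hh hy, rfl⟩
    · rw [map_zero]; exact zero_mem _
    · intro x y _ _ hx hy; rw [map_add]; exact add_mem hx hy
    · intro c x _ hx; rw [map_smul]; exact Submodule.smul_mem _ _ hx
  · rw [map_zero]; exact zero_mem _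
  · intro x y _ _ hx hy; rw [map_add]; exact add_mem hx hy
  · intro c x _ hx; rw [map_smul]; exact Submodule.smul_mem _ _ hx

variable {𝓗 𝓐}

/-- The graded `A # H`-module `M ⊗ V`. -/
def grTensorObj [IsGradedHopf 𝓗] (M : GrBMod 𝓗 𝓐) (V : GrMod 𝓗) : GrBMod 𝓗 𝓐 where
  toMod := tensorObj M.toMod V.toMod
  deg n := (tensorDeg k (fun i => (M.deg i : Set M.toMod)) (fun i => (V.deg i : Set V.toMod))
        n).toAddSubgroup
  internal := GrMod.tensorDeg_internal M V
  smul_mem hb hz := tensorAct_mem 𝓗 𝓐 M V hb hz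

variable (𝓗) in
/-- `H` as a graded module over itself. -/
def grRegH : GrMod 𝓗 where
  toMod := ModuleCat.of H H
  deg i := (𝓗 i).toAddSubgroup
  internal := DirectSum.Decomposition.isInternal 𝓗
  smul_mem hr hm := SetLike.GradedMul.mul_mem hr hm

variable (𝓗 𝓐) in
/-- `A` as a graded `A # H`-module. -/
def grRegA [IsGradedAction 𝓗 𝓐] : GrBMod 𝓗 𝓐 where
  toMod := regA k H A
  deg i := (𝓐 i).toAddSubgroup
  internal := DirectSum.Decomposition.isInternal 𝓐
  smul_mem := @fun n j b (x : A) hb (hx : x ∈ 𝓐 j) => by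
    change SmashProduct.regAct k H A b x ∈ 𝓐 (n + j)
    refine smashDeg_induction 𝓗 𝓐 (p := fun b => SmashProduct.regAct k H A b x ∈ 𝓐 (n + j))
      ?_ ?_ ?_ ?_ hb
    · rw [map_zero]; exact zero_mem _
    · rintro i i' rfl a ha h hh
      rw [SmashProduct.regAct_mk, add_assoc]
      exact SetLike.GradedMul.mul_mem ha (IsGradedAction.smul_mem i' j h hh x hx)
    · intro x y hx hy; rw [map_add]; exact add_mem hx hy
    · intro c x hx; rw [map_smul]; exact Submodule.smul_mem _ _ hx

variable (𝓗 𝓐) in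
/-- The graded `A # H`-module `A ⊗ V`. -/
abbrev grFreeObj [IsGradedHopf 𝓗] [IsGradedAction 𝓗 𝓐] (V : GrMod 𝓗) : GrBMod 𝓗 𝓐 :=
  grTensorObj (grRegA 𝓗 𝓐) V

variable (𝓗 𝓐) in
/-- Two morphisms of graded `A # H`-modules are homotopic if their difference factors through a
graded module `N ⊗ H`. -/
def grHomotopyRel [IsGradedHopf 𝓗] : HomRel (GrBMod 𝓗 𝓐) := fun X Y f g =>
  ∃ (N : GrBMod 𝓗 𝓐) (s : X ⟶ grTensorObj N (grRegH 𝓗)) (t : grTensorObj N (grRegH 𝓗) ⟶ Y),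
    f - g = s ≫ t

variable (𝓗 𝓐) in
/-- The homotopy category of graded `A # H`-modules. -/
abbrev GrHomotopyCat [IsGradedHopf 𝓗] := CategoryTheory.Quotient (grHomotopyRel 𝓗 𝓐)

/-- Restriction of graded `A # H`-modules to `H`. -/
abbrev grResH : GrBMod 𝓗 𝓐 ⥤ GrMod 𝓗 :=
  GrMod.restrict (SmashProduct.inclH k H A).toRingHom (inclH_mem 𝓗 𝓐)

/-- A map is a quasi-isomorphism if it becomes invertible in the stable category of graded
`H`-modules. -/
def IsGrQuasiIso {M N : GrBMod 𝓗 𝓐} (f : M ⟶ N) : Prop :=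
  IsIso ((CategoryTheory.Quotient.functor (stableRel (GrMod 𝓗))).map (grResH.map f))

/-- `M` is acyclic if `0 ⟶ M` is a quasi-isomorphism. -/
def IsGrAcyclic (M : GrBMod 𝓗 𝓐) : Prop := IsGrQuasiIso (0 : GrMod.zero (smashDeg 𝓗 𝓐) ⟶ M)

variable (𝓗 𝓐) in
/-- `X`, with homogeneous parts `D`, is isomorphic to a direct sum of graded modules `A ⊗ V` with
`V` an indecomposable graded `H`-module. -/
def IsGrSumOfFree [IsGradedHopf 𝓗] [IsGradedAction 𝓗 𝓐] (X : Type u) [AddCommGroup X]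
    [Module (SmashProduct k H A) X] (D : ℤ → Set X) : Prop :=
  ∃ (J : Type u) (V : J → GrMod 𝓗), (∀ j, (V j).IsIndecomposable) ∧
    ∃ e : X ≃ₗ[SmashProduct k H A] ⨁ j, (grFreeObj 𝓗 𝓐 (V j)).toMod,
      ∀ i, ∀ x ∈ D i, ∀ j, e x j ∈ (grFreeObj 𝓗 𝓐 (V j)).deg i

/-- `P` has an exhaustive filtration `F 0 ≤ F 1 ≤ ⋯` by graded submodules with `A`-split inclusions
(by degree preserving retractions) such that `F 0` and all `F (r + 1) / F r` are direct sums of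
graded modules `A ⊗ V`, `V` indecomposable. -/
def HasGrPFiltration [IsGradedHopf 𝓗] [IsGradedAction 𝓗 𝓐] (P : GrBMod 𝓗 𝓐) : Prop :=
  ∃ (F : ℕ → Submodule (SmashProduct k H A) P.toMod) (hF : ∀ r, F r ≤ F (r + 1)),
    (∀ r, P.IsHomogeneous (F r)) ∧
    (∀ x : P.toMod, ∃ r, x ∈ F r) ∧
    (∀ r, ∃ s : F (r + 1) →+ F r, IsALinear (k := k) (H := H) (A := A) s ∧
      (∀ i, ∀ x : F (r + 1), (x : P.toMod) ∈ P.deg i → (s x : P.toMod) ∈ P.deg i) ∧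
      ∀ x : F r, s (Submodule.inclusion (hF r) x) = x) ∧
    IsGrSumOfFree 𝓗 𝓐 (F 0) (fun i => {x | (x : P.toMod) ∈ P.deg i}) ∧
    ∀ r, IsGrSumOfFree 𝓗 𝓐 (F (r + 1) ⧸ (F r).submoduleOf (F (r + 1)))
      (fun i => Submodule.Quotient.mk '' {x | (x : P.toMod) ∈ P.deg i})

/-- Graded property (P): being isomorphic in the graded homotopy category to a module with a
filtration as in `HasGrPFiltration`. -/
def GrPropertyP [IsGradedHopf 𝓗] [IsGradedAction 𝓗 𝓐] (M : GrBMod 𝓗 𝓐) : Prop :=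
  ∃ P : GrBMod 𝓗 𝓐, HasGrPFiltration P ∧
    Nonempty ((CategoryTheory.Quotient.functor (grHomotopyRel 𝓗 𝓐)).obj M ≅
      (CategoryTheory.Quotient.functor (grHomotopyRel 𝓗 𝓐)).obj P)

/-- `0 ⟶ X ⟶ Y ⟶ Z ⟶ 0` is a short exact sequence of graded `A # H`-modules that splits as a
sequence of graded `A`-modules. -/
def IsGrASplitShortExact {X Y Z : GrBMod 𝓗 𝓐} (f : X ⟶ Y) (g : Y ⟶ Z) : Prop :=
  Function.Injective f.1 ∧ Function.Exact f.1 g.1 ∧ Function.Surjective g.1 ∧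
    ∃ s : Y.toMod →+ X.toMod, IsALinear (k := k) (H := H) (A := A) s ∧
      (∀ i, ∀ y ∈ Y.deg i, s y ∈ X.deg i) ∧ ∀ x, s (f.1 x) = x

end Graded

end Hopfological

end

open Hopfological

/-!
# Acyclic envelopes of modules over a smash product

The sequence `0 → M → 𝐚M → 𝐩̃M → 0` comes from a small object argument that makes the restriction
of `M` to `H` injective by attaching cells of the form `A ⊗ C`.

For a finitely generated graded `H`-submodule `W` of a graded `A # H`-module `G`, the coinduced
module `Coind W = Hom_k(H, W)` contains `W`, and every `H`-linear map from a left ideal to `W`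
extends to a map `H → Coind W` (`GrMod.exists_extension_coind`). Let `U ⊂ C` be the direct sums of
all `W` and of all `Coind W`; they depend functorially on `G`. The functor `step` sends `G` to the
pushout of `G ← A ⊗ U → A ⊗ C`, where the left map is `a ⊗ w ↦ a w`. The inclusion `G ⟶ step G` has
three properties.

* It has a retraction over `A`, because evaluation at `1` is a `k`-linear retraction of
  `W → Coind W`, and `A` acts on `A ⊗ C` through the first factor only.
* Its cokernel is `A ⊗ (C / U)`, and `C / U` is a direct sum of finite dimensional modules
  `Coind W / W`, hence of indecomposable ones (`GrMod.exists_env_decomposition`). This is why the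
  construction uses the finitely generated submodules instead of the whole of `G`: arbitrary
  `H`-modules need not be direct sums of indecomposable ones.
* Every `H`-linear map from a left ideal of `H` to `G` extends to a map `H → step G`
  (`exists_extension_step`).

The first two properties are `isCellular_stepIn`. Now `𝐚M` is the colimit of the iterates of `step`
and `𝐩̃M = 𝐚M / M`, filtered by the images of the iterates (`hasGrPFiltration_colimQuot`). A left
ideal of `H` is finitely generated, so that a map from it to `𝐚M` lands in some iterate and extends
to `H` in the next one; by Baer's criterion `𝐚M` is injective over `H` (`injective_acObj`). A finite
dimensional Hopf algebra has a nonzero integral, and with it every injective module embeds in a free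
one, so `𝐚M` is projective over `H` (`projective_of_injective`), also as a graded module
(`GrMod.projective_of_module`). Therefore its identity is zero in the stable category.

The ungraded statement is the graded one for gradings concentrated in degree `0`: a graded module
over such an `H` is the direct sum of its homogeneous parts, so an indecomposable one lives in a
single degree and is indecomposable without its grading (`isIndecomposable_toMod`).
-/

noncomputable section

namespace Hopfological

/-! ### Integrals in finite dimensional Hopf algebras -/

section Integral

open Coalgebra HopfAlgebra LinearMap

variable {k : Type u} [Field k] {H : Type u} [Ring H] [HopfAlgebra k H]

/-- `∑ (S(z₁) ⊗ 1) Δ(z₂) = 1 ⊗ z`. -/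
theorem sum_antipode_tmul_mul_comul (z : H) {ι : Type*} (r : Repr k z ι) :
    ∑ i ∈ r.index, (antipode k (r.left i) ⊗ₜ[k] (1 : H)) * comul (R := k) (r.right i) =
      1 ⊗ₜ[k] z := by
  let a₁ := fun i => Repr.arbitrary k (r.left i)
  let a₂ := fun i => Repr.arbitrary k (r.right i)
  let K : H ⊗[k] (H ⊗[k] H) →ₗ[k] H ⊗[k] H :=
    LinearMap.rTensor H (LinearMap.mul' k H ∘ₗ LinearMap.rTensor H (antipode k)) ∘ₗ
      (TensorProduct.assoc k H H H).symm.toLinearMap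
  have hK : ∀ a b c, K (a ⊗ₜ (b ⊗ₜ c)) = (antipode k a * b) ⊗ₜ c := fun _ _ _ => rfl
  have key := congrArg K (sum_tmul_tmul_eq r a₁ a₂)
  simp only [map_sum, hK] at key
  have e : ∀ i, comul (R := k) (r.right i) = _ := fun i => ((a₂ i).eq).symm
  simp only [e, Finset.mul_sum, Algebra.TensorProduct.tmul_mul_tmul, one_mul]
  rw [← key]
  simp only [← TensorProduct.sum_tmul, sum_antipode_mul_eq_algebraMap_counit]
  simp only [Algebra.algebraMap_eq_smul_one, TensorProduct.smul_tmul, ← TensorProduct.tmul_sum,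
    sum_counit_smul]

/-- The antipode reverses the comultiplication: both sides are inverse to the comultiplication in
the convolution algebra of linear maps `H → H ⊗ H`. -/
theorem comul_antipode (z : H) :
    comul (R := k) (antipode k z) =
      TensorProduct.comm k H H (TensorProduct.map (antipode k) (antipode k) (comul z)) := by
  let G : H →ₗ[k] H ⊗[k] H := (TensorProduct.comm k H H).toLinearMap ∘ₗ
    TensorProduct.map (antipode k) (antipode k) ∘ₗ comul
  suffices h : WithConv.toConv G = WithConv.toConv (comul ∘ₗ antipode k) from
    (LinearMap.congr_fun (WithConv.toConv_injective h) z).symm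
  refine left_inv_eq_right_inv (a := WithConv.toConv (comul (R := k) (A := H))) ?_
    LinearMap.comul_right_inv
  ext z
  let r := Repr.arbitrary k z
  let a₁ := fun i => Repr.arbitrary k (r.left i)
  let a₂ := fun i => Repr.arbitrary k (r.right i)
  let K : H ⊗[k] (H ⊗[k] H) →ₗ[k] H ⊗[k] H :=
    LinearMap.mul' k (H ⊗[k] H) ∘ₗ TensorProduct.map
      ((TensorProduct.comm k H H).toLinearMap ∘ₗ TensorProduct.map (antipode k) (antipode k)) comul
      ∘ₗ (TensorProduct.assoc k H H H).symm.toLinearMap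
  have hK : ∀ a b c, K (a ⊗ₜ (b ⊗ₜ c)) = (antipode k b ⊗ₜ antipode k a) * comul c :=
    fun _ _ _ => rfl
  have key := congrArg K (sum_tmul_tmul_eq r a₁ a₂)
  simp only [map_sum, hK] at key
  rw [r.convMul_apply]
  have e : ∀ i, G (r.left i) = ∑ j ∈ (a₁ i).index,
      antipode k ((a₁ i).right j) ⊗ₜ antipode k ((a₁ i).left j) := fun i => by
    simp only [G, LinearMap.comp_apply, ← (a₁ i).eq, map_sum]; rfl
  simp only [e, Finset.sum_mul]
  rw [key]
  have e2 : ∀ i, ∑ j ∈ (a₂ i).index, (antipode k ((a₂ i).left j) ⊗ₜ[k] antipode k (r.left i)) *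
      comul ((a₂ i).right j) = (1 : H) ⊗ₜ[k] (antipode k (r.left i) * r.right i) := fun i => by
    have := congrArg (fun t => ((1 : H) ⊗ₜ[k] antipode k (r.left i)) * t)
      (sum_antipode_tmul_mul_comul (r.right i) (a₂ i))
    simpa only [Finset.mul_sum, ← mul_assoc, Algebra.TensorProduct.tmul_mul_tmul, one_mul, mul_one]
      using this
  simp only [e2, ← TensorProduct.tmul_sum, sum_antipode_mul_eq_algebraMap_counit]
  simp [Algebra.algebraMap_eq_smul_one, Algebra.TensorProduct.one_def]

/-- The right action of `H*` on `H` given by `z ◁ f = ∑ f (S z₂) z₁`. -/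
def dualAct (f : H →ₗ[k] k) : H →ₗ[k] H :=
  (TensorProduct.rid k H).toLinearMap ∘ₗ LinearMap.lTensor H (f ∘ₗ antipode k) ∘ₗ comul

theorem dualAct_repr (f : H →ₗ[k] k) (z : H) {ι : Type*} (r : Repr k z ι) :
    dualAct f z = ∑ i ∈ r.index, f (antipode k (r.right i)) • r.left i := by
  simp [dualAct, ← r.eq]

/-- `h (z ◁ f) = ∑ (h₁ z) ◁ f(- h₂)`. -/
theorem mul_dualAct (f : H →ₗ[k] k) (h z : H) {ι : Type*} (r : Repr k h ι) :
    h * dualAct f z =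
      ∑ i ∈ r.index, dualAct (f ∘ₗ LinearMap.mulRight k (r.right i)) (r.left i * z) := by
  let a₁ := fun i => Repr.arbitrary k (r.left i)
  let a₂ := fun i => Repr.arbitrary k (r.right i)
  let s := Repr.arbitrary k z
  let K : H ⊗[k] (H ⊗[k] H) →ₗ[k] H := ∑ m ∈ s.index,
    (TensorProduct.rid k H).toLinearMap ∘ₗ TensorProduct.map (LinearMap.mulRight k (s.left m))
      (f ∘ₗ LinearMap.mulLeft k (antipode k (s.right m)) ∘ₗ LinearMap.mul' k H ∘ₗ
        LinearMap.rTensor H (antipode k))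
  have hK : ∀ a b c, K (a ⊗ₜ (b ⊗ₜ c)) = ∑ m ∈ s.index,
      f (antipode k (s.right m) * (antipode k b * c)) • (a * s.left m) := fun _ _ _ => by
    simp [K, LinearMap.sum_apply]
  have key := congrArg K (sum_tmul_tmul_eq r a₁ a₂)
  simp only [map_sum, hK] at key
  have e : ∀ i, dualAct (f ∘ₗ LinearMap.mulRight k (r.right i)) (r.left i * z) =
      ∑ j ∈ (a₁ i).index, ∑ m ∈ s.index, f (antipode k (s.right m) *
        (antipode k ((a₁ i).right j) * r.right i)) • ((a₁ i).left j * s.left m) := fun i => by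
    rw [dualAct_repr _ _ ((a₁ i).mul s)]
    simp [Finset.sum_product, antipode_mul_antidistrib, mul_assoc]
  simp only [e]
  rw [key, dualAct_repr f z s, Finset.mul_sum]
  simp only [Finset.sum_comm (t := s.index)]
  refine Finset.sum_congr rfl fun m _ => ?_
  simp only [← Finset.sum_smul, ← map_sum, ← Finset.mul_sum, sum_antipode_mul_eq_algebraMap_counit]
  simp only [Algebra.algebraMap_eq_smul_one, mul_smul_comm, map_smul, mul_one, smul_eq_mul,
    mul_comm (counit _)]
  simp only [← smul_smul, ← Finset.smul_sum, ← smul_mul_assoc, ← Finset.sum_mul]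
  congr 2
  have := congrArg (TensorProduct.rid k H) (sum_tmul_counit_eq r)
  simp only [map_sum, TensorProduct.rid_tmul, one_smul] at this
  exact this.symm

/-- `(z ◁ f) ◁ g = z ◁ (f * g)` for the convolution product `f * g`. -/
theorem dualAct_dualAct (f g : H →ₗ[k] k) (z : H) :
    dualAct g (dualAct f z) =
      dualAct (LinearMap.mul' k k ∘ₗ TensorProduct.map f g ∘ₗ comul) z := by
  let r := Repr.arbitrary k z
  let a₁ := fun i => Repr.arbitrary k (r.left i)
  let a₂ := fun i => Repr.arbitrary k (r.right i)
  let K : H ⊗[k] (H ⊗[k] H) →ₗ[k] H := (TensorProduct.rid k H).toLinearMap ∘ₗ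
    LinearMap.lTensor H (LinearMap.mul' k k ∘ₗ
      TensorProduct.map (g ∘ₗ antipode k) (f ∘ₗ antipode k))
  have hK : ∀ a b c, K (a ⊗ₜ (b ⊗ₜ c)) = (g (antipode k b) * f (antipode k c)) • a :=
    fun _ _ _ => by simp [K]
  have key := congrArg K (sum_tmul_tmul_eq r a₁ a₂)
  simp only [map_sum, hK] at key
  rw [dualAct_repr f z r, dualAct_repr _ z r, map_sum]
  have e : ∀ i, dualAct g (r.left i) = _ := fun i => dualAct_repr g _ (a₁ i)
  have e2 : ∀ i, (LinearMap.mul' k k ∘ₗ TensorProduct.map f g ∘ₗ comul) (antipode k (r.right i)) =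
      ∑ j ∈ (a₂ i).index, g (antipode k ((a₂ i).left j)) * f (antipode k ((a₂ i).right j)) :=
    fun i => by
      simp only [LinearMap.comp_apply, comul_antipode, ← (a₂ i).eq, map_sum]
      simp [mul_comm]
  simp only [map_smul, e, e2, Finset.sum_smul, Finset.smul_sum, smul_smul]
  rw [← key]
  simp only [mul_comm]

/-- A nonzero left integral of a finite dimensional Hopf algebra (Larson and Sweedler). In the
basis `b` of `H` with coordinates `b*`, the elements `∑ᵢ (S(bᵢ) x) ◁ bᵢ*` are left integrals, and
`1 = ∑ⱼ (∑ᵢ (S(bᵢ) bⱼ) ◁ bᵢ*) ◁ bⱼ*`, so that they are not all zero. -/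
theorem exists_left_integral [FiniteDimensional k H] :
    ∃ Λ : H, Λ ≠ 0 ∧ ∀ h : H, h * Λ = counit (R := k) h • Λ := by
  let b := Module.finBasis k H
  have expand : ∀ y, y = ∑ i, b.coord i y • b i := fun y => (b.sum_repr y).symm
  have expand' : ∀ f : H →ₗ[k] k, f = ∑ i, f (b i) • b.coord i := fun f =>
    b.ext fun j => by simp
  let D : (H →ₗ[k] k) →ₗ[k] H →ₗ[k] H :=
    { toFun := dualAct
      map_add' := fun f g => by
        simp [dualAct, LinearMap.add_comp, LinearMap.lTensor_add, LinearMap.comp_add]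
      map_smul' := fun c g => by
        simp [dualAct, LinearMap.smul_comp, LinearMap.lTensor_smul, LinearMap.comp_smul] }
  have hD : ∀ f z, dualAct f z = D f z := fun _ _ => rfl
  let P : H → H := fun x => ∑ i, dualAct (b.coord i) (antipode k (b i) * x)
  have hP : ∀ x h, h * P x = counit (R := k) h • P x := by
    intro x h
    let r := Repr.arbitrary k h
    have e : ∀ i, h * dualAct (b.coord i) (antipode k (b i) * x) = _ :=
      fun i => mul_dualAct (b.coord i) h _ r
    simp only [P, Finset.mul_sum, e]
    rw [Finset.sum_comm]
    have e2 : ∀ m, ∑ i, dualAct (b.coord i ∘ₗ LinearMap.mulRight k (r.right m))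
        (r.left m * (antipode k (b i) * x)) = ∑ j, dualAct (b.coord j)
          ((r.left m * antipode k (r.right m)) * (antipode k (b j) * x)) := by
      intro m
      calc _ = ∑ i, ∑ j, b.coord i (b j * r.right m) • dualAct (b.coord j)
              (r.left m * (antipode k (b i) * x)) := by
            refine Finset.sum_congr rfl fun i _ => ?_
            conv_lhs => rw [expand' (b.coord i ∘ₗ _)]
            simp only [hD, map_sum, map_smul, LinearMap.sum_apply, LinearMap.smul_apply]
            rfl
        _ = _ := by
            rw [Finset.sum_comm]
            refine Finset.sum_congr rfl fun j _ => ?_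
            simp only [← map_smul, ← map_sum, ← mul_smul_comm, ← Finset.mul_sum]
            simp only [mul_smul_comm, ← smul_mul_assoc, ← Finset.sum_mul, ← map_smul, ← map_sum]
            rw [← expand, antipode_mul_antidistrib]
            simp only [mul_assoc]
    simp only [e2]
    rw [Finset.sum_comm, Finset.smul_sum]
    refine Finset.sum_congr rfl fun j _ => ?_
    rw [← map_sum, ← Finset.sum_mul, sum_mul_antipode_eq_algebraMap_counit,
      Algebra.algebraMap_eq_smul_one, smul_mul_assoc, one_mul, map_smul]
  -- If there is no nonzero left integral, all `P x` vanish, and the expansion of `1` gives `1 = 0`.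
  by_contra! hne
  have hP0 : ∀ x, P x = 0 := fun x => by
    by_contra h
    obtain ⟨h', hh'⟩ := hne _ h
    exact hh' (hP x h')
  have one : (1 : H) = ∑ j, dualAct (b.coord j) (P (b j)) := by

    have e : ∀ j, dualAct (b.coord j) (P (b j)) = ∑ i, dualAct
        (LinearMap.mul' k k ∘ₗ TensorProduct.map (b.coord i) (b.coord j) ∘ₗ comul)
          (antipode k (b i) * b j) := fun j => by
      simp only [P, map_sum, dualAct_dualAct]
    have e2 : ∀ i j, dualAct
        (LinearMap.mul' k k ∘ₗ TensorProduct.map (b.coord i) (b.coord j) ∘ₗ comul)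
          (antipode k (b i) * b j) = ∑ l, ∑ m ∈ (Repr.arbitrary k (b l)).index,
        (b.coord i ((Repr.arbitrary k (b l)).left m) *
          b.coord j ((Repr.arbitrary k (b l)).right m)) • dualAct (b.coord l)
            (antipode k (b i) * b j) := fun i j => by
      rw [expand' (LinearMap.mul' k k ∘ₗ _)]
      simp only [hD, map_sum, map_smul, LinearMap.sum_apply, LinearMap.smul_apply]
      refine Finset.sum_congr rfl fun l _ => ?_
      rw [← Finset.sum_smul]
      congr 1
      simp only [LinearMap.comp_apply]
      conv_lhs => rw [← (Repr.arbitrary k (b l)).eq]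
      simp
    have e3 : ∀ l m, ∑ i, ∑ j, (b.coord i ((Repr.arbitrary k (b l)).left m) *
          b.coord j ((Repr.arbitrary k (b l)).right m)) • dualAct (b.coord l)
            (antipode k (b i) * b j) = dualAct (b.coord l)
          (antipode k ((Repr.arbitrary k (b l)).left m) * (Repr.arbitrary k (b l)).right m) := by
      intro l m
      conv_rhs => rw [expand ((Repr.arbitrary k (b l)).left m),
        expand ((Repr.arbitrary k (b l)).right m)]
      simp only [map_sum, map_smul, Finset.sum_mul, Finset.mul_sum, smul_mul_smul_comm]
      exact Finset.sum_comm
    have e4 : ∀ l, ∑ m ∈ (Repr.arbitrary k (b l)).index, dualAct (b.coord l)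
          (antipode k ((Repr.arbitrary k (b l)).left m) * (Repr.arbitrary k (b l)).right m) =
        counit (R := k) (b l) • dualAct (b.coord l) 1 := by
      intro l
      rw [← map_sum, sum_antipode_mul_eq_algebraMap_counit, Algebra.algebraMap_eq_smul_one,
        map_smul]
    simp only [e, e2]
    calc (1 : H) = dualAct counit 1 := by
          simp [dualAct, Bialgebra.comul_one, Algebra.TensorProduct.one_def]
      _ = ∑ l, counit (R := k) (b l) • dualAct (b.coord l) 1 := by
          conv_lhs => rw [expand' (counit (R := k) (A := H))]
          simp only [hD, map_sum, map_smul, LinearMap.sum_apply, LinearMap.smul_apply]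
      _ = _ := by
          simp only [← e4, ← e3]
          have swap : ∀ l, ∀ F : H × H → Fin (Module.finrank k H) → Fin (Module.finrank k H) → H,
              ∑ m ∈ (Repr.arbitrary k (b l)).index, ∑ i, ∑ j, F m i j =
                ∑ j, ∑ i, ∑ m ∈ (Repr.arbitrary k (b l)).index, F m i j := fun l F => by
            rw [Finset.sum_comm, Finset.sum_comm (s := (Finset.univ : Finset (Fin _)))]
            rw [Finset.sum_comm]
            simp only [Finset.sum_comm (s := (Repr.arbitrary k (b l)).index)]
            exact Finset.sum_comm
          simp only [swap]
          rw [Finset.sum_comm]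
          refine Finset.sum_congr rfl fun j _ => Finset.sum_comm
  have h0 : (1 : H) = 0 := by rw [one]; simp [hP0]
  have := congrArg (counit (R := k)) h0
  simp at this

/-- For a left integral `Λ`, the element `∑ Λ₁ ⊗ S Λ₂` of `H ⊗ H` commutes with `H`. -/
theorem casimir_comm {Λ : H} (hΛ : ∀ h : H, h * Λ = counit (R := k) h • Λ) (h : H) :
    TensorProduct.map (LinearMap.mulLeft k h) (antipode k) (comul (R := k) Λ) =
      TensorProduct.map LinearMap.id (LinearMap.mulRight k h ∘ₗ antipode k)
        (comul (R := k) Λ) := by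
  let r := Repr.arbitrary k h
  let a₁ := fun i => Repr.arbitrary k (r.left i)
  let a₂ := fun i => Repr.arbitrary k (r.right i)
  let s := Repr.arbitrary k Λ
  let K : H ⊗[k] (H ⊗[k] H) →ₗ[k] H ⊗[k] H := ∑ m ∈ s.index,
    TensorProduct.map (LinearMap.mulRight k (s.left m))
      (LinearMap.mulLeft k (antipode k (s.right m)) ∘ₗ LinearMap.mul' k H ∘ₗ
        LinearMap.rTensor H (antipode k))
  have hK : ∀ a b c, K (a ⊗ₜ (b ⊗ₜ c)) = ∑ m ∈ s.index,
      (a * s.left m) ⊗ₜ (antipode k (s.right m) * (antipode k b * c)) := fun _ _ _ => by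
    simp [K, LinearMap.sum_apply]
  have key := congrArg K (sum_tmul_tmul_eq r a₁ a₂)
  simp only [map_sum, hK] at key
  have lhs : ∀ i, ∑ j ∈ (a₁ i).index, ∑ m ∈ s.index, ((a₁ i).left j * s.left m) ⊗ₜ[k]
      (antipode k (s.right m) * (antipode k ((a₁ i).right j) * r.right i)) =
      counit (R := k) (r.left i) • ∑ m ∈ s.index,
        s.left m ⊗ₜ[k] (antipode k (s.right m) * r.right i) := fun i => by
    have := congrArg (TensorProduct.map LinearMap.id (LinearMap.mulRight k (r.right i) ∘ₗ
      antipode k)) (congrArg (comul (R := k)) (hΛ (r.left i)))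
    rw [← ((a₁ i).mul s).eq, map_smul, ← s.eq] at this
    simpa [Finset.sum_product, antipode_mul_antidistrib, mul_assoc] using this
  have rhs : ∀ i, ∑ j ∈ (a₂ i).index, ∑ m ∈ s.index, (r.left i * s.left m) ⊗ₜ[k]
      (antipode k (s.right m) * (antipode k ((a₂ i).left j) * (a₂ i).right j)) =
      ∑ m ∈ s.index, (counit (R := k) (r.right i) • r.left i * s.left m) ⊗ₜ[k]
        antipode k (s.right m) := fun i => by
    rw [Finset.sum_comm]
    refine Finset.sum_congr rfl fun m _ => ?_
    rw [← TensorProduct.tmul_sum, ← Finset.mul_sum, sum_antipode_mul_eq_algebraMap_counit,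
      Algebra.algebraMap_eq_smul_one, mul_smul_comm, mul_one, smul_mul_assoc,
      TensorProduct.smul_tmul]
  simp only [lhs, rhs] at key
  rw [Finset.sum_comm] at key
  simp only [← TensorProduct.sum_tmul, ← Finset.sum_mul] at key
  have e1 : ∑ i ∈ r.index, counit (R := k) (r.right i) • r.left i = h := by
    have := congrArg (TensorProduct.rid k H) (sum_tmul_counit_eq r)
    simpa only [map_sum, TensorProduct.rid_tmul, one_smul] using this
  simp only [Finset.smul_sum, e1] at key
  rw [Finset.sum_comm] at key
  simp only [← TensorProduct.tmul_smul, ← TensorProduct.tmul_sum, ← mul_smul_comm,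
    ← Finset.mul_sum, sum_counit_smul] at key
  rw [← s.eq]
  simpa using key.symm

/-- Over a finite dimensional Hopf algebra, injective modules are projective: for a nonzero left
integral `Λ` the `H`-linear map `x ↦ ∑ Λ₁ ⊗ S(Λ₂) x` embeds a module `E` into the free module
`H ⊗ E`. -/
theorem projective_of_injective [FiniteDimensional k H] (E : Type u) [AddCommGroup E]
    [Module k E] [Module H E] [IsScalarTower k H E] [Module.Injective H E] :
    Module.Projective H E := by
  obtain ⟨Λ, hΛ0, hΛ⟩ := exists_left_integral (k := k) (H := H)
  let ev : E → H ⊗[k] H →ₗ[k] H ⊗[k] E := fun x =>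
    LinearMap.lTensor H ((Algebra.lsmul k k E).toLinearMap.flip x ∘ₗ antipode k)
  have hev : ∀ x a b, ev x (a ⊗ₜ b) = a ⊗ₜ (antipode k b • x) := fun _ _ _ => rfl
  let j : E →ₗ[H] H ⊗[k] E :=
    { toFun := fun x => ev x (comul Λ)
      map_add' := fun x y => by
        rw [← LinearMap.add_apply]
        congr 1
        ext a b
        simp [hev, TensorProduct.tmul_add]
      map_smul' := fun h x => by
        let T : H ⊗[k] H →ₗ[k] H ⊗[k] E :=
          LinearMap.lTensor H ((Algebra.lsmul k k E).toLinearMap.flip x)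
        have := congrArg T (casimir_comm hΛ h)
        let s := Repr.arbitrary k Λ
        simp only [← s.eq, map_sum, TensorProduct.map_tmul] at this
        simp only [← s.eq, map_sum, RingHom.id_apply, hev, Finset.smul_sum,
          TensorProduct.smul_tmul']
        refine Eq.trans ?_ this.symm
        refine Finset.sum_congr rfl fun i _ => ?_
        simp [T] }
  -- `h ⊗ x ↦ ∑ h₁ ⊗ h₂ x` sends `j x` to `Λ ⊗ x`.
  let U : H ⊗[k] E →ₗ[k] H ⊗[k] E :=
    LinearMap.lTensor H (TensorProduct.lift (Algebra.lsmul k k E).toLinearMap) ∘ₗ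
      (TensorProduct.assoc k H H E).toLinearMap ∘ₗ LinearMap.rTensor E comul
  have hU : ∀ x, U (j x) = Λ ⊗ₜ x := by
    intro x
    let s := Repr.arbitrary k Λ
    let a₁ := fun i => Repr.arbitrary k (s.left i)
    let a₂ := fun i => Repr.arbitrary k (s.right i)
    let K : H ⊗[k] (H ⊗[k] H) →ₗ[k] H ⊗[k] E :=
      LinearMap.lTensor H ((Algebra.lsmul k k E).toLinearMap.flip x ∘ₗ LinearMap.mul' k H ∘ₗ
        LinearMap.lTensor H (antipode k))
    have hK : ∀ a b c, K (a ⊗ₜ (b ⊗ₜ c)) = a ⊗ₜ ((b * antipode k c) • x) := fun _ _ _ => rfl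
    have key := congrArg K (sum_tmul_tmul_eq s a₁ a₂)
    simp only [map_sum, hK] at key
    have e : ∀ i (y : E), U (s.left i ⊗ₜ y) = ∑ j ∈ (a₁ i).index,
        (a₁ i).left j ⊗ₜ ((a₁ i).right j • y) := fun i y => by
      simp [U, ← (a₁ i).eq, TensorProduct.sum_tmul]
    have : j x = ∑ i ∈ s.index, s.left i ⊗ₜ (antipode k (s.right i) • x) := by
      change ev x (comul Λ) = _
      simp [← s.eq, hev]
    rw [this, map_sum]
    simp only [e, smul_smul]
    rw [key]
    simp only [← TensorProduct.tmul_sum, ← Finset.sum_smul, sum_mul_antipode_eq_algebraMap_counit,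
      algebraMap_smul, ← TensorProduct.smul_tmul]
    rw [← TensorProduct.sum_tmul]
    congr 1
    have := congrArg (TensorProduct.rid k H) (sum_tmul_counit_eq s)
    simpa only [map_sum, TensorProduct.rid_tmul, one_smul] using this
  have hj : Function.Injective j := by
    rw [injective_iff_map_eq_zero]
    intro x hx
    have h0 : Λ ⊗ₜ[k] x = 0 := by rw [← hU, hx, map_zero]
    obtain ⟨f, hf⟩ : ∃ f : Module.Dual k H, f Λ ≠ 0 := by
      by_contra! h
      exact hΛ0 ((Module.forall_dual_apply_eq_zero_iff k Λ).1 h)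
    have := congrArg (TensorProduct.lid k E) (congrArg (LinearMap.rTensor E f) h0)
    rw [LinearMap.rTensor_tmul, TensorProduct.lid_tmul, map_zero, map_zero] at this
    exact (smul_eq_zero.1 this).resolve_left hf
  have : Module.Free H (H ⊗[k] E) :=
    Module.Free.of_basis (Algebra.TensorProduct.basis H (Module.Free.chooseBasis k E))
  obtain ⟨q, hq⟩ := Module.Injective.out j hj (LinearMap.id : E →ₗ[H] E)
  exact Module.Projective.of_split j q (LinearMap.ext hq)

end Integral

/-! ### Graded modules: projections, cokernels, sums and projectives -/

namespace GrMod

variable {k : Type u} [Field k] {R : Type u} [Ring R] [Algebra k R] {𝓡 : ℤ → Submodule k R}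

/-- The linear map underlying a morphism of graded modules. -/
abbrev lin {M N : GrMod 𝓡} (f : M ⟶ N) : M.toMod →ₗ[R] N.toMod := f.1.hom

/-- The morphism of graded modules given by a degree preserving linear map. -/
def ofLin {M N : GrMod 𝓡} (f : M.toMod →ₗ[R] N.toMod)
    (hf : ∀ i, ∀ m ∈ M.deg i, f m ∈ N.deg i) : M ⟶ N :=
  ⟨ModuleCat.ofHom f, hf⟩

theorem lin_mem {M N : GrMod 𝓡} (f : M ⟶ N) {i : ℤ} {m : M.toMod} (hm : m ∈ M.deg i) :
    lin f m ∈ N.deg i := f.2 i m hm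

@[simp]
theorem lin_id (M : GrMod 𝓡) (x : M.toMod) : lin (𝟙 M) x = x := rfl

@[simp]
theorem lin_comp {M N P : GrMod 𝓡} (f : M ⟶ N) (g : N ⟶ P) (x : M.toMod) :
    lin (f ≫ g) x = lin g (lin f x) := rfl

theorem hom_ext {M N : GrMod 𝓡} {f g : M ⟶ N} (h : ∀ x, lin f x = lin g x) : f = g :=
  Subtype.ext (ModuleCat.hom_ext (LinearMap.ext h))

theorem lin_congr {M N : GrMod 𝓡} {f g : M ⟶ N} (h : f = g) (x : M.toMod) : lin f x = lin g x :=
  by rw [h]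

theorem isInternal_of_proj {M : Type u} [AddCommGroup M] (D : ℤ → AddSubgroup M)
    (p : ℤ → M →+ M) (hp : ∀ n, ∀ x ∈ D n, p n x = x) (hp' : ∀ m n, m ≠ n → ∀ x ∈ D m, p n x = 0)
    (hD : ∀ x, x ∈ AddSubgroup.closure {y | ∃ i, y ∈ D i}) : DirectSum.IsInternal D := by
  constructor
  · rw [injective_iff_map_eq_zero]
    intro f hf
    have key : ∀ (f : ⨁ i, D i) (i : ℤ), p i (DirectSum.coeAddMonoidHom D f) = f i := by
      intro f i
      induction f using DirectSum.induction_on with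
      | zero => simp
      | of j x =>
        rw [DirectSum.coeAddMonoidHom_of]
        by_cases h : j = i
        · subst h; rw [hp _ _ x.2]; simp
        · rw [hp' _ _ h _ x.2, DirectSum.of_eq_of_ne _ _ _ (Ne.symm h)]; rfl
      | add f g hf hg => simp [hf, hg]
    ext i
    rw [← key f i, hf]; simp
  · intro x
    have := hD x
    induction this using AddSubgroup.closure_induction with
    | mem x hx =>
      obtain ⟨i, hi⟩ := hx
      exact ⟨DirectSum.of (fun i => D i) i ⟨x, hi⟩, DirectSum.coeAddMonoidHom_of _ _ _⟩
    | zero => exact ⟨0, map_zero _⟩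
    | add x y _ _ hx hy =>
      obtain ⟨f, rfl⟩ := hx; obtain ⟨g, rfl⟩ := hy
      exact ⟨f + g, map_add _ _ _⟩
    | neg x _ hx =>
      obtain ⟨f, rfl⟩ := hx
      exact ⟨-f, map_neg _ _⟩

section Proj

variable (M : GrMod 𝓡)

/-- The homogeneous component of degree `n`. -/
def proj (n : ℤ) : M.toMod →+ M.toMod :=
  (M.deg n).subtype.comp ((DFinsupp.evalAddMonoidHom n).comp
    (AddEquiv.ofBijective _ M.internal).symm.toAddMonoidHom)

variable {M}

theorem ofBijective_symm {i : ℤ} {x : M.toMod} (hx : x ∈ M.deg i) :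
    (AddEquiv.ofBijective _ M.internal).symm x = DirectSum.of (fun i => M.deg i) i ⟨x, hx⟩ := by
  rw [AddEquiv.symm_apply_eq]
  exact (DirectSum.coeAddMonoidHom_of M.deg i ⟨x, hx⟩).symm

theorem proj_mem (n : ℤ) (x : M.toMod) : M.proj n x ∈ M.deg n := Subtype.prop _

theorem proj_of_mem {n : ℤ} {x : M.toMod} (hx : x ∈ M.deg n) : M.proj n x = x := by
  change (((AddEquiv.ofBijective _ M.internal).symm x n : M.deg n) : M.toMod) = x
  rw [ofBijective_symm hx, DirectSum.of_eq_same]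

theorem proj_of_ne {m n : ℤ} (h : m ≠ n) {x : M.toMod} (hx : x ∈ M.deg m) : M.proj n x = 0 := by
  change (((AddEquiv.ofBijective _ M.internal).symm x n : M.deg n) : M.toMod) = 0
  rw [ofBijective_symm hx, DirectSum.of_eq_of_ne _ _ _ (Ne.symm h)]
  rfl

@[elab_as_elim]
theorem induction_hom {p : M.toMod → Prop} (x : M.toMod) (hom : ∀ i, ∀ y ∈ M.deg i, p y)
    (zero : p 0) (add : ∀ y z, p y → p z → p (y + z)) : p x := by
  induction M.mem_closure x using AddSubgroup.closure_induction'' with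
  | mem x hx => obtain ⟨i, hi⟩ := hx; exact hom i x hi
  | zero => exact zero
  | add x y _ _ hx hy => exact add x y hx hy
  | neg_mem x hx => obtain ⟨i, hi⟩ := hx; exact hom i _ (neg_mem hi)

variable (M) in
theorem exists_eq_sum_proj (x : M.toMod) :
    ∃ s : Finset ℤ, ∀ t, s ⊆ t → x = ∑ i ∈ t, M.proj i x := by
  induction x using induction_hom with
  | hom i y hy =>
    refine ⟨{i}, fun t ht => ?_⟩
    rw [Finset.sum_eq_single i, proj_of_mem hy]
    · exact fun j _ hj => proj_of_ne (Ne.symm hj) hy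
    · exact fun h => absurd (ht (Finset.mem_singleton_self i)) h
  | zero => exact ⟨∅, fun t _ => by simp⟩
  | add y z hy hz =>
    obtain ⟨s, hs⟩ := hy
    obtain ⟨t, ht⟩ := hz
    refine ⟨s ∪ t, fun r hr => ?_⟩
    simp only [map_add, Finset.sum_add_distrib]
    rw [← hs r (Finset.union_subset_left hr), ← ht r (Finset.union_subset_right hr)]

theorem eq_zero_of_proj {x : M.toMod} (h : ∀ n, M.proj n x = 0) : x = 0 := by
  obtain ⟨s, hs⟩ := M.exists_eq_sum_proj x
  rw [hs s subset_rfl]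
  exact Finset.sum_eq_zero fun i _ => h i

theorem smul_proj {d : ℤ} {r : R} (hr : r ∈ 𝓡 d) (n : ℤ) (x : M.toMod) :
    M.proj (d + n) (r • x) = r • M.proj n x := by
  induction x using induction_hom with
  | hom i y hy =>
    by_cases h : i = n
    · subst h; rw [proj_of_mem hy, proj_of_mem (M.smul_mem hr hy)]
    · rw [proj_of_ne h hy, smul_zero, proj_of_ne (by omega) (M.smul_mem hr hy)]
  | zero => simp
  | add y z hy hz => simp only [smul_add, map_add, hy, hz]

/-- Degree preserving additive maps commute with homogeneous components. The two modules may be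
graded over different rings. -/
theorem map_proj {S : Type u} [Ring S] [Algebra k S] {𝓢 : ℤ → Submodule k S} {N : GrMod 𝓢}
    (f : M.toMod →+ N.toMod) (hf : ∀ i, ∀ m ∈ M.deg i, f m ∈ N.deg i) (n : ℤ) (x : M.toMod) :
    f (M.proj n x) = N.proj n (f x) := by
  induction x using induction_hom with
  | hom i y hy =>
    by_cases h : i = n
    · subst h; rw [proj_of_mem hy, proj_of_mem (hf i y hy)]
    · rw [proj_of_ne h hy, map_zero, proj_of_ne h (hf i y hy)]
  | zero => simp
  | add y z hy hz => simp only [map_add, hy, hz]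

theorem lin_proj {N : GrMod 𝓡} (f : M ⟶ N) (n : ℤ) (x : M.toMod) :
    lin f (M.proj n x) = N.proj n (lin f x) :=
  map_proj (lin f).toAddMonoidHom f.2 n x

theorem isHomogeneous_iff {p : Submodule R M.toMod} :
    M.IsHomogeneous p ↔ ∀ n, ∀ x ∈ p, M.proj n x ∈ p := by
  constructor
  · intro h n x hx
    induction h x hx using AddSubgroup.closure_induction with
    | mem y hy =>
      obtain ⟨hy, i, hi⟩ := hy
      by_cases h : i = n
      · subst h; rwa [proj_of_mem hi]
      · rw [proj_of_ne h hi]; exact zero_mem _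
    | zero => rw [map_zero]; exact zero_mem _
    | add y z h₁ h₂ hy hz =>
      have hp : ∀ y ∈ AddSubgroup.closure {y | y ∈ p ∧ ∃ i, y ∈ M.deg i}, y ∈ p := fun y hy =>
        (AddSubgroup.closure_le p.toAddSubgroup).2 (fun _ h => h.1) hy
      rw [map_add]
      exact add_mem (hy (hp y h₁)) (hz (hp z h₂))
    | neg y h₁ hy =>
      have hp : ∀ y ∈ AddSubgroup.closure {y | y ∈ p ∧ ∃ i, y ∈ M.deg i}, y ∈ p := fun y hy =>
        (AddSubgroup.closure_le p.toAddSubgroup).2 (fun _ h => h.1) hy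
      rw [map_neg]
      exact neg_mem (hy (hp y h₁))
  · intro h x hx
    obtain ⟨s, hs⟩ := M.exists_eq_sum_proj x
    rw [hs s subset_rfl]
    exact sum_mem fun i _ => AddSubgroup.subset_closure ⟨h i x hx, i, proj_mem i x⟩

theorem isHomogeneous_range {N : GrMod 𝓡} (f : M ⟶ N) :
    N.IsHomogeneous (LinearMap.range (lin f)) := by
  rw [isHomogeneous_iff]
  rintro n _ ⟨x, rfl⟩
  exact ⟨M.proj n x, lin_proj f n x⟩

theorem mem_deg_of_proj {n : ℤ} {x : M.toMod} (h : M.proj n x = x) : x ∈ M.deg n :=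
  h ▸ proj_mem n x

end Proj

section Coker

variable {M N : GrMod 𝓡} (f : M ⟶ N)

/-- The cokernel of a morphism of graded modules. -/
def coker : GrMod 𝓡 where
  toMod := ModuleCat.of R (N.toMod ⧸ LinearMap.range (lin f))
  deg n := (N.deg n).map (LinearMap.range (lin f)).mkQ.toAddMonoidHom
  internal := by
    let q := (LinearMap.range (lin f)).mkQ
    let p : ℤ → (N.toMod ⧸ LinearMap.range (lin f)) →+ (N.toMod ⧸ LinearMap.range (lin f)) :=
      fun n => QuotientAddGroup.map _ _ (N.proj n)
        (fun x hx => isHomogeneous_iff.1 (isHomogeneous_range f) n x hx)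
    have hp : ∀ n x, p n (q x) = q (N.proj n x) := fun _ _ => rfl
    refine isInternal_of_proj (M := N.toMod ⧸ LinearMap.range (lin f)) _ p ?_ ?_ ?_
    · rintro n _ ⟨x, hx, rfl⟩
      exact (hp n x).trans (congrArg q (proj_of_mem hx))
    · rintro m n h _ ⟨x, hx, rfl⟩
      exact (hp n x).trans ((congrArg q (proj_of_ne h hx)).trans (map_zero q))
    · intro x
      obtain ⟨x, rfl⟩ := Submodule.mkQ_surjective _ x
      induction x using induction_hom with
      | hom i y hy => exact AddSubgroup.subset_closure ⟨i, y, hy, rfl⟩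
      | zero => rw [map_zero]; exact zero_mem _
      | add y z hy hz => rw [map_add]; exact add_mem hy hz
  smul_mem := by
    rintro i j r _ hr ⟨m, hm, rfl⟩
    exact ⟨r • m, N.smul_mem hr hm, rfl⟩

/-- The projection to the cokernel. -/
def cokerπ : N ⟶ coker f :=
  ofLin (LinearMap.range (lin f)).mkQ fun _ m hm => ⟨m, hm, rfl⟩

theorem cokerπ_surjective : Function.Surjective (lin (cokerπ f)) := Submodule.mkQ_surjective _

theorem cokerπ_eq_zero_iff {x : N.toMod} : lin (cokerπ f) x = 0 ↔ ∃ y, lin f y = x :=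
  (Submodule.Quotient.mk_eq_zero (LinearMap.range (lin f))).trans LinearMap.mem_range

theorem cokerπ_map (y : M.toMod) : lin (cokerπ f) (lin f y) = 0 :=
  (cokerπ_eq_zero_iff f).2 ⟨y, rfl⟩

variable {f}

/-- The map from the cokernel induced by a morphism vanishing on the image of `f`. -/
def cokerDesc {P : GrMod 𝓡} (g : N ⟶ P) (hg : ∀ y, lin g (lin f y) = 0) : coker f ⟶ P :=
  ofLin (M := coker f) (Submodule.liftQ _ (lin g) (by rintro _ ⟨y, rfl⟩; exact hg y)) (by
    rintro i _ ⟨m, hm, rfl⟩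
    exact lin_mem g hm)

variable (f) in
/-- An additive map that kills the image of `f`, on the cokernel. -/
def cokerLift {X : Type u} [AddCommGroup X] (s : N.toMod →+ X) (hs : ∀ y, s (lin f y) = 0) :
    (coker f).toMod →+ X :=
  QuotientAddGroup.lift (LinearMap.range (lin f)).toAddSubgroup s
    (by rintro _ ⟨y, rfl⟩; exact hs y)

@[simp]
theorem cokerLift_π {X : Type u} [AddCommGroup X] (s : N.toMod →+ X) (hs) (x : N.toMod) :
    cokerLift f s hs (lin (cokerπ f) x) = s x := rfl

end Coker

section Sum

/-- The direct sum of a family of graded modules. -/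
def dsum {ι : Type u} (X : ι → GrMod 𝓡) : GrMod 𝓡 where
  toMod := ModuleCat.of R (⨁ j, (X j).toMod)
  deg n :=
    { carrier := {x : ⨁ j, (X j).toMod | ∀ j, x j ∈ (X j).deg n}
      add_mem' := fun hx hy j => add_mem (hx j) (hy j)
      zero_mem' := fun j => zero_mem ((X j).deg n)
      neg_mem' := fun hx j => neg_mem (hx j) }
  internal := by
    classical
    refine isInternal_of_proj (M := ⨁ j, (X j).toMod) _
      (fun n => DirectSum.map fun j => (X j).proj n) ?_ ?_ ?_
    · intro n x hx
      refine DFinsupp.ext fun j => ?_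
      rw [DirectSum.map_apply]
      exact proj_of_mem (hx j)
    · intro m n h x hx
      refine DFinsupp.ext fun j => ?_
      rw [DirectSum.map_apply]
      exact proj_of_ne h (hx j)
    · intro x
      induction x using DirectSum.induction_on with
      | zero => exact zero_mem _
      | of j y =>
        induction y using induction_hom with
        | hom i y hy =>
          refine AddSubgroup.subset_closure ⟨i, fun j' => ?_⟩
          by_cases h : j' = j
          · subst h; rwa [DirectSum.of_eq_same]
          · rw [DirectSum.of_eq_of_ne _ _ _ h]; exact zero_mem _
        | zero => rw [map_zero]; exact zero_mem _
        | add y z hy hz => rw [map_add]; exact add_mem hy hz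
      | add x y hx hy => exact add_mem hx hy
  smul_mem hr hm j := (X j).smul_mem hr (hm j)

variable {ι : Type u} (X : ι → GrMod 𝓡)

open Classical in
/-- The inclusion of a summand. -/
def dsumι (j : ι) : X j ⟶ dsum X :=
  ofLin (N := dsum X) (DirectSum.lof R ι (fun j => (X j).toMod) j) (by
    intro i m hm j'
    change (DirectSum.of (fun j => (X j).toMod) j m) j' ∈ _
    by_cases h : j' = j
    · subst h; rwa [DirectSum.of_eq_same]
    · rw [DirectSum.of_eq_of_ne _ _ _ h]; exact zero_mem _)

/-- The projection to a summand. -/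
def dsumπ (j : ι) : dsum X ⟶ X j :=
  ofLin (M := dsum X) (DirectSum.component R ι (fun j => (X j).toMod) j) fun _ _ hm => hm j

theorem dsumπ_ι_same (j : ι) (x : (X j).toMod) :
    lin (dsumπ X j) (lin (dsumι X j) x) = x := by
  classical
  exact DirectSum.of_eq_same (β := fun j => (X j).toMod) j x

theorem dsumπ_ι_ne {j j' : ι} (h : j' ≠ j) (x : (X j).toMod) :
    lin (dsumπ X j') (lin (dsumι X j) x) = 0 := by
  classical
  exact DirectSum.of_eq_of_ne (β := fun j => (X j).toMod) j j' x h

variable {X} in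
theorem dsum_ext {x y : (dsum X).toMod} (h : ∀ j, lin (dsumπ X j) x = lin (dsumπ X j) y) :
    x = y :=
  DFinsupp.ext (β := fun j => (X j).toMod) h

variable {X} in
theorem mem_dsum_deg {n : ℤ} {x : (dsum X).toMod} :
    x ∈ (dsum X).deg n ↔ ∀ j, lin (dsumπ X j) x ∈ (X j).deg n := Iff.rfl

variable {X}

@[elab_as_elim]
theorem dsum_induction {p : (dsum X).toMod → Prop} (x : (dsum X).toMod) (zero : p 0)
    (ι : ∀ j x, p (lin (dsumι X j) x)) (add : ∀ x y, p x → p y → p (x + y)) : p x := by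
  classical
  exact DirectSum.induction_on (motive := p) x zero ι add

open Classical in
/-- The map from a direct sum given by its components. -/
def dsumDesc {P : GrMod 𝓡} (g : ∀ j, X j ⟶ P) : dsum X ⟶ P :=
  ofLin (M := dsum X) (DirectSum.toModule R ι P.toMod fun j => lin (g j)) (by
    intro i m hm
    have : ∀ x : ⨁ j, (X j).toMod, (∀ j, x j ∈ (X j).deg i) →
        DirectSum.toModule R ι P.toMod (fun j => lin (g j)) x ∈ P.deg i := by
      intro x hx
      rw [← DirectSum.sum_support_of x, map_sum]
      refine sum_mem fun j _ => ?_
      rw [← DirectSum.lof_eq_of R, DirectSum.toModule_lof]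
      exact lin_mem _ (hx j)
    exact this m hm)

@[simp]
theorem dsumDesc_ι {P : GrMod 𝓡} (g : ∀ j, X j ⟶ P) (j : ι) (x : (X j).toMod) :
    lin (dsumDesc g) (lin (dsumι X j) x) = lin (g j) x := by
  classical
  exact DirectSum.toModule_lof (M := fun j => (X j).toMod) R j x

theorem dsum_hom_ext {P : GrMod 𝓡} {f g : dsum X ⟶ P}
    (h : ∀ j x, lin f (lin (dsumι X j) x) = lin g (lin (dsumι X j) x)) : f = g := by
  refine hom_ext fun x => ?_
  induction x using dsum_induction with
  | zero => simp
  | ι j x => exact h j x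
  | add x y hx hy => simp only [map_add, hx, hy]

/-- The map of direct sums over a map of index sets. -/
def dsumMap {ι' : Type u} {Y : ι' → GrMod 𝓡} (e : ι → ι') (g : ∀ j, X j ⟶ Y (e j)) :
    dsum X ⟶ dsum Y :=
  dsumDesc fun j => g j ≫ dsumι Y (e j)

theorem dsumMap_ι {ι' : Type u} {Y : ι' → GrMod 𝓡} (e : ι → ι') (g : ∀ j, X j ⟶ Y (e j)) (j : ι)
    (x : (X j).toMod) :
    lin (dsumMap e g) (lin (dsumι X j) x) = lin (dsumι Y (e j)) (lin (g j) x) :=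
  dsumDesc_ι (fun j => g j ≫ dsumι Y (e j)) j x

end Sum

section Prod

variable (M N : GrMod 𝓡)

/-- The direct sum of two graded modules. -/
def prod : GrMod 𝓡 where
  toMod := ModuleCat.of R (M.toMod × N.toMod)
  deg n := (M.deg n).prod (N.deg n)
  internal := by
    refine isInternal_of_proj (M := M.toMod × N.toMod) _
      (fun n => (M.proj n).prodMap (N.proj n)) ?_ ?_ ?_
    · rintro n ⟨x, y⟩ ⟨hx, hy⟩
      exact Prod.ext (proj_of_mem hx) (proj_of_mem hy)
    · rintro m n h ⟨x, y⟩ ⟨hx, hy⟩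
      exact Prod.ext (proj_of_ne h hx) (proj_of_ne h hy)
    · rintro ⟨x, y⟩
      have e : (x, y) = (x, 0) + ((0 : M.toMod), y) := by simp
      rw [e]
      refine add_mem ?_ ?_
      · induction x using induction_hom with
        | hom i x hx => exact AddSubgroup.subset_closure ⟨i, hx, zero_mem _⟩
        | zero => exact zero_mem _
        | add x y hx hy => simpa using add_mem (hx (by simp)) (hy (by simp))
      · clear e
        induction y using induction_hom with
        | hom i x hx => exact AddSubgroup.subset_closure ⟨i, zero_mem _, hx⟩
        | zero => exact zero_mem _
        | add x y hx hy => simpa using add_mem hx hy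
  smul_mem hr hm := ⟨M.smul_mem hr hm.1, N.smul_mem hr hm.2⟩

end Prod

section Sub

variable {M : GrMod 𝓡} (p : Submodule R M.toMod) (hp : M.IsHomogeneous p)

/-- A homogeneous submodule as a graded module. -/
def sub : GrMod 𝓡 where
  toMod := ModuleCat.of R p
  deg n := (M.deg n).comap p.subtype.toAddMonoidHom
  internal := by
    have hp' := isHomogeneous_iff.1 hp
    refine isInternal_of_proj (M := p) _
      (fun n => ((M.proj n).comp p.subtype.toAddMonoidHom).codRestrict p
        (fun x => hp' n x x.2)) ?_ ?_ ?_
    · exact fun n x hx => Subtype.ext (proj_of_mem hx)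
    · exact fun m n h x hx => Subtype.ext (proj_of_ne h hx)
    · intro x
      obtain ⟨s, hs⟩ := M.exists_eq_sum_proj x
      have : x = ∑ i ∈ s, (⟨M.proj i x, hp' i x x.2⟩ : p) := by
        refine Subtype.ext ?_
        rw [AddSubmonoidClass.coe_finsetSum]
        exact hs s subset_rfl
      rw [this]
      exact sum_mem fun i _ => AddSubgroup.subset_closure ⟨i, proj_mem i (x : M.toMod)⟩
  smul_mem hr hm := M.smul_mem hr hm

/-- The inclusion of a homogeneous submodule. -/
def subι : sub p hp ⟶ M := ofLin (M := sub p hp) p.subtype fun _ _ hm => hm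

theorem subι_injective : Function.Injective (lin (subι p hp)) := Subtype.val_injective

/-- The map between homogeneous submodules induced by a morphism. -/
def subMap {N : GrMod 𝓡} (f : M ⟶ N) (q : Submodule R N.toMod) (hq : N.IsHomogeneous q)
    (h : ∀ x ∈ p, lin f x ∈ q) : sub p hp ⟶ sub q hq :=
  ofLin (M := sub p hp) (N := sub q hq) ((lin f).restrict h) fun _ _ hm => lin_mem f hm

end Sub

section Projective

variable {M N : GrMod 𝓡}

/-- The part of degree `n` of an additive map. -/
def degPart (n : ℤ) (f : M.toMod →+ N.toMod) : M.toMod →+ N.toMod :=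
  (DirectSum.toAddMonoid fun i => (N.proj (i + n)).comp (f.comp (M.deg i).subtype)).comp
    (AddEquiv.ofBijective _ M.internal).symm.toAddMonoidHom

theorem degPart_of_mem (n : ℤ) (f : M.toMod →+ N.toMod) {i : ℤ} {x : M.toMod}
    (hx : x ∈ M.deg i) : degPart n f x = N.proj (i + n) (f x) := by
  change DirectSum.toAddMonoid _ ((AddEquiv.ofBijective _ M.internal).symm x) = _
  rw [ofBijective_symm hx, DirectSum.toAddMonoid_of]
  rfl

theorem surjective_of_epi (f : M ⟶ N) [Epi f] : Function.Surjective (lin f) := by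
  have h : cokerπ f = 0 := by
    rw [← cancel_epi f]
    exact hom_ext fun x => cokerπ_map f x
  intro y
  exact (cokerπ_eq_zero_iff f).1 (lin_congr h y)

/-- A graded module is projective if the underlying module is: the degree preserving part of a lift
is again a lift. -/
theorem projective_of_module (h𝓡 : ∀ r : R, r ∈ AddSubgroup.closure {r : R | ∃ i, r ∈ 𝓡 i})
    (P : GrMod 𝓡)
    [Module.Projective R P.toMod] : Projective P where
  factors {E X} f e _ := by
    obtain ⟨g, hg⟩ := Module.projective_lifting_property (lin e) (lin f) (surjective_of_epi e)
    let φ : P.toMod →+ E.toMod := degPart 0 g.toAddMonoidHom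
    have hφ : ∀ i, ∀ x ∈ P.deg i, φ x = E.proj i (g x) := fun i x hx => by
      rw [degPart_of_mem 0 _ hx, add_zero]; rfl
    have hsmul : ∀ (r : R) (x : P.toMod), φ (r • x) = r • φ x := by
      intro r x
      induction h𝓡 r using AddSubgroup.closure_induction with
      | mem r hr =>
        obtain ⟨d, hd⟩ := hr
        induction x using induction_hom with
        | hom i y hy => rw [hφ _ _ (P.smul_mem hd hy), hφ i y hy, map_smul, smul_proj hd]
        | zero => simp
        | add y z hy hz => simp only [smul_add, map_add, hy, hz]
      | zero => simp
      | add a b _ _ ha hb => simp only [add_smul, map_add, ha, hb]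
      | neg a _ ha => simp only [neg_smul, map_neg, ha]
    refine ⟨ofLin { φ with map_smul' := hsmul } fun i x hx => ?_, hom_ext fun x => ?_⟩
    · change φ x ∈ E.deg i
      rw [hφ i x hx]
      exact proj_mem i _
    · change lin e (φ x) = lin f x
      induction x using induction_hom with
      | hom i y hy =>
        have := LinearMap.congr_fun hg y
        rw [LinearMap.comp_apply] at this
        rw [hφ i y hy, lin_proj, this, proj_of_mem (lin_mem f hy)]
      | zero => simp
      | add y z hy hz => simp only [map_add, hy, hz]

end Projective

end GrMod

/-! ### Decomposition into indecomposables -/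

namespace GrMod

variable {k : Type u} [Field k] {R : Type u} [Ring R] [Algebra k R] {𝓡 : ℤ → Submodule k R}

/-- A graded module is a direct sum of indecomposable graded modules. -/
def IsSumOfIndecomposables (V : GrMod 𝓡) : Prop :=
  ∃ (J : Type u) (W : J → GrMod 𝓡), (∀ j, (W j).IsIndecomposable) ∧
    ∃ e : V ⟶ dsum W, Function.Bijective (lin e)

/-- The projection onto a homogeneous submodule along a homogeneous complement. -/
def subProj {V : GrMod 𝓡} {p q : Submodule R V.toMod} (hp : V.IsHomogeneous p)
    (hq : V.IsHomogeneous q) (h : IsCompl p q) : V ⟶ sub p hp :=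
  ofLin (N := sub p hp) (Submodule.projectionOnto p q h) (by
    intro i x hx
    obtain ⟨a, ha, b, hb, rfl⟩ := Submodule.mem_sup.1 (h.sup_eq_top ▸ Submodule.mem_top : x ∈ p ⊔ q)
    have e : ∀ a ∈ p, ∀ b ∈ q,
        ((Submodule.projectionOnto p q h (a + b) : p) : V.toMod) = a := by
      intro a ha b hb
      rw [map_add, (Submodule.projectionOnto_apply_eq_zero_iff h).2 hb, add_zero]
      exact congrArg Subtype.val (Submodule.projectionOnto_apply_left h ⟨a, ha⟩)
    refine mem_deg_of_proj (M := V) ?_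
    have e1 := e _ (isHomogeneous_iff.1 hp i a ha) _ (isHomogeneous_iff.1 hq i b hb)
    rw [← map_add, proj_of_mem hx] at e1
    change V.proj i ((Submodule.projectionOnto p q h (a + b) : p) : V.toMod) =
      ((Submodule.projectionOnto p q h (a + b) : p) : V.toMod)
    rw [e1, proj_of_mem (proj_mem i a)])

theorem subProj_left {V : GrMod 𝓡} {p q : Submodule R V.toMod} (hp : V.IsHomogeneous p)
    (hq : V.IsHomogeneous q) (h : IsCompl p q) (x : (sub p hp).toMod) :
    lin (subProj hp hq h) (lin (subι p hp) x) = x :=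
  Submodule.projectionOnto_apply_left h x

theorem subProj_eq_zero_iff {V : GrMod 𝓡} {p q : Submodule R V.toMod} (hp : V.IsHomogeneous p)
    (hq : V.IsHomogeneous q) (h : IsCompl p q) (x : V.toMod) :
    lin (subProj hp hq h) x = 0 ↔ x ∈ q :=
  Submodule.projectionOnto_apply_eq_zero_iff h

/-- The inclusion of a subsum. -/
def dsumIncl {ι ι' : Type u} (W : ι' → GrMod 𝓡) (s : ι → ι') :
    dsum (fun j => W (s j)) ⟶ dsum W :=
  dsumDesc fun j => dsumι W (s j)

section dsumIncl

variable {ι ι' : Type u} (W : ι' → GrMod 𝓡) (s : ι → ι')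

theorem dsumIncl_ι (j : ι) (x : (W (s j)).toMod) :
    lin (dsumIncl W s) (lin (dsumι (fun j => W (s j)) j) x) = lin (dsumι W (s j)) x :=
  dsumDesc_ι (X := fun j => W (s j)) (fun j => dsumι W (s j)) j x

theorem dsumπ_incl (hs : Function.Injective s) (j : ι) (x : (dsum fun j => W (s j)).toMod) :
    lin (dsumπ W (s j)) (lin (dsumIncl W s) x) = lin (dsumπ (fun j => W (s j)) j) x := by
  induction x using dsum_induction with
  | zero => simp only [map_zero]
  | ι j' x =>
    rw [dsumIncl_ι]
    by_cases hj : j = j'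
    · subst hj; rw [dsumπ_ι_same, dsumπ_ι_same (fun j => W (s j))]
    · rw [dsumπ_ι_ne _ (fun e => hj (hs e)), dsumπ_ι_ne (fun j => W (s j)) hj]
  | add x y hx hy => simp only [map_add, hx, hy]

theorem dsumπ_incl_ne {j' : ι'} (h : ∀ j, j' ≠ s j) (x : (dsum fun j => W (s j)).toMod) :
    lin (dsumπ W j') (lin (dsumIncl W s) x) = 0 := by
  induction x using dsum_induction with
  | zero => simp only [map_zero]
  | ι j x => rw [dsumIncl_ι, dsumπ_ι_ne _ (h j)]
  | add x y hx hy => simp only [map_add, hx, hy, add_zero]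

end dsumIncl

theorem bijective_of_compl {V : GrMod 𝓡} {p q : Submodule R V.toMod}
    (hp : V.IsHomogeneous p) (hq : V.IsHomogeneous q) (h : IsCompl p q) {J₁ J₂ : Type u}
    (W : J₁ ⊕ J₂ → GrMod 𝓡) (e₁ : sub p hp ⟶ dsum fun j => W (Sum.inl j))
    (e₂ : sub q hq ⟶ dsum fun j => W (Sum.inr j)) (b₁ : Function.Bijective (lin e₁))
    (b₂ : Function.Bijective (lin e₂)) :
    Function.Bijective (lin (subProj hp hq h ≫ e₁ ≫ dsumIncl W Sum.inl +
      subProj hq hp h.symm ≫ e₂ ≫ dsumIncl W Sum.inr)) := by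
  have he : ∀ x, lin (subProj hp hq h ≫ e₁ ≫ dsumIncl W Sum.inl +
      subProj hq hp h.symm ≫ e₂ ≫ dsumIncl W Sum.inr) x =
      lin (dsumIncl W Sum.inl) (lin e₁ (lin (subProj hp hq h) x)) +
      lin (dsumIncl W Sum.inr) (lin e₂ (lin (subProj hq hp h.symm) x)) := fun _ => rfl
  constructor
  · rw [injective_iff_map_eq_zero]
    intro x hx
    have z₁ : lin (subProj hp hq h) x = 0 := by
      refine (injective_iff_map_eq_zero _).1 b₁.1 _ (dsum_ext fun j => ?_)
      have := congrArg (lin (dsumπ W (Sum.inl j))) hx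
      rw [he, map_add, dsumπ_incl _ _ Sum.inl_injective,
        dsumπ_incl_ne _ _ (fun _ => Sum.inl_ne_inr), add_zero, map_zero] at this
      rw [map_zero]; exact this
    have z₂ : lin (subProj hq hp h.symm) x = 0 := by
      refine (injective_iff_map_eq_zero _).1 b₂.1 _ (dsum_ext fun j => ?_)
      have := congrArg (lin (dsumπ W (Sum.inr j))) hx
      rw [he, map_add, dsumπ_incl _ _ Sum.inr_injective,
        dsumπ_incl_ne _ _ (fun _ => Sum.inr_ne_inl), zero_add, map_zero] at this
      rw [map_zero]; exact this
    rw [subProj_eq_zero_iff] at z₁ z₂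
    exact (Submodule.disjoint_def.1 h.disjoint) x z₂ z₁
  · intro y
    induction y using dsum_induction with
    | zero => exact ⟨0, map_zero _⟩
    | ι j w =>
      cases j with
      | inl j =>
        obtain ⟨x, hx⟩ := b₁.2 (lin (dsumι (fun j => W (Sum.inl j)) j) w)
        refine ⟨lin (subι p hp) x, ?_⟩
        have hx' : lin (subProj hq hp h.symm) (lin (subι p hp) x) = 0 :=
          (subProj_eq_zero_iff hq hp h.symm _).2 x.2
        rw [he, subProj_left, hx, hx', map_zero, map_zero, add_zero, dsumIncl_ι]
      | inr j =>
        obtain ⟨x, hx⟩ := b₂.2 (lin (dsumι (fun j => W (Sum.inr j)) j) w)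
        refine ⟨lin (subι q hq) x, ?_⟩
        have hx' : lin (subProj hp hq h) (lin (subι q hq) x) = 0 :=
          (subProj_eq_zero_iff hp hq h _).2 x.2
        rw [he, subProj_left, hx, hx', map_zero, map_zero, zero_add, dsumIncl_ι]
    | add x y hx hy =>
      obtain ⟨a, rfl⟩ := hx
      obtain ⟨b, rfl⟩ := hy
      exact ⟨a + b, map_add _ _ _⟩

theorem isSumOfIndecomposables_of_compl {V : GrMod 𝓡} {p q : Submodule R V.toMod}
    (hp : V.IsHomogeneous p) (hq : V.IsHomogeneous q) (h : IsCompl p q)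
    (h₁ : (sub p hp).IsSumOfIndecomposables) (h₂ : (sub q hq).IsSumOfIndecomposables) :
    V.IsSumOfIndecomposables := by
  obtain ⟨J₁, W₁, i₁, e₁, b₁⟩ := h₁
  obtain ⟨J₂, W₂, i₂, e₂, b₂⟩ := h₂
  exact ⟨J₁ ⊕ J₂, Sum.elim W₁ W₂, fun j => j.rec i₁ i₂, _,
    bijective_of_compl hp hq h (Sum.elim W₁ W₂) e₁ e₂ b₁ b₂⟩

/-- A graded module of finite length is a direct sum of indecomposables: split it as long as
possible, by induction on the length. -/
theorem isSumOfIndecomposables_of_finite (V : GrMod 𝓡) [IsNoetherian R V.toMod]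
    [IsArtinian R V.toMod] : V.IsSumOfIndecomposables := by
  by_cases hV : V.IsIndecomposable
  · refine ⟨PUnit, fun _ => V, fun _ => hV, dsumι (fun _ => V) PUnit.unit, ?_, ?_⟩
    · exact Function.LeftInverse.injective (g := lin (dsumπ (fun _ => V) PUnit.unit))
        fun x => dsumπ_ι_same (fun _ => V) PUnit.unit x
    · intro y
      induction y using dsum_induction with
      | zero => exact ⟨0, map_zero _⟩
      | ι j w => exact ⟨w, rfl⟩
      | add x y hx hy =>
        obtain ⟨a, rfl⟩ := hx
        obtain ⟨b, rfl⟩ := hy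
        exact ⟨a + b, map_add _ _ _⟩
  · rcases subsingleton_or_nontrivial V.toMod with hs | hn
    · let W : PEmpty.{u + 1} → GrMod 𝓡 := fun j => j.elim
      have : Subsingleton (dsum W).toMod := ⟨fun x y => dsum_ext fun j => j.elim⟩
      exact ⟨PEmpty, W, fun j => j.elim, 0, fun _ _ _ => Subsingleton.elim _ _,
        fun _ => ⟨0, Subsingleton.elim _ _⟩⟩
    · have : ∃ p q : Submodule R V.toMod, V.IsHomogeneous p ∧ V.IsHomogeneous q ∧ IsCompl p q ∧
          p ≠ ⊥ ∧ q ≠ ⊥ := by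
        by_contra! hc
        exact hV ⟨hn, fun p q hp hq h => or_iff_not_imp_left.2 (hc p q hp hq h)⟩
      obtain ⟨p, q, hp, hq, h, hp0, hq0⟩ := this
      have hp1 : p ≠ ⊤ := fun e => hq0 (by simpa [e] using h.disjoint)
      have hq1 : q ≠ ⊤ := fun e => hp0 (by simpa [e] using h.disjoint)
      have l₁ : Module.length R (sub p hp).toMod < Module.length R V.toMod :=
        Submodule.length_lt hp1
      have l₂ : Module.length R (sub q hq).toMod < Module.length R V.toMod :=
        Submodule.length_lt hq1
      have : IsNoetherian R (sub p hp).toMod := inferInstanceAs (IsNoetherian R p)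
      have : IsNoetherian R (sub q hq).toMod := inferInstanceAs (IsNoetherian R q)
      have : IsArtinian R (sub p hp).toMod := inferInstanceAs (IsArtinian R p)
      have : IsArtinian R (sub q hq).toMod := inferInstanceAs (IsArtinian R q)
      exact isSumOfIndecomposables_of_compl hp hq h (isSumOfIndecomposables_of_finite (sub p hp))
        (isSumOfIndecomposables_of_finite (sub q hq))
termination_by Module.length R V.toMod

end GrMod

/-! ### Coinduced modules -/

namespace GrMod

variable {k : Type u} [Field k] {R : Type u} [Ring R] [Algebra k R] {𝓡 : ℤ → Submodule k R}

theorem mem_closure_homogeneous [GradedAlgebra 𝓡] (r : R) :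
    r ∈ AddSubgroup.closure {r : R | ∃ i, r ∈ 𝓡 i} := by
  classical
  rw [← DirectSum.sum_support_decompose 𝓡 r]
  exact sum_mem fun i _ => AddSubgroup.subset_closure ⟨i, SetLike.coe_mem _⟩

/-- `Hom_k(R, V)` with the action `(r f) x = f (x r)`; a type synonym, since `R →ₗ[k] V` carries the
action of `R` on the values. -/
def CoindModule (V : GrMod 𝓡) : Type u := R →ₗ[k] V.toMod

namespace CoindModule

variable (V : GrMod 𝓡)

instance : AddCommGroup (CoindModule V) := inferInstanceAs (AddCommGroup (R →ₗ[k] V.toMod))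

instance : Module k (CoindModule V) := inferInstanceAs (Module k (R →ₗ[k] V.toMod))

instance : FunLike (CoindModule V) R V.toMod :=
  inferInstanceAs (FunLike (R →ₗ[k] V.toMod) R V.toMod)

instance : LinearMapClass (CoindModule V) k R V.toMod :=
  inferInstanceAs (LinearMapClass (R →ₗ[k] V.toMod) k R V.toMod)

instance : Module R (CoindModule V) where
  smul r f := LinearMap.comp (M₂ := R) (f : R →ₗ[k] V.toMod) (LinearMap.mulRight k r)
  one_smul f := LinearMap.ext fun x => congrArg (f : R →ₗ[k] V.toMod) (mul_one x)
  mul_smul r s f := LinearMap.ext fun x =>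
    congrArg (f : R →ₗ[k] V.toMod) (mul_assoc x r s).symm
  smul_zero _ := rfl
  smul_add _ _ _ := rfl
  add_smul r s f := LinearMap.ext fun x =>
    (congrArg (f : R →ₗ[k] V.toMod) (mul_add x r s)).trans (map_add (f : R →ₗ[k] V.toMod) _ _)
  zero_smul f := LinearMap.ext fun x =>
    (congrArg (f : R →ₗ[k] V.toMod) (mul_zero x)).trans (map_zero (f : R →ₗ[k] V.toMod))

variable {V}

@[ext]
theorem ext {f g : CoindModule V} (h : ∀ x, f x = g x) : f = g := LinearMap.ext h

@[simp] theorem smul_apply (r : R) (f : CoindModule V) (x : R) : (r • f) x = f (x * r) := rfl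
@[simp] theorem add_apply (f g : CoindModule V) (x : R) : (f + g) x = f x + g x := rfl
@[simp] theorem zero_apply (x : R) : (0 : CoindModule V) x = 0 := rfl
@[simp] theorem ksmul_apply (c : k) (f : CoindModule V) (x : R) : (c • f) x = c • f x := rfl

instance : IsScalarTower k R (CoindModule V) :=
  ⟨fun c r f => ext fun x => by
    rw [smul_apply, ksmul_apply, smul_apply, mul_smul_comm, map_smul]⟩

instance [FiniteDimensional k R] [FiniteDimensional k V.toMod] : Module.Finite R (CoindModule V) :=
  have : Module.Finite k (CoindModule V) := inferInstanceAs (Module.Finite k (R →ₗ[k] V.toMod))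
  Module.Finite.of_restrictScalars_finite k R _

theorem sum_apply {ι : Type*} (s : Finset ι) (f : ι → CoindModule V) (x : R) :
    (∑ i ∈ s, f i) x = ∑ i ∈ s, f i x := by
  classical
  induction s using Finset.induction_on with
  | empty => rfl
  | insert a s ha ih => rw [Finset.sum_insert ha, Finset.sum_insert ha, add_apply, ih]

end CoindModule

section Coind

variable [GradedAlgebra 𝓡]

/-- Homogeneous components are `k`-linear. -/
def projₖ (V : GrMod 𝓡) (n : ℤ) : V.toMod →ₗ[k] V.toMod :=
  { V.proj n with
    map_smul' := fun c x => by
      have := smul_proj (M := V) (SetLike.algebraMap_mem_graded 𝓡 c) n x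
      rwa [zero_add, algebraMap_smul, algebraMap_smul] at this }

theorem CoindModule.ext_homogeneous {V : GrMod 𝓡} {f g : CoindModule V}
    (h : ∀ i, ∀ x ∈ 𝓡 i, f x = g x) : f = g := by
  ext x
  induction mem_closure_homogeneous (𝓡 := 𝓡) x using AddSubgroup.closure_induction with
  | mem x hx => obtain ⟨i, hi⟩ := hx; exact h i x hi
  | zero => rw [map_zero, map_zero]
  | add a b _ _ ha hb => rw [map_add, map_add, ha, hb]
  | neg a _ ha => rw [map_neg, map_neg, ha]

/-- The part of degree `n` of a `k`-linear map `R → V`. -/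
def coindPart (V : GrMod 𝓡) (n : ℤ) (f : CoindModule V) : CoindModule V :=
  DirectSum.toModule k ℤ V.toMod
    (fun i => V.projₖ (i + n) ∘ₗ (f : R →ₗ[k] V.toMod) ∘ₗ (𝓡 i).subtype) ∘ₗ
      (DirectSum.decomposeLinearEquiv 𝓡).toLinearMap

theorem coindPart_apply (V : GrMod 𝓡) (n : ℤ) (f : CoindModule V) {i : ℤ} {x : R} (hx : x ∈ 𝓡 i) :
    coindPart V n f x = V.proj (i + n) (f x) := by
  change DirectSum.toModule k ℤ V.toMod
    (fun i => V.projₖ (i + n) ∘ₗ (f : R →ₗ[k] V.toMod) ∘ₗ (𝓡 i).subtype)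
      (DirectSum.decompose 𝓡 x) = _
  rw [DirectSum.decompose_of_mem 𝓡 hx, ← DirectSum.lof_eq_of k, DirectSum.toModule_lof]
  rfl

/-- A `k`-linear map `R → V` is a finite sum of homogeneous ones, since `R` is finite
dimensional. -/
theorem exists_eq_sum_coindPart [FiniteDimensional k R] (V : GrMod 𝓡) (f : CoindModule V) :
    ∃ s : Finset ℤ, f = ∑ n ∈ s, coindPart V n f := by
  classical
  have key : ∀ x : R, ∃ s : Finset ℤ, ∀ t, s ⊆ t → f x = ∑ n ∈ t, coindPart V n f x := by
    intro x
    induction mem_closure_homogeneous (𝓡 := 𝓡) x using AddSubgroup.closure_induction with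
    | mem x hx =>
      obtain ⟨i, hi⟩ := hx
      obtain ⟨s, hs⟩ := V.exists_eq_sum_proj (f x)
      refine ⟨s.image (fun m => m - i), fun t ht => ?_⟩
      have := hs (t.image (fun m => i + m)) fun m hm =>
        Finset.mem_image.2 ⟨m - i, ht (Finset.mem_image_of_mem _ hm), by ring⟩
      rw [Finset.sum_image (fun a _ b _ h => by simpa using h)] at this
      simpa only [coindPart_apply V _ f hi] using this
    | zero => exact ⟨∅, fun t _ => by simp⟩
    | add a b _ _ ha hb =>
      obtain ⟨s, hs⟩ := ha
      obtain ⟨t, ht⟩ := hb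
      refine ⟨s ∪ t, fun r hr => ?_⟩
      simp only [map_add, Finset.sum_add_distrib]
      rw [← hs r (Finset.union_subset_left hr), ← ht r (Finset.union_subset_right hr)]
    | neg a _ ha =>
      obtain ⟨s, hs⟩ := ha
      refine ⟨s, fun r hr => ?_⟩
      simp only [map_neg, Finset.sum_neg_distrib]
      rw [← hs r hr]
  choose s hs using key
  let b := Module.finBasis k R
  refine ⟨Finset.univ.biUnion fun j => s (b j), ?_⟩
  refine b.ext (f₁ := (f : R →ₗ[k] V.toMod)) fun j => ?_
  refine (hs (b j) _ (Finset.subset_biUnion_of_mem (fun j => s (b j)) (Finset.mem_univ j))).trans ?_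
  exact (CoindModule.sum_apply _ _ (b j)).symm

variable [FiniteDimensional k R]

/-- The coinduced graded module `Hom_k(R, V)`. -/
def coind (V : GrMod 𝓡) : GrMod 𝓡 where
  toMod := ModuleCat.of R (CoindModule V)
  deg n :=
    { carrier := {f : CoindModule V | ∀ i, ∀ x ∈ 𝓡 i, f x ∈ V.deg (i + n)}
      add_mem' := fun hf hg i x hx => add_mem (hf i x hx) (hg i x hx)
      zero_mem' := fun i _ _ => zero_mem (V.deg (i + n))
      neg_mem' := fun hf i x hx => neg_mem (hf i x hx) }
  internal := by
    refine isInternal_of_proj (M := CoindModule V) _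
      (fun n => { toFun := coindPart V n, map_zero' := ?_, map_add' := fun f g => ?_ }) ?_ ?_ ?_
    · refine CoindModule.ext_homogeneous fun i x hx => ?_
      rw [coindPart_apply V n _ hx, CoindModule.zero_apply, map_zero]
    · refine CoindModule.ext_homogeneous fun i x hx => ?_
      rw [CoindModule.add_apply, coindPart_apply V n _ hx, coindPart_apply V n _ hx,
        coindPart_apply V n _ hx, CoindModule.add_apply, map_add]
    · intro n f hf
      refine CoindModule.ext_homogeneous fun i x hx => ?_
      exact (coindPart_apply V n f hx).trans (proj_of_mem (hf i x hx))
    · intro m n h f hf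
      refine CoindModule.ext_homogeneous fun i x hx => ?_
      exact (coindPart_apply V n f hx).trans (proj_of_ne (by omega) (hf i x hx))
    · intro f
      obtain ⟨s, hs⟩ := exists_eq_sum_coindPart V f
      rw [hs]
      refine sum_mem fun n _ => AddSubgroup.subset_closure ⟨n, fun i x hx => ?_⟩
      rw [coindPart_apply V n f hx]
      exact proj_mem _ _
  smul_mem := by
    intro d n r f hr hf i x hx
    have := hf (i + d) (x * r) (SetLike.GradedMul.mul_mem hx hr)
    rwa [add_assoc] at this

/-- The embedding `v ↦ (x ↦ x v)` of a graded module in the coinduced module. -/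
def coindι (V : GrMod 𝓡) : V ⟶ coind V :=
  ofLin (N := coind V)
    { toFun := fun v => ((Algebra.lsmul k k V.toMod).toLinearMap.flip v : R →ₗ[k] V.toMod)
      map_add' := fun v w => map_add (Algebra.lsmul k k V.toMod).toLinearMap.flip v w
      map_smul' := fun r v => CoindModule.ext (V := V) fun x => (mul_smul x r v).symm }
    fun _ _ hv _ _ hx => V.smul_mem hx hv

/-- Evaluation at `1`, a `k`-linear retraction of `coindι`. -/
def coindρ (V : GrMod 𝓡) : (coind V).toMod →+ V.toMod where
  toFun f := (show CoindModule V from f) 1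
  map_zero' := rfl
  map_add' _ _ := rfl

theorem coindρ_ι (V : GrMod 𝓡) (v : V.toMod) : coindρ V (lin (coindι V) v) = v := one_smul R v

theorem coindρ_mem (V : GrMod 𝓡) {n : ℤ} {f : (coind V).toMod} (hf : f ∈ (coind V).deg n) :
    coindρ V f ∈ V.deg n := by
  have := hf 0 1 SetLike.GradedOne.one_mem
  rwa [zero_add] at this

theorem coindρ_smul (V : GrMod 𝓡) (c : k) (f : (coind V).toMod) :
    coindρ V (algebraMap k R c • f) = algebraMap k R c • coindρ V f := by
  change (show CoindModule V from f) (1 * algebraMap k R c) = _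
  rw [one_mul, Algebra.algebraMap_eq_smul_one, map_smul, ← algebraMap_smul R c]
  rw [Algebra.algebraMap_eq_smul_one]
  rfl

/-- The map of coinduced modules induced by a morphism. -/
def coindMap {V W : GrMod 𝓡} (f : V ⟶ W) : coind V ⟶ coind W :=
  ofLin (M := coind V) (N := coind W)
    { toFun := fun φ => (((lin f).restrictScalars k) ∘ₗ (φ : R →ₗ[k] V.toMod) : R →ₗ[k] W.toMod)
      map_add' := fun _ _ => CoindModule.ext (V := W) fun _ => map_add (lin f) _ _
      map_smul' := fun _ _ => rfl }
    fun _ _ hφ i x hx => lin_mem f (hφ i x hx)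

theorem coindMap_ι {V W : GrMod 𝓡} (f : V ⟶ W) (v : V.toMod) :
    lin (coindMap f) (lin (coindι V) v) = lin (coindι W) (lin f v) :=
  CoindModule.ext (V := W) fun x => map_smul (lin f) x v

/-- Every linear map from a left ideal to `V`, homogeneous or not, extends to a linear map from the
ring to the coinduced module of `V`. -/
theorem exists_extension_coind (V : GrMod 𝓡) (I : Submodule R R) (g : I →ₗ[R] V.toMod) :
    ∃ G : R →ₗ[R] (coind V).toMod, ∀ x : I, G x = lin (coindι V) (g x) := by
  obtain ⟨g', hg'⟩ := LinearMap.exists_extend (p := I.restrictScalars k) (g.restrictScalars k)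
  refine ⟨LinearMap.toSpanSingleton R (coind V).toMod (show CoindModule V from g'), fun x => ?_⟩
  refine CoindModule.ext (V := V) fun y => ?_
  have := LinearMap.congr_fun hg' (⟨y * x, I.smul_mem y x.2⟩ : I)
  refine Eq.trans this ?_
  exact map_smul g y x

end Coind

end GrMod

/-! ### Finitely generated graded submodules and their coinduced modules -/

namespace GrMod

variable {k : Type u} [Field k] {R : Type u} [Ring R] [Algebra k R] {𝓡 : ℤ → Submodule k R}

theorem isHomogeneous_map {X Y : GrMod 𝓡} (f : X ⟶ Y) {p : Submodule R X.toMod}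
    (hp : X.IsHomogeneous p) : Y.IsHomogeneous (p.map (lin f)) := by
  rw [isHomogeneous_iff] at hp ⊢
  rintro n _ ⟨x, hx, rfl⟩
  exact ⟨X.proj n x, hp n x hx, lin_proj f n x⟩

/-- The homogeneous components of generators of a finitely generated submodule generate a finitely
generated graded submodule. -/
theorem exists_homogeneous_fg [GradedAlgebra 𝓡] (X : GrMod 𝓡) (N : Submodule R X.toMod)
    (hN : N.FG) : ∃ p : Submodule R X.toMod, X.IsHomogeneous p ∧ p.FG ∧ N ≤ p := by
  classical
  induction N, hN using Submodule.fg_induction with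
  | singleton x =>
    obtain ⟨s, hs⟩ := X.exists_eq_sum_proj x
    refine ⟨Submodule.span R (s.image fun n => X.proj n x), ?_, ⟨_, rfl⟩, ?_⟩
    · rw [isHomogeneous_iff]
      intro n y hy
      induction hy using Submodule.span_induction generalizing n with
      | mem y hy =>
        obtain ⟨i, hi, rfl⟩ := Finset.mem_image.1 hy
        by_cases h : i = n
        · subst h; rw [proj_of_mem (proj_mem i x)]; exact Submodule.subset_span hy
        · rw [proj_of_ne h (proj_mem i x)]; exact zero_mem _
      | zero => rw [map_zero]; exact zero_mem _
      | add y z _ _ hy hz => rw [map_add]; exact add_mem (hy n) (hz n)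
      | smul r y _ hy =>
        induction mem_closure_homogeneous (𝓡 := 𝓡) r using AddSubgroup.closure_induction with
        | mem r hr =>
          obtain ⟨d, hd⟩ := hr
          have := smul_proj hd (n - d) y
          rw [add_sub_cancel] at this
          rw [this]
          exact Submodule.smul_mem _ _ (hy _)
        | zero => rw [zero_smul, map_zero]; exact zero_mem _
        | add a b _ _ ha hb => rw [add_smul, map_add]; exact add_mem ha hb
        | neg a _ ha => rw [neg_smul, map_neg]; exact neg_mem ha
    · rw [Submodule.span_singleton_le_iff_mem]
      have : ∑ i ∈ s, X.proj i x ∈ Submodule.span R (s.image fun n => X.proj n x : Set X.toMod) :=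
        sum_mem fun i hi => Submodule.subset_span (Finset.mem_image_of_mem _ hi)
      rwa [← hs s subset_rfl] at this
  | sup N₁ N₂ _ _ h₁ h₂ =>
    obtain ⟨p, hp, fp, lp⟩ := h₁
    obtain ⟨q, hq, fq, lq⟩ := h₂
    refine ⟨p ⊔ q, ?_, fp.sup fq, sup_le_sup lp lq⟩
    rw [isHomogeneous_iff] at hp hq ⊢
    intro n x hx
    obtain ⟨a, ha, b, hb, rfl⟩ := Submodule.mem_sup.1 hx
    rw [map_add]
    exact add_mem (Submodule.mem_sup_left (hp n a ha)) (Submodule.mem_sup_right (hq n b hb))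

/-- The finitely generated graded submodules of `X`. -/
def FGSub (X : GrMod 𝓡) : Type u := {p : Submodule R X.toMod // X.IsHomogeneous p ∧ p.FG}

/-- The image of a finitely generated graded submodule. -/
def FGSub.map {X Y : GrMod 𝓡} (f : X ⟶ Y) (p : FGSub X) : FGSub Y :=
  ⟨p.1.map (lin f), isHomogeneous_map f p.2.1, p.2.2.map (lin f)⟩

/-- A finitely generated graded submodule as a graded module. -/
def FGSub.obj {X : GrMod 𝓡} (p : FGSub X) : GrMod 𝓡 := sub p.1 p.2.1

/-- The inclusion of a finitely generated graded submodule. -/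
def FGSub.incl {X : GrMod 𝓡} (p : FGSub X) : p.obj ⟶ X := subι p.1 p.2.1

theorem FGSub.incl_injective {X : GrMod 𝓡} (p : FGSub X) : Function.Injective (lin p.incl) :=
  subι_injective _ _

/-- The map from a finitely generated graded submodule to its image. -/
def FGSub.res {X Y : GrMod 𝓡} (f : X ⟶ Y) (p : FGSub X) : p.obj ⟶ (p.map f).obj :=
  subMap p.1 p.2.1 f _ _ fun _ hx => Submodule.mem_map_of_mem hx

/-- The direct sum of all finitely generated graded submodules of `X`. -/
abbrev locObj (X : GrMod 𝓡) : GrMod 𝓡 := dsum fun p : FGSub X => p.obj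

/-- The inclusion of a summand of `locObj X`. -/
abbrev locIn {X : GrMod 𝓡} (p : FGSub X) : p.obj ⟶ locObj X :=
  dsumι (fun p : FGSub X => p.obj) p

/-- Equality of elements in summands whose indices are only propositionally equal. -/
theorem locIn_eq {X : GrMod 𝓡} {p q : FGSub X} (h : p = q) {x : p.obj.toMod} {y : q.obj.toMod}
    (hxy : lin p.incl x = lin q.incl y) : lin (locIn p) x = lin (locIn q) y := by
  subst h
  rw [p.incl_injective hxy]

/-- The action of `locObj` on morphisms. -/
def locMap {X Y : GrMod 𝓡} (f : X ⟶ Y) : locObj X ⟶ locObj Y :=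
  dsumMap (FGSub.map f) (FGSub.res f)

theorem locMap_in {X Y : GrMod 𝓡} (f : X ⟶ Y) (p : FGSub X) (x : p.obj.toMod) :
    lin (locMap f) (lin (locIn p) x) = lin (locIn (p.map f)) (lin (p.res f) x) :=
  dsumMap_ι (FGSub.map f) (FGSub.res f) p x

variable (𝓡) in
/-- The functor sending a graded module to the direct sum of its finitely generated graded
submodules. -/
def loc : GrMod 𝓡 ⥤ GrMod 𝓡 where
  obj := locObj
  map f := locMap f
  map_id X := dsum_hom_ext fun p x => (locMap_in _ p x).trans
    (locIn_eq (Subtype.ext (Submodule.map_id _)) rfl)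
  map_comp {X Y Z} f g := dsum_hom_ext fun p x => by
    change lin (locMap (f ≫ g)) (lin (locIn p) x) =
      lin (locMap g) (lin (locMap f) (lin (locIn p) x))
    rw [locMap_in, locMap_in, locMap_in]
    exact locIn_eq (Subtype.ext (Submodule.map_comp (lin f) (lin g) p.1)) rfl

/-- The canonical map from `locObj X` to `X`. -/
def locDesc (X : GrMod 𝓡) : locObj X ⟶ X := dsumDesc fun p : FGSub X => p.incl

theorem locDesc_in (X : GrMod 𝓡) (p : FGSub X) (x : p.obj.toMod) :
    lin (locDesc X) (lin (locIn p) x) = lin p.incl x :=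
  dsumDesc_ι (fun p : FGSub X => p.incl) p x

variable (𝓡) in
/-- The map to a graded module from the direct sum of its finitely generated graded submodules. -/
def locι : loc 𝓡 ⟶ 𝟭 (GrMod 𝓡) where
  app X := locDesc X
  naturality X Y f := dsum_hom_ext fun p x => by
    change lin (locDesc Y) (lin (locMap f) (lin (locIn p) x)) =
      lin f (lin (locDesc X) (lin (locIn p) x))
    rw [locMap_in, locDesc_in, locDesc_in]
    rfl

variable [GradedAlgebra 𝓡] [FiniteDimensional k R]

/-- The direct sum of the coinduced modules of all finitely generated graded submodules of `X`. -/
abbrev envObj (X : GrMod 𝓡) : GrMod 𝓡 := dsum fun p : FGSub X => coind p.obj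

/-- The inclusion of a summand of `envObj X`. -/
abbrev envIn {X : GrMod 𝓡} (p : FGSub X) : coind p.obj ⟶ envObj X :=
  dsumι (fun p : FGSub X => coind p.obj) p

theorem envIn_eq {X : GrMod 𝓡} {p q : FGSub X} (h : p = q) {x : (coind p.obj).toMod}
    {y : (coind q.obj).toMod} (hxy : ∀ r, lin p.incl ((show CoindModule p.obj from x) r) =
      lin q.incl ((show CoindModule q.obj from y) r)) :
    lin (envIn p) x = lin (envIn q) y := by
  subst h
  congr 1
  exact CoindModule.ext (V := p.obj) fun r => p.incl_injective (hxy r)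

/-- The action of `envObj` on morphisms. -/
def envMap {X Y : GrMod 𝓡} (f : X ⟶ Y) : envObj X ⟶ envObj Y :=
  dsumMap (X := fun p : FGSub X => coind p.obj) (Y := fun p : FGSub Y => coind p.obj)
    (FGSub.map f) fun p => coindMap (FGSub.res f p)

theorem envMap_in {X Y : GrMod 𝓡} (f : X ⟶ Y) (p : FGSub X) (x : (coind p.obj).toMod) :
    lin (envMap f) (lin (envIn p) x) = lin (envIn (p.map f)) (lin (coindMap (p.res f)) x) :=
  dsumMap_ι (X := fun p : FGSub X => coind p.obj) (Y := fun p : FGSub Y => coind p.obj)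
    (FGSub.map f) (fun p => coindMap (FGSub.res f p)) p x

variable (𝓡) in
/-- The functor sending a graded module to the direct sum of the coinduced modules of its finitely
generated graded submodules. -/
def env : GrMod 𝓡 ⥤ GrMod 𝓡 where
  obj := envObj
  map f := envMap f
  map_id X := dsum_hom_ext fun p x => (envMap_in _ p x).trans
    (envIn_eq (Subtype.ext (Submodule.map_id _)) fun _ => rfl)
  map_comp {X Y Z} f g := dsum_hom_ext fun p x => by
    change lin (envMap (f ≫ g)) (lin (envIn p) x) =
      lin (envMap g) (lin (envMap f) (lin (envIn p) x))
    rw [envMap_in, envMap_in, envMap_in]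
    exact envIn_eq (Subtype.ext (Submodule.map_comp (lin f) (lin g) p.1)) fun _ => rfl

/-- The embedding of `locObj X` in `envObj X`. -/
def locToEnv (X : GrMod 𝓡) : locObj X ⟶ envObj X :=
  dsumMap (Y := fun p : FGSub X => coind p.obj) id fun p : FGSub X => coindι p.obj

theorem locToEnv_in (X : GrMod 𝓡) (p : FGSub X) (x : p.obj.toMod) :
    lin (locToEnv X) (lin (locIn p) x) = lin (envIn p) (lin (coindι p.obj) x) :=
  dsumMap_ι (Y := fun p : FGSub X => coind p.obj) id (fun p : FGSub X => coindι p.obj) p x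

variable (𝓡) in
/-- The embedding of the sum of the finitely generated graded submodules in the sum of their
coinduced modules. -/
def envι : loc 𝓡 ⟶ env 𝓡 where
  app X := locToEnv X
  naturality X Y f := dsum_hom_ext fun p x => by
    change lin (locToEnv Y) (lin (locMap f) (lin (locIn p) x)) =
      lin (envMap f) (lin (locToEnv X) (lin (locIn p) x))
    rw [locMap_in, locToEnv_in, locToEnv_in, envMap_in, coindMap_ι]

/-- The retraction of `locToEnv` given by the evaluations at `1`. -/
def envρ (X : GrMod 𝓡) : (envObj X).toMod →+ (locObj X).toMod :=
  (DirectSum.map fun p : FGSub X => coindρ p.obj :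
    (⨁ p : FGSub X, (coind p.obj).toMod) →+ ⨁ p : FGSub X, p.obj.toMod)

theorem envρ_apply (X : GrMod 𝓡) (y : (envObj X).toMod) (p : FGSub X) :
    lin (dsumπ (fun p : FGSub X => p.obj) p) (envρ X y) =
      coindρ p.obj (lin (dsumπ (fun p : FGSub X => coind p.obj) p) y) :=
  DirectSum.map_apply (α := fun p : FGSub X => (coind p.obj).toMod)
    (β := fun p : FGSub X => p.obj.toMod) (fun p : FGSub X => coindρ p.obj) p y

theorem dsumπ_locToEnv (X : GrMod 𝓡) (x : (locObj X).toMod) (p : FGSub X) :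
    lin (dsumπ (fun p : FGSub X => coind p.obj) p) (lin (locToEnv X) x) =
      lin (coindι p.obj) (lin (dsumπ (fun p : FGSub X => p.obj) p) x) := by
  induction x using dsum_induction with
  | zero => simp only [map_zero]
  | ι q x =>
    rw [locToEnv_in]
    by_cases h : p = q
    · subst h; rw [dsumπ_ι_same, dsumπ_ι_same]
    · rw [dsumπ_ι_ne _ h, dsumπ_ι_ne _ h, map_zero]
  | add x y hx hy => simp only [map_add, hx, hy]

theorem envρ_locToEnv (X : GrMod 𝓡) (x : (locObj X).toMod) :
    envρ X (lin (locToEnv X) x) = x :=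
  dsum_ext fun p => by rw [envρ_apply, dsumπ_locToEnv, coindρ_ι]

theorem envρ_mem (X : GrMod 𝓡) {n : ℤ} {y : (envObj X).toMod}
    (hy : y ∈ (envObj X).deg n) : envρ X y ∈ (locObj X).deg n :=
  mem_dsum_deg.2 fun p => by
    rw [envρ_apply]
    exact coindρ_mem _ (hy p)

theorem envρ_smul (X : GrMod 𝓡) (c : k) (y : (envObj X).toMod) :
    envρ X (algebraMap k R c • y) = algebraMap k R c • envρ X y :=
  dsum_ext fun p => by
    rw [envρ_apply, map_smul (lin _), coindρ_smul, map_smul (lin _), envρ_apply]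

/-- Every linear map from a left ideal to `X` lifts to the sum of the finitely generated graded
submodules, and the lift extends to the whole ring after passing to the coinduced modules. -/
theorem exists_extension_env (X : GrMod 𝓡) (I : Submodule R R) (g : I →ₗ[R] X.toMod) :
    ∃ (g' : I →ₗ[R] (locObj X).toMod) (G : R →ₗ[R] (envObj X).toMod), ∀ x : I,
      lin (locDesc X) (g' x) = g x ∧ G x = lin (locToEnv X) (g' x) := by
  have : IsNoetherianRing R := isNoetherian_of_tower k inferInstance
  obtain ⟨p, hp, fp, lp⟩ := exists_homogeneous_fg X (LinearMap.range g)
    (Module.Finite.iff_fg.1 (Module.Finite.range g))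
  let P : FGSub X := ⟨p, hp, fp⟩
  let g₀ : I →ₗ[R] P.obj.toMod := g.codRestrict p fun x => lp ⟨x, rfl⟩
  obtain ⟨G, hG⟩ := exists_extension_coind P.obj I g₀
  refine ⟨lin (locIn P) ∘ₗ g₀,
    lin (envIn P) ∘ₗ G, fun x => ⟨?_, ?_⟩⟩
  · exact locDesc_in X P (g₀ x)
  · exact (congrArg _ (hG x)).trans (locToEnv_in X P (g₀ x)).symm

/-- The cokernel of `locToEnv` is a direct sum of indecomposables, since it is a direct sum of
finite dimensional modules. -/
theorem exists_env_decomposition (X : GrMod 𝓡) :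
    ∃ (J : Type u) (W : J → GrMod 𝓡) (q : envObj X ⟶ dsum W),
      (∀ j, (W j).IsIndecomposable) ∧ Function.Surjective (lin q) ∧
        ∀ y, lin q y = 0 ↔ ∃ x, lin (locToEnv X) x = y := by
  have : IsArtinianRing R := isArtinian_of_tower k inferInstance
  have : IsNoetherianRing R := isNoetherian_of_tower k inferInstance
  have dec : ∀ p : FGSub X, (coker (coindι p.obj)).IsSumOfIndecomposables := fun p => by
    have : Module.Finite R p.1 := Module.Finite.iff_fg.2 p.2.2
    have : Module.Finite R p.obj.toMod := this
    have : FiniteDimensional k p.obj.toMod := Module.Finite.trans R _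
    have : Module.Finite R (coind p.obj).toMod :=
      inferInstanceAs (Module.Finite R (CoindModule p.obj))
    have : Module.Finite R (coker (coindι p.obj)).toMod :=
      Module.Finite.of_surjective (lin (cokerπ _)) (cokerπ_surjective _)
    have : IsArtinian R (coker (coindι p.obj)).toMod := inferInstance
    have : IsNoetherian R (coker (coindι p.obj)).toMod := inferInstance
    exact isSumOfIndecomposables_of_finite _
  choose J W hW e he using dec
  let W' : (Σ p, J p) → GrMod 𝓡 := fun j => W j.1 j.2
  let q₀ : ∀ p : FGSub X, coind p.obj ⟶ dsum W' := fun p =>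
    cokerπ (coindι p.obj) ≫ e p ≫ dsumIncl W' (Sigma.mk p)
  let q : envObj X ⟶ dsum W' := dsumDesc q₀
  have hq : ∀ p y, lin q (lin (envIn p) y) =
      lin (dsumIncl W' (Sigma.mk p)) (lin (e p) (lin (cokerπ (coindι p.obj)) y)) :=
    fun p y => dsumDesc_ι q₀ p y
  have hπ : ∀ p j y, lin (dsumπ W' ⟨p, j⟩) (lin q y) = lin (dsumπ (W p) j) (lin (e p)
      (lin (cokerπ (coindι p.obj)) (lin (dsumπ (fun p : FGSub X => coind p.obj) p) y))) := by
    intro p j y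
    induction y using dsum_induction with
    | zero => simp only [map_zero]
    | ι p' y =>
      rw [hq]
      by_cases h : p = p'
      · subst h
        rw [dsumπ_ι_same]
        exact dsumπ_incl W' (Sigma.mk p) sigma_mk_injective j _
      · rw [dsumπ_ι_ne _ h, dsumπ_incl_ne W' (Sigma.mk p') fun j' e => h (congrArg Sigma.fst e)]
        simp only [map_zero]
    | add x y hx hy => simp only [map_add, hx, hy]
  refine ⟨Σ p, J p, W', q, fun j => hW j.1 j.2, ?_, fun y => ⟨fun hy => ⟨envρ X y, ?_⟩, ?_⟩⟩
  · intro z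
    induction z using dsum_induction with
    | zero => exact ⟨0, map_zero _⟩
    | ι j w =>
      obtain ⟨p, j⟩ := j
      obtain ⟨x, hx⟩ := (he p).2 (lin (dsumι (W p) j) w)
      obtain ⟨y, rfl⟩ := cokerπ_surjective _ x
      refine ⟨lin (envIn p) y, ?_⟩
      rw [hq, hx]
      exact dsumIncl_ι W' (Sigma.mk p) j w
    | add x y hx hy =>
      obtain ⟨a, rfl⟩ := hx
      obtain ⟨b, rfl⟩ := hy
      exact ⟨a + b, map_add _ _ _⟩
  · refine dsum_ext fun p => ?_
    have h0 : lin (cokerπ (coindι p.obj))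
        (lin (dsumπ (fun p : FGSub X => coind p.obj) p) y) = 0 := by
      refine (injective_iff_map_eq_zero _).1 (he p).1 _ (dsum_ext fun j => ?_)
      rw [← hπ p j y, hy, map_zero]
      exact (map_zero _).symm
    obtain ⟨x, hx⟩ := (cokerπ_eq_zero_iff _).1 h0
    rw [dsumπ_locToEnv, envρ_apply, ← hx, coindρ_ι]
  · rintro ⟨x, rfl⟩
    refine dsum_ext fun j => ?_
    obtain ⟨p, j⟩ := j
    rw [hπ, dsumπ_locToEnv, cokerπ_map]
    simp only [map_zero]

end GrMod

/-! ### The graded modules `A ⊗ V` -/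

section Free

variable {k : Type u} [Field k] {H : Type u} [Ring H] [HopfAlgebra k H]
  {A : Type u} [Ring A] [Algebra k A] [Module H A] [IsScalarTower k H A] [ModuleAlgebra k H A]

open GrMod SmashProduct

theorem regA_smul (b : SmashProduct k H A) (x : A) :
    (b • (show regA k H A from x) : regA k H A) = regAct k H A b x := rfl

theorem regA_inclA_smul (a x : A) :
    (inclA k H A a • (show regA k H A from x) : regA k H A) = a * x := by
  rw [regA_smul, inclA_apply, regAct_mk, one_smul]

theorem regA_inclH_smul (h : H) (x : A) :
    (inclH k H A h • (show regA k H A from x) : regA k H A) = h • x := by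
  rw [regA_smul, inclH_apply, regAct_mk, one_mul]

theorem regA_ksmul (c : k) (x : A) :
    (c • (show regA k H A from x) : regA k H A) = c • x := by
  change algebraMap k (SmashProduct k H A) c • (show regA k H A from x) = _
  rw [← AlgHom.commutes (inclA k H A), regA_inclA_smul, Algebra.smul_def]

theorem tensorAct_inclA {M : BMod k H A} {V : ModuleCat.{u} H} (a : A) (m : M) (v : V) :
    tensorAct k H A M V (inclA k H A a) (m ⊗ₜ v) = (inclA k H A a • m) ⊗ₜ v := by
  change (Module.endTensorEndAlgHom (R := k) (S := k) (A := k) (M := M) (N := V))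
    ((Algebra.TensorProduct.map (Algebra.lsmul k k M) (Algebra.lsmul k k V))
      (SmashProduct.coaction k H A (mk k H A a 1))) (m ⊗ₜ v) = _
  rw [coaction_repr k H A a 1 ⟨{()}, fun _ => 1, fun _ => 1, by
      simp [Algebra.TensorProduct.one_def]⟩]
  simp [Module.endTensorEndAlgHom_apply]
  rfl

theorem tensorAct_inclH {M : BMod k H A} {V : ModuleCat.{u} H} (h : H) (m : M) (v : V)
    {ι : Type*} (r : Coalgebra.Repr k h ι) :
    tensorAct k H A M V (inclH k H A h) (m ⊗ₜ v) =
      ∑ i ∈ r.index, (inclH k H A (r.left i) • m) ⊗ₜ (r.right i • v) := by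
  change (Module.endTensorEndAlgHom (R := k) (S := k) (A := k) (M := M) (N := V))
    ((Algebra.TensorProduct.map (Algebra.lsmul k k M) (Algebra.lsmul k k V))
      (SmashProduct.coaction k H A (mk k H A 1 h))) (m ⊗ₜ v) = _
  rw [coaction_repr k H A 1 h r]
  simp [Module.endTensorEndAlgHom_apply, LinearMap.sum_apply]
  rfl

/-- The homogeneous parts of a tensor product are additively spanned by homogeneous pure tensors. -/
theorem tensorDeg_induction {M N : Type u} [AddCommGroup M] [Module k M] [AddCommGroup N]
    [Module k N] {P : ℤ → Set M} {Q : ℤ → Set N} {n : ℤ} (hP : ∀ i, ∀ c : k, ∀ x ∈ P i, c • x ∈ P i)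
    {p : M ⊗[k] N → Prop} (zero : p 0)
    (mk : ∀ i j, i + j = n → ∀ x ∈ P i, ∀ y ∈ Q j, p (x ⊗ₜ y))
    (add : ∀ x y, p x → p y → p (x + y)) {z : M ⊗[k] N} (hz : z ∈ tensorDeg k P Q n) : p z := by
  have key : ∀ c : k, p (c • z) := by
    refine Submodule.span_induction (p := fun z _ => ∀ c : k, p (c • z)) ?_ ?_ ?_ ?_ hz
    · rintro _ ⟨i, j, hij, x, hx, v, hv, rfl⟩ c
      rw [TensorProduct.smul_tmul']
      exact mk i j hij _ (hP i c x hx) v hv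
    · intro c
      rwa [smul_zero]
    · intro x y _ _ hx hy c
      rw [smul_add]
      exact add _ _ (hx c) (hy c)
    · intro d x _ hx c
      rw [smul_smul]
      exact hx _
  have := key 1
  rwa [one_smul] at this

/-- An additive map between `A # H`-modules is linear if it commutes with `A` and `H`. -/
theorem map_smul_of_incl {X Y : Type u} [AddCommGroup X] [Module (SmashProduct k H A) X]
    [AddCommGroup Y] [Module (SmashProduct k H A) Y] (f : X →+ Y)
    (hA : ∀ a x, f (inclA k H A a • x) = inclA k H A a • f x)
    (hH : ∀ h x, f (inclH k H A h • x) = inclH k H A h • f x) (b : SmashProduct k H A) (x : X) :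
    f (b • x) = b • f x := by
  induction b using SmashProduct.induction with
  | zero => simp
  | mk a h => rw [← inclA_mul_inclH, mul_smul, mul_smul, hA, hH]
  | add b c hb hc => rw [add_smul, add_smul, map_add, hb, hc]

variable {𝓗 : ℤ → Submodule k H} [GradedAlgebra 𝓗] [IsGradedHopf 𝓗]
  {𝓐 : ℤ → Submodule k A} [GradedAlgebra 𝓐] [IsGradedAction 𝓗 𝓐]

variable (𝓐) in
/-- The element `x ⊗ v` of the graded module `A ⊗ V`. -/
def freeMk {V : GrMod 𝓗} (x : A) (v : V.toMod) : (grFreeObj 𝓗 𝓐 V).toMod :=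
  (show regA k H A from x) ⊗ₜ[k] v

section freeMk

variable {V : GrMod 𝓗}

theorem freeMk_add (x : A) (v w : V.toMod) :
    freeMk 𝓐 x (v + w) = freeMk 𝓐 x v + freeMk 𝓐 x w := TensorProduct.tmul_add _ _ _

@[elab_as_elim]
theorem free_induction {p : (grFreeObj 𝓗 𝓐 V).toMod → Prop} (z : (grFreeObj 𝓗 𝓐 V).toMod)
    (zero : p 0) (mk : ∀ x v, p (freeMk 𝓐 x v)) (add : ∀ y z, p y → p z → p (y + z)) : p z :=
  TensorProduct.induction_on (motive := p) z zero mk add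

theorem inclA_smul_freeMk (a x : A) (v : V.toMod) :
    inclA k H A a • freeMk 𝓐 x v = freeMk 𝓐 (a * x) v := by
  refine (tensorAct_inclA (M := regA k H A) a _ v).trans ?_
  rw [regA_inclA_smul]
  rfl

theorem inclH_smul_freeMk (h : H) (x : A) (v : V.toMod) {ι : Type*} (r : Coalgebra.Repr k h ι) :
    inclH k H A h • freeMk 𝓐 x v = ∑ i ∈ r.index, freeMk 𝓐 (r.left i • x) (r.right i • v) := by
  refine (tensorAct_inclH (M := regA k H A) h _ v r).trans ?_
  refine Finset.sum_congr rfl fun i _ => ?_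
  rw [regA_inclH_smul]
  rfl

theorem smul_freeMk (c : k) (x : A) (v : V.toMod) : freeMk 𝓐 (c • x) v = freeMk 𝓐 x (c • v) := by
  have : freeMk 𝓐 (c • x) v = (c • (show regA k H A from x)) ⊗ₜ[k] v := by
    rw [regA_ksmul]; rfl
  exact this.trans (TensorProduct.smul_tmul _ _ _)

theorem inclH_smul_freeMk_one (h : H) (v : V.toMod) :
    inclH k H A h • freeMk 𝓐 (1 : A) v = freeMk 𝓐 1 (h • v) := by
  let r := Coalgebra.Repr.arbitrary k h
  rw [inclH_smul_freeMk h 1 v r]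
  have e : ∀ i, freeMk 𝓐 (r.left i • (1 : A)) (r.right i • v) =
      freeMk 𝓐 1 ((Coalgebra.counit (R := k) (r.left i) • r.right i) • v) := fun i => by
    rw [ModuleAlgebra.smul_one (k := k), Algebra.algebraMap_eq_smul_one]
    rw [smul_freeMk, smul_assoc]
  let F : V.toMod →+ (grFreeObj 𝓗 𝓐 V).toMod := AddMonoidHom.mk' (freeMk 𝓐 1) (freeMk_add 1)
  have hF : ∀ v, freeMk 𝓐 1 v = F v := fun _ => rfl
  simp only [e]
  simp only [hF]
  refine (map_sum F _ _).symm.trans (congrArg F ?_)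
  exact (Finset.sum_smul (M := V.toMod)).symm.trans
    (congrArg (fun h : H => h • v) (Coalgebra.sum_counit_smul r))

theorem freeMk_mem {i j : ℤ} {x : A} {v : V.toMod} (hx : x ∈ 𝓐 i) (hv : v ∈ V.deg j) :
    freeMk 𝓐 x v ∈ (grFreeObj 𝓗 𝓐 V).deg (i + j) :=
  Submodule.subset_span (M := (grRegA 𝓗 𝓐).toMod ⊗[k] V.toMod) ⟨i, j, rfl, x, hx, v, hv, rfl⟩

theorem free_deg_induction {n : ℤ} {p : (grFreeObj 𝓗 𝓐 V).toMod → Prop} (zero : p 0)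
    (mk : ∀ i j, i + j = n → ∀ x ∈ 𝓐 i, ∀ v ∈ V.deg j, p (freeMk 𝓐 x v))
    (add : ∀ x y, p x → p y → p (x + y))
    {z : (grFreeObj 𝓗 𝓐 V).toMod} (hz : z ∈ (grFreeObj 𝓗 𝓐 V).deg n) : p z := by
  refine tensorDeg_induction (p := p) (fun i c x hx => (grRegA 𝓗 𝓐).algebraMap_smul_mem c hx) zero
    ?_ add hz
  exact fun i j hij x hx v hv => mk i j hij x hx v hv

/-- The map `id ⊗ f : A ⊗ V → A ⊗ W` for a `k`-linear map `f`. It is `A`-linear, but commutes with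
`H` only if `f` does. -/
def freeMapₖ {W : GrMod 𝓗} (f : V.toMod →ₗ[k] W.toMod) :
    (grFreeObj 𝓗 𝓐 V).toMod →+ (grFreeObj 𝓗 𝓐 W).toMod :=
  (LinearMap.lTensor (regA k H A) f :
    regA k H A ⊗[k] V.toMod →ₗ[k] regA k H A ⊗[k] W.toMod).toAddMonoidHom

theorem freeMapₖ_mk {W : GrMod 𝓗} (f : V.toMod →ₗ[k] W.toMod) (x : A) (v : V.toMod) :
    freeMapₖ f (freeMk 𝓐 x v) = freeMk 𝓐 x (f v) := rfl

theorem freeMapₖ_isALinear {W : GrMod 𝓗} (f : V.toMod →ₗ[k] W.toMod) :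
    IsALinear (k := k) (H := H) (A := A) (freeMapₖ (𝓐 := 𝓐) f) := by
  intro a z
  induction z using free_induction with
  | zero => simp only [smul_zero, map_zero]
  | mk x v => rw [inclA_smul_freeMk, freeMapₖ_mk, freeMapₖ_mk, inclA_smul_freeMk]
  | add y z hy hz => simp only [smul_add, map_add, hy, hz]

theorem freeMapₖ_mem {W : GrMod 𝓗} (f : V.toMod →ₗ[k] W.toMod)
    (hf : ∀ i, ∀ v ∈ V.deg i, f v ∈ W.deg i) {n : ℤ} {z : (grFreeObj 𝓗 𝓐 V).toMod}
    (hz : z ∈ (grFreeObj 𝓗 𝓐 V).deg n) : freeMapₖ f z ∈ (grFreeObj 𝓗 𝓐 W).deg n := by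
  refine free_deg_induction (p := fun z => freeMapₖ f z ∈ (grFreeObj 𝓗 𝓐 W).deg n) ?_ ?_ ?_ hz
  · rw [map_zero]; exact zero_mem _
  · rintro i j rfl x hx v hv
    rw [freeMapₖ_mk]
    exact freeMk_mem hx (hf j v hv)
  · intro x y hx hy
    rw [map_add]
    exact add_mem hx hy

/-- The morphism `A ⊗ V ⟶ A ⊗ W` induced by a morphism of graded `H`-modules. -/
def freeMap {W : GrMod 𝓗} (f : V ⟶ W) : grFreeObj 𝓗 𝓐 V ⟶ grFreeObj 𝓗 𝓐 W :=
  ofLin { freeMapₖ (𝓐 := 𝓐) ((lin f).restrictScalars k) with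
    map_smul' := map_smul_of_incl (freeMapₖ (𝓐 := 𝓐) ((lin f).restrictScalars k))
      (freeMapₖ_isALinear _) fun h z => by
        induction z using free_induction with
        | zero => simp only [smul_zero, map_zero]
        | mk x v =>
          rw [freeMapₖ_mk, inclH_smul_freeMk h x v (Coalgebra.Repr.arbitrary k h),
            inclH_smul_freeMk h x _ (Coalgebra.Repr.arbitrary k h), map_sum]
          refine Finset.sum_congr rfl fun i _ => ?_
          rw [freeMapₖ_mk]
          exact congrArg _ (map_smul (lin f) _ _)
        | add y z hy hz => simp only [smul_add, map_add, hy, hz] }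
    fun _ _ hz => freeMapₖ_mem _ (fun i _ hv => lin_mem f hv) hz

theorem freeMap_mk {W : GrMod 𝓗} (f : V ⟶ W) (x : A) (v : V.toMod) :
    lin (freeMap (𝓐 := 𝓐) f) (freeMk 𝓐 x v) = freeMk 𝓐 x (lin f v) := rfl

theorem free_hom_ext {G : GrBMod 𝓗 𝓐} {f g : grFreeObj 𝓗 𝓐 V ⟶ G}
    (h : ∀ x v, lin f (freeMk 𝓐 x v) = lin g (freeMk 𝓐 x v)) : f = g := by
  refine hom_ext fun z => ?_
  induction z using free_induction with
  | zero => simp only [map_zero]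
  | mk x v => exact h x v
  | add y z hy hz => simp only [map_add, hy, hz]

/-- The functor `A ⊗ -` is right exact. -/
theorem freeMap_exact {W X : GrMod 𝓗} (f : V ⟶ W) (g : W ⟶ X)
    (hg : Function.Surjective (lin g)) (hfg : ∀ w, lin g w = 0 ↔ ∃ v, lin f v = w)
    (z : (grFreeObj 𝓗 𝓐 W).toMod) :
    lin (freeMap (𝓐 := 𝓐) g) z = 0 ↔ ∃ y, lin (freeMap (𝓐 := 𝓐) f) y = z :=
  lTensor_exact (regA k H A) (f := (lin f).restrictScalars k) (g := (lin g).restrictScalars k)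
    hfg hg z

theorem freeMap_surjective {W : GrMod 𝓗} (f : V ⟶ W) (hf : Function.Surjective (lin f)) :
    Function.Surjective (lin (freeMap (𝓐 := 𝓐) f)) :=
  LinearMap.lTensor_surjective (regA k H A) (g := (lin f).restrictScalars k) hf

/-- The map `v ↦ 1 ⊗ v`. -/
def freeUnit (V : GrMod 𝓗) : V ⟶ grResH.obj (grFreeObj 𝓗 𝓐 V) :=
  ofLin (N := grResH.obj (grFreeObj 𝓗 𝓐 V))
    { toFun := fun v => freeMk 𝓐 1 v
      map_add' := freeMk_add 1
      map_smul' := fun h v => (inclH_smul_freeMk_one h v).symm }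
    fun i v hv => by
      have := freeMk_mem (𝓐 := 𝓐) SetLike.GradedOne.one_mem hv
      rwa [zero_add] at this

section Desc

variable {G : GrBMod 𝓗 𝓐} (f : V ⟶ grResH.obj G)

/-- The map `a ⊗ v ↦ a f(v)`. -/
def freeDescₖ : (grFreeObj 𝓗 𝓐 V).toMod →+ G.toMod :=
  (TensorProduct.lift (LinearMap.mk₂ k
    (fun (x : regA k H A) (v : V.toMod) =>
      (inclA k H A (show A from x) • (show G.toMod from lin f v) : G.toMod))
    (fun x y v => by
      rw [← add_smul, ← map_add]; rfl)
    (fun c x v => by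
      have e : ∀ x : A, inclA k H A (show A from (c • (show regA k H A from x) : regA k H A)) =
          c • inclA k H A x := fun x => by
        have : (show A from (c • (show regA k H A from x) : regA k H A)) = c • x := regA_ksmul c x
        rw [this, map_smul]
      refine (congrArg (fun b => b • (show G.toMod from lin f v)) (e x)).trans ?_
      exact smul_assoc c _ (show G.toMod from lin f v))
    (fun x v w => by
      rw [map_add]; exact smul_add _ _ _)
    (fun c x v => by
      have e : (show G.toMod from lin f (c • v)) = c • (show G.toMod from lin f v) := by
        refine (map_smul (lin f) (algebraMap k H c) v).trans ?_
        change inclH k H A (algebraMap k H c) • (show G.toMod from lin f v) = _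
        rw [AlgHom.commutes, algebraMap_smul]
      rw [e]
      exact smul_comm _ _ _)) : regA k H A ⊗[k] V.toMod →ₗ[k] G.toMod).toAddMonoidHom

theorem freeDescₖ_mk (x : A) (v : V.toMod) :
    freeDescₖ f (freeMk 𝓐 x v) = inclA k H A x • (show G.toMod from lin f v) := rfl

theorem freeDescₖ_mem {n : ℤ} {z : (grFreeObj 𝓗 𝓐 V).toMod}
    (hz : z ∈ (grFreeObj 𝓗 𝓐 V).deg n) : freeDescₖ f z ∈ G.deg n := by
  refine free_deg_induction (p := fun z => freeDescₖ f z ∈ G.deg n) ?_ ?_ ?_ hz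
  · rw [map_zero]; exact zero_mem _
  · rintro i j rfl x hx v hv
    rw [freeDescₖ_mk]
    exact G.smul_mem (inclA_mem 𝓗 𝓐 i x hx) (lin_mem f hv)
  · intro x y hx hy
    rw [map_add]
    exact add_mem hx hy

/-- The morphism `A ⊗ V ⟶ G`, `a ⊗ v ↦ a f(v)`, corresponding to an `H`-linear map `f : V ⟶ G`. -/
def freeDesc : grFreeObj 𝓗 𝓐 V ⟶ G :=
  ofLin { freeDescₖ f with
    map_smul' := map_smul_of_incl (freeDescₖ f)
      (fun a z => by
        induction z using free_induction with
        | zero => simp only [smul_zero, map_zero]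
        | mk x v => rw [inclA_smul_freeMk, freeDescₖ_mk, freeDescₖ_mk, map_mul, mul_smul]
        | add y z hy hz => simp only [smul_add, map_add, hy, hz])
      (fun h z => by
        induction z using free_induction with
        | zero => simp only [smul_zero, map_zero]
        | mk x v =>
          let r := Coalgebra.Repr.arbitrary k h
          rw [inclH_smul_freeMk h x v r, freeDescₖ_mk, ← mul_smul, inclH_mul_inclA h x r, map_sum,
            Finset.sum_smul]
          refine Finset.sum_congr rfl fun i _ => ?_
          rw [freeDescₖ_mk, ← inclA_mul_inclH, mul_smul]
          exact congrArg _ (map_smul (lin f) (r.right i) v)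
        | add y z hy hz => simp only [smul_add, map_add, hy, hz]) }
    fun _ _ hz => freeDescₖ_mem f hz

theorem freeDesc_mk (x : A) (v : V.toMod) :
    lin (freeDesc f) (freeMk 𝓐 x v) = inclA k H A x • (show G.toMod from lin f v) := rfl

theorem freeDesc_one (v : V.toMod) :
    lin (freeDesc f) (freeMk 𝓐 1 v) = (show G.toMod from lin f v) := by
  rw [freeDesc_mk, map_one, one_smul]

theorem freeDesc_freeMap {W : GrMod 𝓗} (g : W ⟶ V) (z : (grFreeObj 𝓗 𝓐 W).toMod) :
    lin (freeDesc f) (lin (freeMap (𝓐 := 𝓐) g) z) = lin (freeDesc (g ≫ f)) z := by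
  refine lin_congr (f := freeMap g ≫ freeDesc f) (free_hom_ext fun x v => ?_) z
  rw [lin_comp, freeMap_mk, freeDesc_mk, freeDesc_mk]
  rfl

theorem lin_freeDesc {G' : GrBMod 𝓗 𝓐} (g : G ⟶ G') (z : (grFreeObj 𝓗 𝓐 V).toMod) :
    lin g (lin (freeDesc f) z) = lin (freeDesc (f ≫ grResH.map g)) z := by
  refine lin_congr (f := freeDesc f ≫ g) (free_hom_ext fun x v => ?_) z
  rw [lin_comp, freeDesc_mk, freeDesc_mk, map_smul]
  rfl

end Desc

end freeMk

end Free

/-! ### Pushouts of graded modules -/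

namespace GrMod

section Push

variable {k : Type u} [Field k] {R : Type u} [Ring R] [Algebra k R] {𝓡 : ℤ → Submodule k R}
  {X G Y : GrMod 𝓡} (u : X ⟶ G) (v : X ⟶ Y)

/-- The antidiagonal map `x ↦ (u x, - v x)`. -/
def antidiag : X ⟶ prod G Y :=
  ofLin (N := prod G Y) (LinearMap.prod (lin u) (-lin v)) fun _ _ hm =>
    ⟨lin_mem u hm, AddSubgroup.neg_mem _ (lin_mem v hm)⟩

/-- The pushout of `u : X ⟶ G` and `v : X ⟶ Y`. -/
def push : GrMod 𝓡 := coker (antidiag u v)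

/-- The map from `G` to the pushout. -/
def pushInl : G ⟶ push u v :=
  ofLin (N := prod G Y) (LinearMap.inl R G.toMod Y.toMod) (fun _ _ hm => ⟨hm, zero_mem _⟩) ≫
    cokerπ (antidiag u v)

/-- The map from `Y` to the pushout. -/
def pushInr : Y ⟶ push u v :=
  ofLin (N := prod G Y) (LinearMap.inr R G.toMod Y.toMod) (fun _ _ hm => ⟨zero_mem _, hm⟩) ≫
    cokerπ (antidiag u v)

variable {u v} in
theorem push_induction {p : (push u v).toMod → Prop}
    (h : ∀ g y, p (lin (pushInl u v) g + lin (pushInr u v) y)) (z : (push u v).toMod) : p z := by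
  obtain ⟨⟨g, y⟩, rfl⟩ := cokerπ_surjective (antidiag u v) z
  have := h g y
  have e : lin (pushInl u v) g + lin (pushInr u v) y = lin (cokerπ (antidiag u v)) (g, y) := by
    refine (map_add (lin (cokerπ (antidiag u v))) _ _).symm.trans (congrArg _ ?_)
    exact Prod.ext (add_zero g) (zero_add y)
  rwa [e] at this

theorem push_deg {n : ℤ} {z : (push u v).toMod} (hz : z ∈ (push u v).deg n) :
    ∃ g ∈ G.deg n, ∃ y ∈ Y.deg n, z = lin (pushInl u v) g + lin (pushInr u v) y := by
  obtain ⟨⟨g, y⟩, ⟨hg, hy⟩, rfl⟩ := hz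
  refine ⟨g, hg, y, hy, ?_⟩
  refine Eq.trans (congrArg (lin (cokerπ (antidiag u v))) ?_)
    (map_add (lin (cokerπ (antidiag u v))) _ _)
  exact Prod.ext (add_zero g).symm (zero_add y).symm

theorem push_condition (x : X.toMod) :
    lin (pushInl u v) (lin u x) = lin (pushInr u v) (lin v x) := by
  rw [← sub_eq_zero]
  refine (map_sub (lin (cokerπ (antidiag u v))) _ _).symm.trans ?_
  refine (cokerπ_eq_zero_iff _).2 ⟨x, ?_⟩
  exact Prod.ext (sub_zero _).symm (zero_sub _).symm

variable {u v}

theorem push_hom_ext {P : GrMod 𝓡} {f g : push u v ⟶ P}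
    (hl : ∀ x, lin f (lin (pushInl u v) x) = lin g (lin (pushInl u v) x))
    (hr : ∀ y, lin f (lin (pushInr u v) y) = lin g (lin (pushInr u v) y)) : f = g :=
  hom_ext fun z => by
    induction z using push_induction with
    | h x y => rw [map_add, map_add, hl, hr]

/-- The additive map from the pushout given by compatible additive maps from `G` and `Y`. -/
def pushLift {Z : Type u} [AddCommGroup Z] (s : G.toMod →+ Z) (t : Y.toMod →+ Z)
    (h : ∀ x, s (lin u x) = t (lin v x)) : (push u v).toMod →+ Z :=
  cokerLift (antidiag u v) (s.coprod t) fun x => by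
    change s (lin u x) + t (-lin v x) = 0
    rw [h, map_neg, add_neg_cancel]

theorem pushLift_inl {Z : Type u} [AddCommGroup Z] (s : G.toMod →+ Z) (t : Y.toMod →+ Z)
    (h : ∀ x, s (lin u x) = t (lin v x)) (g : G.toMod) :
    pushLift s t h (lin (pushInl u v) g) = s g :=
  (cokerLift_π (f := antidiag u v) (s.coprod t) _ (g, (0 : Y.toMod))).trans <| by
    change s g + t 0 = s g
    rw [map_zero, add_zero]

theorem pushLift_inr {Z : Type u} [AddCommGroup Z] (s : G.toMod →+ Z) (t : Y.toMod →+ Z)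
    (h : ∀ x, s (lin u x) = t (lin v x)) (y : Y.toMod) :
    pushLift s t h (lin (pushInr u v) y) = t y :=
  (cokerLift_π (f := antidiag u v) (s.coprod t) _ ((0 : G.toMod), y)).trans <| by
    change s 0 + t y = t y
    rw [map_zero, zero_add]

theorem pushLift_smul {Z : Type u} [AddCommGroup Z] [Module R Z] (s : G.toMod →+ Z)
    (t : Y.toMod →+ Z) (h : ∀ x, s (lin u x) = t (lin v x)) {r : R} (hs : ∀ g, s (r • g) = r • s g)
    (ht : ∀ y, t (r • y) = r • t y) (z : (push u v).toMod) :
    pushLift s t h (r • z) = r • pushLift s t h z := by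
  induction z using push_induction with
  | h g y =>
    rw [smul_add, ← map_smul, ← map_smul, map_add, map_add, pushLift_inl, pushLift_inl,
      pushLift_inr, pushLift_inr, hs, ht, smul_add]

theorem pushLift_mem {P : GrMod 𝓡} (s : G.toMod →+ P.toMod)
    (t : Y.toMod →+ P.toMod) (h : ∀ x, s (lin u x) = t (lin v x))
    {n : ℤ} (hs : ∀ g ∈ G.deg n, s g ∈ P.deg n) (ht : ∀ y ∈ Y.deg n, t y ∈ P.deg n)
    {z : (push u v).toMod} (hz : z ∈ (push u v).deg n) : pushLift s t h z ∈ P.deg n := by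
  obtain ⟨g, hg, y, hy, rfl⟩ := push_deg u v hz
  rw [map_add, pushLift_inl, pushLift_inr]
  exact add_mem (hs g hg) (ht y hy)

/-- The universal property of the pushout. -/
def pushDesc {P : GrMod 𝓡} (s : G ⟶ P) (t : Y ⟶ P) (h : ∀ x, lin s (lin u x) = lin t (lin v x)) :
    push u v ⟶ P :=
  ofLin (M := push u v)
    { pushLift (lin s).toAddMonoidHom (lin t).toAddMonoidHom h with
      map_smul' := fun _ z => pushLift_smul (lin s).toAddMonoidHom (lin t).toAddMonoidHom h
        (map_smul (lin s) _) (map_smul (lin t) _) z }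
    fun _ _ hz => pushLift_mem (lin s).toAddMonoidHom (lin t).toAddMonoidHom h
      (fun _ => lin_mem s) (fun _ => lin_mem t) hz

theorem pushDesc_inl {P : GrMod 𝓡} (s : G ⟶ P) (t : Y ⟶ P)
    (h : ∀ x, lin s (lin u x) = lin t (lin v x)) (g : G.toMod) :
    lin (pushDesc s t h) (lin (pushInl u v) g) = lin s g :=
  pushLift_inl (lin s).toAddMonoidHom (lin t).toAddMonoidHom h g

theorem pushDesc_inr {P : GrMod 𝓡} (s : G ⟶ P) (t : Y ⟶ P)
    (h : ∀ x, lin s (lin u x) = lin t (lin v x)) (y : Y.toMod) :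
    lin (pushDesc s t h) (lin (pushInr u v) y) = lin t y :=
  pushLift_inr (lin s).toAddMonoidHom (lin t).toAddMonoidHom h y

/-- The quotient of the pushout by `G` is the quotient of `Y` by `X`. -/
theorem exists_push_quotient {Z : GrMod 𝓡} (q : Y ⟶ Z) (hq : Function.Surjective (lin q))
    (hv : ∀ y, lin q y = 0 ↔ ∃ x, lin v x = y) :
    ∃ p : push u v ⟶ Z, Function.Surjective (lin p) ∧
      ∀ z, lin p z = 0 ↔ ∃ g, lin (pushInl u v) g = z := by
  have h : ∀ x, lin (0 : G ⟶ Z) (lin u x) = lin q (lin v x) := fun x => ((hv _).2 ⟨x, rfl⟩).symm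
  refine ⟨pushDesc 0 q h, fun z => ?_, fun z => ⟨fun hz => ?_, ?_⟩⟩
  · obtain ⟨y, rfl⟩ := hq z
    exact ⟨_, pushDesc_inr 0 q h y⟩
  · induction z using push_induction with
    | h g y =>
      rw [map_add, pushDesc_inl, pushDesc_inr] at hz
      obtain ⟨x, rfl⟩ := (hv y).1 ((zero_add _).symm.trans hz)
      exact ⟨g + lin u x, by rw [map_add, push_condition]⟩
  · rintro ⟨g, rfl⟩
    exact pushDesc_inl 0 q h g

end Push

end GrMod

/-! ### Attaching cells -/

section Step

variable {k : Type u} [Field k] {H : Type u} [Ring H] [HopfAlgebra k H]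
  {A : Type u} [Ring A] [Algebra k A] [Module H A] [IsScalarTower k H A] [ModuleAlgebra k H A]
  {𝓗 : ℤ → Submodule k H} [GradedAlgebra 𝓗] [IsGradedHopf 𝓗]
  {𝓐 : ℤ → Submodule k A} [GradedAlgebra 𝓐] [IsGradedAction 𝓗 𝓐]

open GrMod SmashProduct

section Dsum

variable {J : Type u} (W : J → GrMod 𝓗)

theorem freeMk_zero {V : GrMod 𝓗} (x : A) : freeMk 𝓐 x (0 : V.toMod) = 0 :=
  TensorProduct.tmul_zero _ _

variable (𝓐)

/-- The direct sum of the modules `A ⊗ W j`. -/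
abbrev freeSum : GrBMod 𝓗 𝓐 := dsum fun j => grFreeObj 𝓗 𝓐 (W j)

/-- The inclusion of a summand of `freeSum`. -/
abbrev freeSumι (j : J) : grFreeObj 𝓗 𝓐 (W j) ⟶ freeSum 𝓐 W :=
  dsumι (fun j => grFreeObj 𝓗 𝓐 (W j)) j

/-- The map `w ↦ 1 ⊗ w` from the direct sum of the `W j` to the direct sum of the `A ⊗ W j`. -/
def freeSumUnit : dsum W ⟶ grResH.obj (freeSum 𝓐 W) :=
  dsumDesc fun j => freeUnit (𝓐 := 𝓐) (W j) ≫ grResH.map (freeSumι 𝓐 W j)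

theorem freeSumUnit_ι (j : J) (w : (W j).toMod) :
    lin (freeSumUnit 𝓐 W) (lin (dsumι W j) w) = lin (freeSumι 𝓐 W j) (freeMk 𝓐 1 w) :=
  dsumDesc_ι _ j w

/-- The canonical map `⨁ A ⊗ W j ⟶ A ⊗ ⨁ W j`. -/
def freeSumTo : freeSum 𝓐 W ⟶ grFreeObj 𝓗 𝓐 (dsum W) := dsumDesc fun j => freeMap (dsumι W j)

theorem freeSumTo_ι (j : J) (z : (grFreeObj 𝓗 𝓐 (W j)).toMod) :
    lin (freeSumTo 𝓐 W) (lin (freeSumι 𝓐 W j) z) = lin (freeMap (𝓐 := 𝓐) (dsumι W j)) z :=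
  dsumDesc_ι (X := fun j => grFreeObj 𝓗 𝓐 (W j)) (fun j => freeMap (dsumι W j)) j z

theorem freeDesc_freeSumUnit (j : J) (x : A) (w : (W j).toMod) :
    lin (freeDesc (freeSumUnit 𝓐 W)) (freeMk 𝓐 x (lin (dsumι W j) w)) =
      lin (freeSumι 𝓐 W j) (freeMk 𝓐 x w) := by
  refine (freeDesc_mk _ _ _).trans ?_
  refine (congrArg (fun z : (freeSum 𝓐 W).toMod => inclA k H A x • z)
    (freeSumUnit_ι 𝓐 W j w)).trans ?_
  refine (map_smul (lin (freeSumι 𝓐 W j)) _ _).symm.trans ?_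
  rw [inclA_smul_freeMk, mul_one]

theorem freeSumTo_freeDesc (z : (grFreeObj 𝓗 𝓐 (dsum W)).toMod) :
    lin (freeSumTo 𝓐 W) (lin (freeDesc (freeSumUnit 𝓐 W)) z) = z := by
  induction z using free_induction with
  | zero => rw [map_zero, map_zero]
  | mk x w =>
    induction w using dsum_induction with
    | zero => rw [freeMk_zero, map_zero, map_zero]
    | ι j w => rw [freeDesc_freeSumUnit, freeSumTo_ι, freeMap_mk]
    | add v w hv hw => rw [freeMk_add, map_add, map_add, hv, hw]
  | add y z hy hz => rw [map_add, map_add, hy, hz]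

theorem freeDesc_freeSumTo (z : (freeSum 𝓐 W).toMod) :
    lin (freeDesc (freeSumUnit 𝓐 W)) (lin (freeSumTo 𝓐 W) z) = z := by
  induction z using dsum_induction with
  | zero => rw [map_zero, map_zero]
  | ι j x =>
    rw [freeSumTo_ι]
    induction x using free_induction with
    | zero => rw [map_zero, map_zero, map_zero]
    | mk x w => rw [freeMap_mk, freeDesc_freeSumUnit]
    | add y z hy hz => rw [map_add, map_add, hy, hz, map_add]
  | add y z hy hz => rw [map_add, map_add, hy, hz]

/-- The functor `A ⊗ -` commutes with direct sums. -/
theorem bijective_freeDesc_freeSumUnit :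
    Function.Bijective (lin (freeDesc (freeSumUnit 𝓐 W))) :=
  Function.bijective_iff_has_inverse.2
    ⟨lin (freeSumTo 𝓐 W), freeSumTo_freeDesc 𝓐 W, freeDesc_freeSumTo 𝓐 W⟩

end Dsum

/-- A morphism is a cellular extension if it has a retraction of graded `A`-modules and its cokernel
is a direct sum of modules `A ⊗ W` with `W` indecomposable. -/
structure IsCellular {X Y : GrBMod 𝓗 𝓐} (f : X ⟶ Y) : Prop where
  exists_retraction : ∃ s : Y.toMod →+ X.toMod, IsALinear (k := k) (H := H) (A := A) s ∧
    (∀ i, ∀ y ∈ Y.deg i, s y ∈ X.deg i) ∧ ∀ x, s (lin f x) = x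
  exists_quotient : ∃ (J : Type u) (W : J → GrMod 𝓗) (q : Y ⟶ freeSum 𝓐 W),
    (∀ j, (W j).IsIndecomposable) ∧ Function.Surjective (lin q) ∧
      ∀ y, lin q y = 0 ↔ ∃ x, lin f x = y

theorem IsCellular.injective {X Y : GrBMod 𝓗 𝓐} {f : X ⟶ Y} (hf : IsCellular f) :
    Function.Injective (lin f) := by
  obtain ⟨s, -, -, hs⟩ := hf.exists_retraction
  exact Function.LeftInverse.injective hs

variable [FiniteDimensional k H] (G : GrBMod 𝓗 𝓐)

/-- The map `A ⊗ U ⟶ G`, where `U` is the sum of the finitely generated graded `H`-submodules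
of `G`. -/
abbrev attach : grFreeObj 𝓗 𝓐 (locObj (grResH.obj G)) ⟶ G := freeDesc (locDesc (grResH.obj G))

/-- The embedding `A ⊗ U ⟶ A ⊗ C` of the attaching spaces in the cells. -/
abbrev cellIncl : grFreeObj 𝓗 𝓐 (locObj (grResH.obj G)) ⟶ grFreeObj 𝓗 𝓐 (envObj (grResH.obj G)) :=
  freeMap (locToEnv (grResH.obj G))

/-- The module obtained from `G` by attaching a cell along each finitely generated graded
`H`-submodule. -/
abbrev stepObj : GrBMod 𝓗 𝓐 := push (attach G) (cellIncl G)

/-- The inclusion of `G` in `stepObj G`. -/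
abbrev stepIn : G ⟶ stepObj G := pushInl (attach G) (cellIncl G)

/-- The map from the cells to `stepObj G`. -/
abbrev stepCell : grFreeObj 𝓗 𝓐 (envObj (grResH.obj G)) ⟶ stepObj G :=
  pushInr (attach G) (cellIncl G)

/-- The retraction of `cellIncl` given by the evaluations at `1`. It is `A`-linear, but not
`H`-linear. -/
def cellRetr : (grFreeObj 𝓗 𝓐 (envObj (grResH.obj G))).toMod →+
    (grFreeObj 𝓗 𝓐 (locObj (grResH.obj G))).toMod :=
  freeMapₖ { envρ (grResH.obj G) with map_smul' := envρ_smul (grResH.obj G) }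

theorem cellRetr_cellIncl (z : (grFreeObj 𝓗 𝓐 (locObj (grResH.obj G))).toMod) :
    cellRetr G (lin (cellIncl G) z) = z := by
  induction z using free_induction with
  | zero => simp only [map_zero]
  | mk x v =>
    rw [freeMap_mk]
    exact (freeMapₖ_mk _ _ _).trans (congrArg _ (envρ_locToEnv _ v))
  | add y z hy hz => simp only [map_add, hy, hz]

theorem isCellular_stepIn : IsCellular (stepIn G) where
  exists_retraction := by
    let t := (lin (attach G)).toAddMonoidHom.comp (cellRetr G)
    have h : ∀ x, AddMonoidHom.id G.toMod (lin (attach G) x) = t (lin (cellIncl G) x) := fun x =>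
      (congrArg (lin (attach G)) (cellRetr_cellIncl G x)).symm
    refine ⟨pushLift (AddMonoidHom.id G.toMod) t h, fun a z => ?_, fun i z hz => ?_,
      pushLift_inl _ t h⟩
    · refine pushLift_smul _ t h (fun _ => rfl) (fun y => ?_) z
      exact (congrArg (lin (attach G)) (freeMapₖ_isALinear _ a y)).trans (map_smul _ _ _)
    · refine pushLift_mem _ t h (fun _ hg => hg) (fun y hy => ?_) hz
      exact lin_mem (attach G) (freeMapₖ_mem _ (fun _ _ hv => envρ_mem _ hv) hy)
  exists_quotient := by
    obtain ⟨J, W, q, hW, hq, hk⟩ := exists_env_decomposition (grResH.obj G)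
    have hf := bijective_freeDesc_freeSumUnit 𝓐 W
    obtain ⟨p, hp, hpk⟩ := exists_push_quotient (u := attach G) (v := cellIncl G)
      (freeMap q ≫ freeDesc (freeSumUnit 𝓐 W)) (hf.2.comp (freeMap_surjective q hq)) fun y => by
        rw [lin_comp, ← freeMap_exact _ q hq hk]
        exact map_eq_zero_iff _ hf.1
    exact ⟨J, W, p, hW, hp, hpk⟩

/-- Linear maps from left ideals of `H` to `G` extend to `H` after attaching cells. -/
theorem exists_extension_step (I : Submodule H H) (g : I →ₗ[H] (grResH.obj G).toMod) :
    ∃ g' : H →ₗ[H] (grResH.obj (stepObj G)).toMod,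
      ∀ x : I, g' x = lin (grResH.map (stepIn G)) (g x) := by
  obtain ⟨g₀, E, h⟩ := exists_extension_env (grResH.obj G) I g
  refine ⟨lin (grResH.map (stepCell G)) ∘ₗ lin (freeUnit (envObj (grResH.obj G))) ∘ₗ E, fun x => ?_⟩
  change lin (stepCell G) (freeMk 𝓐 1 (E x)) = lin (stepIn G) (g x)
  rw [(h x).2, ← (h x).1, ← freeMap_mk, ← push_condition]
  exact congrArg _ (freeDesc_one _ _)

variable {G} {G' : GrBMod 𝓗 𝓐}

theorem attach_naturality (f : G ⟶ G') (x : (grFreeObj 𝓗 𝓐 (locObj (grResH.obj G))).toMod) :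
    lin (attach G') (lin (freeMap (𝓐 := 𝓐) (locMap (grResH.map f))) x) =
      lin f (lin (attach G) x) := by
  rw [freeDesc_freeMap, lin_freeDesc]
  exact congrArg (fun g => lin (freeDesc g) x) ((locι 𝓗).naturality (grResH.map f))

theorem cellIncl_naturality (f : G ⟶ G') (x : (grFreeObj 𝓗 𝓐 (locObj (grResH.obj G))).toMod) :
    lin (cellIncl G') (lin (freeMap (𝓐 := 𝓐) (locMap (grResH.map f))) x) =
      lin (freeMap (𝓐 := 𝓐) (envMap (grResH.map f))) (lin (cellIncl G) x) := by
  induction x using free_induction with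
  | zero => simp only [map_zero]
  | mk x v =>
    simp only [freeMap_mk]
    exact congrArg _ (lin_congr ((envι 𝓗).naturality (grResH.map f)) v)
  | add y z hy hz => simp only [map_add, hy, hz]

/-- The action of `stepObj` on morphisms. -/
def stepMap (f : G ⟶ G') : stepObj G ⟶ stepObj G' :=
  pushDesc (f ≫ stepIn G') (freeMap (envMap (grResH.map f)) ≫ stepCell G') fun x => by
    rw [lin_comp, lin_comp, ← attach_naturality, ← cellIncl_naturality, push_condition]

theorem stepMap_in (f : G ⟶ G') (x : G.toMod) :
    lin (stepMap f) (lin (stepIn G) x) = lin (stepIn G') (lin f x) :=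
  pushDesc_inl _ _ _ x

theorem stepMap_cell (f : G ⟶ G') (y : (grFreeObj 𝓗 𝓐 (envObj (grResH.obj G))).toMod) :
    lin (stepMap f) (lin (stepCell G) y) =
      lin (stepCell G') (lin (freeMap (𝓐 := 𝓐) (envMap (grResH.map f))) y) :=
  pushDesc_inr _ _ _ y

variable (𝓗 𝓐) in
/-- The functor attaching a cell along each finitely generated graded `H`-submodule. -/
def step : GrBMod 𝓗 𝓐 ⥤ GrBMod 𝓗 𝓐 where
  obj := stepObj
  map f := stepMap f
  map_id G := push_hom_ext (fun x => stepMap_in _ x) fun y => by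
    rw [stepMap_cell, lin_id]
    congr 1
    induction y using free_induction with
    | zero => simp only [map_zero]
    | mk x v =>
      rw [freeMap_mk]
      exact congrArg _ (lin_congr ((env 𝓗).map_id (grResH.obj G)) v)
    | add y z hy hz => simp only [map_add, hy, hz]
  map_comp {G G' G''} f g := push_hom_ext
    (fun x => by rw [lin_comp, stepMap_in, stepMap_in, stepMap_in, lin_comp]) fun y => by
      rw [lin_comp, stepMap_cell, stepMap_cell, stepMap_cell]
      congr 1
      induction y using free_induction with
      | zero => simp only [map_zero]
      | mk x v =>
        simp only [freeMap_mk]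
        exact congrArg _ (lin_congr ((env 𝓗).map_comp (grResH.map f) (grResH.map g)) v)
      | add y z hy hz => simp only [map_add, hy, hz]

end Step

/-! ### Colimits of sequences of graded modules -/

namespace GrMod

section Lift

variable {k : Type u} [Field k] {R : Type u} [Ring R] [Algebra k R] {𝓡 : ℤ → Submodule k R}
  {ι : Type u} {X : ι → GrMod 𝓡}

open Classical in
/-- The additive map from a direct sum given by its components. -/
def dsumLift {Z : Type u} [AddCommGroup Z] (c : ∀ j, (X j).toMod →+ Z) :
    (dsum X).toMod →+ Z :=
  (DirectSum.toAddMonoid c : (⨁ j, (X j).toMod) →+ Z)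

theorem dsumLift_ι {Z : Type u} [AddCommGroup Z]
    (c : ∀ j, (X j).toMod →+ Z) (j : ι) (x : (X j).toMod) :
    dsumLift c (lin (dsumι X j) x) = c j x := by
  classical
  exact DirectSum.toAddMonoid_of (β := fun j => (X j).toMod) c j x

end Lift

section Colim

variable {k : Type u} [Field k] {R : Type u} [Ring R] [Algebra k R] {𝓡 : ℤ → Submodule k R}
  {X : ℕ → GrMod 𝓡} (i : ∀ s, X s ⟶ X (s + 1))

variable (X) in
/-- The direct sum of the members of a sequence of graded modules. -/
abbrev seqSum : GrMod 𝓡 := dsum fun s : ULift.{u} ℕ => X s.down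

variable (X) in
/-- The inclusion of a member in the direct sum of a sequence. -/
abbrev seqι (s : ℕ) : X s ⟶ seqSum X := dsumι (fun s : ULift.{u} ℕ => X s.down) ⟨s⟩

/-- The endomorphism `1 - shift` of the direct sum of a sequence. -/
def seqDiff : seqSum X ⟶ seqSum X :=
  dsumDesc fun s : ULift.{u} ℕ => seqι X s.down - i s.down ≫ seqι X (s.down + 1)

theorem seqDiff_ι (s : ℕ) (x : (X s).toMod) :
    lin (seqDiff i) (lin (seqι X s) x) = lin (seqι X s) x - lin (seqι X (s + 1)) (lin (i s) x) :=
  dsumDesc_ι (X := fun s : ULift.{u} ℕ => X s.down)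
    (fun s : ULift.{u} ℕ => seqι X s.down - i s.down ≫ seqι X (s.down + 1)) ⟨s⟩ x

/-- The colimit of a sequence of graded modules, as the cokernel of `1 - shift`. -/
def colim : GrMod 𝓡 := coker (seqDiff i)

/-- The map from a member of a sequence to the colimit. -/
def colimι (s : ℕ) : X s ⟶ colim i := seqι X s ≫ cokerπ (seqDiff i)

theorem colimι_succ (s : ℕ) (x : (X s).toMod) :
    lin (colimι i (s + 1)) (lin (i s) x) = lin (colimι i s) x := by
  have h := cokerπ_map (seqDiff i) (lin (seqι X s) x)
  rw [seqDiff_ι, map_sub, sub_eq_zero] at h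
  exact h.symm

theorem exists_colimι_of_le {s t : ℕ} (h : s ≤ t) (x : (X s).toMod) :
    ∃ y, lin (colimι i t) y = lin (colimι i s) x := by
  induction h with
  | refl => exact ⟨x, rfl⟩
  | step _ ih =>
    obtain ⟨y, hy⟩ := ih
    exact ⟨lin (i _) y, (colimι_succ i _ y).trans hy⟩

theorem exists_colimι (z : (colim i).toMod) : ∃ s x, lin (colimι i s) x = z := by
  obtain ⟨z, rfl⟩ := cokerπ_surjective (seqDiff i) z
  induction z using dsum_induction with
  | zero => exact ⟨0, 0, by rw [map_zero, map_zero]; rfl⟩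
  | ι s x => exact ⟨s.down, x, rfl⟩
  | add y z hy hz =>
    obtain ⟨s, x, hx⟩ := hy
    obtain ⟨t, y, hy⟩ := hz
    obtain ⟨x', hx'⟩ := exists_colimι_of_le i (le_max_left s t) x
    obtain ⟨y', hy'⟩ := exists_colimι_of_le i (le_max_right s t) y
    exact ⟨max s t, x' + y', by rw [map_add, map_add, hx', hy', hx, hy]; rfl⟩

theorem exists_colimι_deg {n : ℤ} {z : (colim i).toMod} (hz : z ∈ (colim i).deg n) :
    ∃ s, ∃ x ∈ (X s).deg n, lin (colimι i s) x = z := by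
  obtain ⟨s, x, rfl⟩ := exists_colimι i z
  exact ⟨s, _, proj_mem n x, by rw [← proj_of_mem hz, lin_proj]⟩

variable {i}

theorem colim_hom_ext {P : GrMod 𝓡} {f g : colim i ⟶ P}
    (h : ∀ s x, lin f (lin (colimι i s) x) = lin g (lin (colimι i s) x)) : f = g :=
  hom_ext fun z => by
    obtain ⟨s, x, rfl⟩ := exists_colimι i z
    exact h s x

/-- The additive map from the direct sum of a sequence given by its components. -/
def seqLift {Z : Type u} [AddCommGroup Z] (c : ∀ s, (X s).toMod →+ Z) : (seqSum X).toMod →+ Z :=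
  dsumLift fun s : ULift.{u} ℕ => c s.down

theorem seqLift_ι {Z : Type u} [AddCommGroup Z] (c : ∀ s, (X s).toMod →+ Z) (s : ℕ)
    (x : (X s).toMod) : seqLift c (lin (seqι X s) x) = c s x :=
  dsumLift_ι (X := fun s : ULift.{u} ℕ => X s.down) (fun s : ULift.{u} ℕ => c s.down) ⟨s⟩ x

/-- The additive map from the colimit given by a compatible family of additive maps. -/
def colimLift {Z : Type u} [AddCommGroup Z] (c : ∀ s, (X s).toMod →+ Z)
    (hc : ∀ s x, c (s + 1) (lin (i s) x) = c s x) : (colim i).toMod →+ Z :=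
  cokerLift (seqDiff i) (seqLift c) fun z => by
    induction z using dsum_induction with
    | zero => rw [map_zero, map_zero]
    | ι s x =>
      refine (congrArg (seqLift c) (seqDiff_ι i s.down x)).trans ?_
      rw [map_sub, seqLift_ι, seqLift_ι, hc, sub_self]
    | add y z hy hz => rw [map_add, map_add, hy, hz, add_zero]

theorem colimLift_ι {Z : Type u} [AddCommGroup Z] (c : ∀ s, (X s).toMod →+ Z)
    (hc : ∀ s x, c (s + 1) (lin (i s) x) = c s x) (s : ℕ) (x : (X s).toMod) :
    colimLift c hc (lin (colimι i s) x) = c s x :=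
  (cokerLift_π (f := seqDiff i) (seqLift c) _ _).trans (seqLift_ι c s x)

theorem colimLift_smul {Z : Type u} [AddCommGroup Z] [Module R Z] (c : ∀ s, (X s).toMod →+ Z)
    (hc : ∀ s x, c (s + 1) (lin (i s) x) = c s x) {r : R} (h : ∀ s x, c s (r • x) = r • c s x)
    (z : (colim i).toMod) : colimLift c hc (r • z) = r • colimLift c hc z := by
  obtain ⟨s, x, rfl⟩ := exists_colimι i z
  rw [← map_smul, colimLift_ι, colimLift_ι, h]

theorem colimLift_mem {P : GrMod 𝓡} (c : ∀ s, (X s).toMod →+ P.toMod)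
    (hc : ∀ s x, c (s + 1) (lin (i s) x) = c s x) {n : ℤ}
    (h : ∀ s, ∀ x ∈ (X s).deg n, c s x ∈ P.deg n) {z : (colim i).toMod} (hz : z ∈ (colim i).deg n) : colimLift c hc z ∈ P.deg n := by
  obtain ⟨s, x, hx, rfl⟩ := exists_colimι_deg i hz
  rw [colimLift_ι]
  exact h s x hx

/-- The universal property of the colimit of a sequence. -/
def colimDesc {P : GrMod 𝓡} (c : ∀ s, X s ⟶ P)
    (hc : ∀ s x, lin (c (s + 1)) (lin (i s) x) = lin (c s) x) : colim i ⟶ P :=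
  ofLin (M := colim i)
    { colimLift (fun s => (lin (c s)).toAddMonoidHom) hc with
      map_smul' := fun _ z => colimLift_smul (fun s => (lin (c s)).toAddMonoidHom) hc
        (fun s => map_smul (lin (c s)) _) z }
    fun _ _ hz => colimLift_mem (fun s => (lin (c s)).toAddMonoidHom) hc
      (fun s _ => lin_mem (c s)) hz

theorem colimDesc_ι {P : GrMod 𝓡} (c : ∀ s, X s ⟶ P)
    (hc : ∀ s x, lin (c (s + 1)) (lin (i s) x) = lin (c s) x) (s : ℕ) (x : (X s).toMod) :
    lin (colimDesc c hc) (lin (colimι i s) x) = lin (c s) x :=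
  colimLift_ι (fun s => (lin (c s)).toAddMonoidHom) hc s x

/-- A finitely generated module maps into the colimit through a member of the sequence, if the maps
from the members to the colimit are injective. -/
theorem exists_factor_colim {S : Type u} [Ring S] [Algebra k S] {𝓢 : ℤ → Submodule k S}
    (φ : S →+* R) (hφ : ∀ i, ∀ s ∈ 𝓢 i, φ s ∈ 𝓡 i) (hi : ∀ s, Function.Injective (lin (colimι i s)))
    {N : Type u} [AddCommGroup N] [Module S N] [Module.Finite S N]
    (g : N →ₗ[S] ((restrict (𝓢 := 𝓢) φ hφ).obj (colim i)).toMod) :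
    ∃ (s : ℕ) (g' : N →ₗ[S] ((restrict (𝓢 := 𝓢) φ hφ).obj (X s)).toMod),
      ∀ x, lin (colimι i s) (g' x) = g x := by
  obtain ⟨T, hT⟩ := Module.Finite.fg_top (R := S) (M := N)
  choose σ y hy using fun x => exists_colimι i (g x)
  let j := lin ((restrict (𝓢 := 𝓢) φ hφ).map (colimι i (T.sup σ)))
  have hj : Function.Injective j := hi _
  have hg : ∀ x, g x ∈ LinearMap.range j := by
    intro x
    have : (⊤ : Submodule S N) ≤ (LinearMap.range j).comap g := by
      rw [← hT, Submodule.span_le]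
      intro x hx
      obtain ⟨z, hz⟩ := exists_colimι_of_le i (Finset.le_sup (f := σ) hx) (y x)
      exact ⟨z, hz.trans (hy x)⟩
    exact this (Submodule.mem_top (x := x))
  refine ⟨T.sup σ, (LinearEquiv.ofInjective j hj).symm.toLinearMap ∘ₗ g.codRestrict _ hg,
    fun x => ?_⟩
  have := LinearEquiv.apply_symm_apply (LinearEquiv.ofInjective j hj) (g.codRestrict _ hg x)
  exact congrArg Subtype.val this

end Colim

end GrMod

/-! ### Colimits of cellular sequences -/

section Cellular

variable {k : Type u} [Field k] {H : Type u} [Ring H] [HopfAlgebra k H]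
  {A : Type u} [Ring A] [Algebra k A] [Module H A] [IsScalarTower k H A] [ModuleAlgebra k H A]
  {𝓗 : ℤ → Submodule k H} [GradedAlgebra 𝓗] [IsGradedHopf 𝓗]
  {𝓐 : ℤ → Submodule k A} [GradedAlgebra 𝓐] [IsGradedAction 𝓗 𝓐]

open GrMod SmashProduct

/-- An additive map is a homomorphism of graded `A`-modules. -/
structure IsGrALinear {X Y : GrBMod 𝓗 𝓐} (s : X.toMod →+ Y.toMod) : Prop where
  smul : IsALinear (k := k) (H := H) (A := A) s
  mem : ∀ i, ∀ x ∈ X.deg i, s x ∈ Y.deg i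

theorem isGrALinear_id (X : GrBMod 𝓗 𝓐) : IsGrALinear (AddMonoidHom.id X.toMod) :=
  ⟨fun _ _ => rfl, fun _ _ h => h⟩

theorem IsGrALinear.comp {X Y Z : GrBMod 𝓗 𝓐} {t : Y.toMod →+ Z.toMod} {s : X.toMod →+ Y.toMod}
    (ht : IsGrALinear t) (hs : IsGrALinear s) : IsGrALinear (t.comp s) :=
  ⟨fun a x => (congrArg t (hs.smul a x)).trans (ht.smul a _),
    fun i x hx => ht.mem i _ (hs.mem i x hx)⟩

theorem isGrALinear_lin {X Y : GrBMod 𝓗 𝓐} (f : X ⟶ Y) : IsGrALinear (lin f).toAddMonoidHom :=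
  ⟨fun _ _ => map_smul (lin f) _ _, fun _ _ => lin_mem f⟩

theorem IsCellular.exists_isGrALinear {X Y : GrBMod 𝓗 𝓐} {f : X ⟶ Y} (hf : IsCellular f) :
    ∃ s : Y.toMod →+ X.toMod, IsGrALinear s ∧ ∀ x, s (lin f x) = x := by
  obtain ⟨s, h₁, h₂, h₃⟩ := hf.exists_retraction
  exact ⟨s, ⟨h₁, h₂⟩, h₃⟩

/-- The members of a sequence of cellular extensions map compatibly to any fixed member: those
before it by the maps of the sequence, and those after it by retractions. -/
theorem exists_compatible_retractions (r : ℕ) : ∀ {X : ℕ → GrBMod 𝓗 𝓐} {i : ∀ s, X s ⟶ X (s + 1)},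
    (∀ s, IsCellular (i s)) → ∃ c : ∀ s, (X s).toMod →+ (X r).toMod, (∀ s, IsGrALinear (c s)) ∧
      (∀ s x, c (s + 1) (lin (i s) x) = c s x) ∧ ∀ x, c r x = x := by
  induction r with
  | zero =>
    intro X i hi
    choose ρ h₁ h₂ using fun s => (hi s).exists_isGrALinear
    let c : ∀ s, (X s).toMod →+ (X 0).toMod := fun s =>
      Nat.rec (motive := fun s => (X s).toMod →+ (X 0).toMod) (AddMonoidHom.id _)
        (fun s c => c.comp (ρ s)) s
    refine ⟨c, fun s => ?_, fun s x => congrArg (c s) (h₂ s x), fun _ => rfl⟩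
    induction s with
    | zero => exact isGrALinear_id _
    | succ s ih => exact ih.comp (h₁ s)
  | succ r ih =>
    intro X i hi
    obtain ⟨c, h₁, h₂, h₃⟩ := ih (X := fun s => X (s + 1)) (i := fun s => i (s + 1))
      fun s => hi (s + 1)
    let c' : ∀ s, (X s).toMod →+ (X (r + 1)).toMod := fun s =>
      Nat.casesOn (motive := fun s => (X s).toMod →+ (X (r + 1)).toMod) s
        ((c 0).comp (lin (i 0)).toAddMonoidHom) c
    refine ⟨c', fun s => ?_, fun s x => ?_, h₃⟩
    · cases s with
      | zero => exact (h₁ 0).comp (isGrALinear_lin _)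
      | succ s => exact h₁ s
    · cases s with
      | zero => rfl
      | succ s => exact h₂ s x

/-- The quotient of a cellular extension by the smaller module, in any presentation `ψ`, is a direct
sum of modules `A ⊗ V`. -/
theorem IsCellular.isGrSumOfFree {X Y : GrBMod 𝓗 𝓐} {f : X ⟶ Y} (hf : IsCellular f)
    {Q : Type u} [AddCommGroup Q] [Module (SmashProduct k H A) Q]
    (ψ : Y.toMod →ₗ[SmashProduct k H A] Q) (hψ : Function.Surjective ψ)
    (hk : ∀ y, ψ y = 0 ↔ ∃ x, lin f x = y) {D : ℤ → Set Q}
    (hD : ∀ n, ∀ z ∈ D n, ∃ y ∈ Y.deg n, ψ y = z) : IsGrSumOfFree 𝓗 𝓐 Q D := by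
  obtain ⟨J, W, q, hW, hq, hqk⟩ := hf.exists_quotient
  have hker : LinearMap.ker ψ = LinearMap.ker (lin q) := by
    ext y
    rw [LinearMap.mem_ker, LinearMap.mem_ker, hk, hqk]
  let e : Q ≃ₗ[SmashProduct k H A] (freeSum 𝓐 W).toMod :=
    (ψ.quotKerEquivOfSurjective hψ).symm ≪≫ₗ Submodule.quotEquivOfEq _ _ hker ≪≫ₗ
      (lin q).quotKerEquivOfSurjective hq
  have he : ∀ y, e (ψ y) = lin q y := fun y => by
    have : (ψ.quotKerEquivOfSurjective hψ).symm (ψ y) = (LinearMap.ker ψ).mkQ y :=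
      (LinearEquiv.symm_apply_eq _).2 rfl
    change (lin q).quotKerEquivOfSurjective hq (Submodule.quotEquivOfEq _ _ hker
      ((ψ.quotKerEquivOfSurjective hψ).symm (ψ y))) = _
    rw [this]
    rfl
  refine ⟨J, W, hW, e, fun n z hz j => ?_⟩
  obtain ⟨y, hy, rfl⟩ := hD n z hz
  have := mem_dsum_deg.1 (lin_mem q hy) j
  rwa [← he] at this

variable {X : ℕ → GrBMod 𝓗 𝓐} {i : ∀ s, X s ⟶ X (s + 1)}

theorem exists_colim_retraction (hi : ∀ s, IsCellular (i s)) (r : ℕ) :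
    ∃ σ : (colim i).toMod →+ (X r).toMod, IsGrALinear σ ∧ ∀ x, σ (lin (colimι i r) x) = x := by
  obtain ⟨c, h₁, h₂, h₃⟩ := exists_compatible_retractions r hi
  refine ⟨colimLift c h₂, ⟨fun a z => ?_, fun n z hz => ?_⟩, fun x => ?_⟩
  · exact colimLift_smul c h₂ (fun s x => (h₁ s).smul a x) z
  · exact colimLift_mem c h₂ (fun s x hx => (h₁ s).mem n x hx) hz
  · rw [colimLift_ι, h₃]

theorem colimι_injective (hi : ∀ s, IsCellular (i s)) (r : ℕ) :
    Function.Injective (lin (colimι i r)) := by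
  obtain ⟨σ, -, hσ⟩ := exists_colim_retraction hi r
  exact Function.LeftInverse.injective hσ

variable (i) in
/-- The quotient of the colimit of a sequence by its first member. -/
abbrev colimQuot : GrBMod 𝓗 𝓐 := coker (colimι i 0)

theorem isGrASplitShortExact_colim (hi : ∀ s, IsCellular (i s)) :
    IsGrASplitShortExact (colimι i 0) (cokerπ (colimι i 0)) := by
  obtain ⟨σ, h₁, h₂⟩ := exists_colim_retraction hi 0
  exact ⟨colimι_injective hi 0, fun _ => cokerπ_eq_zero_iff _, cokerπ_surjective _,
    σ, h₁.smul, h₁.mem, h₂⟩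

variable (i) in
/-- The map from the member number `s + 1` of a sequence to the quotient of the colimit. -/
def quotι (s : ℕ) : X (s + 1) ⟶ colimQuot i := colimι i (s + 1) ≫ cokerπ (colimι i 0)

theorem quotι_succ (s : ℕ) (x : (X (s + 1)).toMod) :
    lin (quotι i (s + 1)) (lin (i (s + 1)) x) = lin (quotι i s) x :=
  congrArg (lin (cokerπ (colimι i 0))) (colimι_succ i (s + 1) x)

theorem quotι_deg {s : ℕ} {x : (X (s + 1)).toMod} {n : ℤ}
    (hx : lin (quotι i s) x ∈ (colimQuot i).deg n) :
    ∃ y ∈ (X (s + 1)).deg n, lin (quotι i s) y = lin (quotι i s) x :=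
  ⟨_, proj_mem n x, by rw [lin_proj, proj_of_mem hx]⟩

theorem exists_colimι_zero (s : ℕ) (x : (X 0).toMod) :
    ∃ y, lin (colimι i s) y = lin (colimι i 0) x :=
  exists_colimι_of_le i (Nat.zero_le s) x

theorem quotι_eq_zero_iff (hi : ∀ s, IsCellular (i s)) (x : (X 1).toMod) :
    lin (quotι i 0) x = 0 ↔ ∃ y, lin (i 0) y = x := by
  refine (cokerπ_eq_zero_iff _).trans (exists_congr fun y => ?_)
  rw [← colimι_succ]
  exact (colimι_injective hi 1).eq_iff

theorem quotι_mem_range_iff (hi : ∀ s, IsCellular (i s)) (s : ℕ) (x : (X (s + 2)).toMod) :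
    lin (quotι i (s + 1)) x ∈ LinearMap.range (lin (quotι i s)) ↔ ∃ y, lin (i (s + 1)) y = x := by
  constructor
  · rintro ⟨y, hy⟩
    rw [← quotι_succ, ← sub_eq_zero, ← map_sub] at hy
    obtain ⟨z, hz⟩ := (cokerπ_eq_zero_iff _).1 hy
    obtain ⟨w, hw⟩ := exists_colimι_zero (i := i) (s + 1) z
    have : lin (i (s + 1)) w = lin (i (s + 1)) y - x := by
      refine colimι_injective hi (s + 2) ?_
      rw [colimι_succ, hw]
      exact hz
    refine ⟨y - w, ?_⟩
    rw [map_sub, this, sub_sub_cancel]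
  · rintro ⟨y, rfl⟩
    exact ⟨y, (quotι_succ s y).symm⟩

/-- The retractions of the colimit to the members of the sequence descend to the quotient by the
first member. -/
theorem exists_quot_retraction (hi : ∀ s, IsCellular (i s)) (s : ℕ) :
    ∃ e : (colimQuot i).toMod →+ (colimQuot i).toMod, IsGrALinear e ∧
      (∀ z, e z ∈ LinearMap.range (lin (quotι i s))) ∧
      ∀ x, e (lin (quotι i s) x) = lin (quotι i s) x := by
  obtain ⟨σ, hσ, hσι⟩ := exists_colim_retraction hi (s + 1)
  let E : (colim i).toMod →+ (colimQuot i).toMod := (lin (quotι i s)).toAddMonoidHom.comp σ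
  have hE : IsGrALinear E := (isGrALinear_lin (quotι i s)).comp hσ
  have h0 : ∀ x, E (lin (colimι i 0) x) = 0 := fun x => by
    obtain ⟨y, hy⟩ := exists_colimι_zero (i := i) (s + 1) x
    rw [← hy]
    refine (congrArg (lin (quotι i s)) (hσι y)).trans ?_
    exact (cokerπ_eq_zero_iff _).2 ⟨x, hy.symm⟩
  refine ⟨cokerLift (colimι i 0) E h0, ⟨fun a z => ?_, ?_⟩, fun z => ?_, fun x => ?_⟩
  · obtain ⟨z, rfl⟩ := cokerπ_surjective (colimι i 0) z
    rw [← map_smul, cokerLift_π, cokerLift_π]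
    exact hE.smul a z
  · rintro n _ ⟨z, hz, rfl⟩
    exact hE.mem n z hz
  · obtain ⟨z, rfl⟩ := cokerπ_surjective (colimι i 0) z
    rw [cokerLift_π]
    exact ⟨σ z, rfl⟩
  · exact congrArg (lin (quotι i s)) (hσι x)

theorem hasGrPFiltration_colimQuot (hi : ∀ s, IsCellular (i s)) :
    HasGrPFiltration (colimQuot i) := by
  have hF : ∀ r, LinearMap.range (lin (quotι i r)) ≤ LinearMap.range (lin (quotι i (r + 1))) := by
    rintro r _ ⟨x, rfl⟩
    exact ⟨_, quotι_succ r x⟩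
  refine ⟨fun r => LinearMap.range (lin (quotι i r)), hF, fun r => isHomogeneous_range _,
    fun z => ?_, fun r => ?_, ?_, fun r => ?_⟩
  · obtain ⟨z, rfl⟩ := cokerπ_surjective (colimι i 0) z
    obtain ⟨s, x, rfl⟩ := exists_colimι i z
    exact ⟨s, lin (i s) x, congrArg (lin (cokerπ (colimι i 0))) (colimι_succ i s x)⟩
  · obtain ⟨e, h₁, h₂, h₃⟩ := exists_quot_retraction hi r
    refine ⟨(e.codRestrict (LinearMap.range (lin (quotι i r))) h₂).comp
      (LinearMap.range (lin (quotι i (r + 1)))).subtype.toAddMonoidHom, fun a x => ?_,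
      fun n x hx => h₁.mem n _ hx, ?_⟩
    · exact Subtype.ext (h₁.smul a x)
    · rintro ⟨_, x, rfl⟩
      exact Subtype.ext (h₃ x)
  -- The bottom of the filtration is `X 1 / X 0`, and the quotients are `X (r + 2) / X (r + 1)`.
  · refine (hi 0).isGrSumOfFree (lin (quotι i 0)).rangeRestrict
      (LinearMap.surjective_rangeRestrict _) (fun x => ?_) ?_
    · rw [← quotι_eq_zero_iff hi]
      exact Subtype.ext_iff
    · rintro n ⟨_, x, rfl⟩ hx
      obtain ⟨y, hy, e⟩ := quotι_deg hx
      exact ⟨y, hy, Subtype.ext e⟩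
  · refine (hi (r + 1)).isGrSumOfFree
      (((LinearMap.range (lin (quotι i r))).submoduleOf
        (LinearMap.range (lin (quotι i (r + 1))))).mkQ ∘ₗ (lin (quotι i (r + 1))).rangeRestrict)
      ((Submodule.mkQ_surjective _).comp (LinearMap.surjective_rangeRestrict _))
      (fun x => ?_) ?_
    · rw [← quotι_mem_range_iff hi]
      exact Submodule.Quotient.mk_eq_zero _
    · rintro n _ ⟨⟨_, x, rfl⟩, hx, rfl⟩
      obtain ⟨y, hy, e⟩ := quotι_deg hx
      exact ⟨y, hy, congrArg (Submodule.Quotient.mk) (Subtype.ext e)⟩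

end Cellular

/-! ### The acyclic envelope -/

section Graded

variable {k : Type u} [Field k] {H : Type u} [Ring H] [HopfAlgebra k H]
  {A : Type u} [Ring A] [Algebra k A] [Module H A] [IsScalarTower k H A] [ModuleAlgebra k H A]
  {𝓗 : ℤ → Submodule k H} [GradedAlgebra 𝓗] [IsGradedHopf 𝓗]
  {𝓐 : ℤ → Submodule k A} [GradedAlgebra 𝓐] [IsGradedAction 𝓗 𝓐] [FiniteDimensional k H]

open GrMod SmashProduct

variable (𝓗 𝓐) in
/-- The iterates of the functor attaching cells. -/
def iter : ℕ → (GrBMod 𝓗 𝓐 ⥤ GrBMod 𝓗 𝓐)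
  | 0 => 𝟭 _
  | r + 1 => iter r ⋙ step 𝓗 𝓐

/-- The inclusion of an iterate in the next one. -/
abbrev iterIn (M : GrBMod 𝓗 𝓐) (r : ℕ) : (iter 𝓗 𝓐 r).obj M ⟶ (iter 𝓗 𝓐 (r + 1)).obj M :=
  stepIn ((iter 𝓗 𝓐 r).obj M)

theorem iterIn_naturality {M N : GrBMod 𝓗 𝓐} (f : M ⟶ N) (r : ℕ)
    (x : ((iter 𝓗 𝓐 r).obj M).toMod) :
    lin ((iter 𝓗 𝓐 (r + 1)).map f) (lin (iterIn M r) x) =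
      lin (iterIn N r) (lin ((iter 𝓗 𝓐 r).map f) x) :=
  stepMap_in _ x

theorem isCellular_iterIn (M : GrBMod 𝓗 𝓐) (r : ℕ) : IsCellular (iterIn M r) :=
  isCellular_stepIn _

/-- The colimit of the iterates. -/
abbrev acObj (M : GrBMod 𝓗 𝓐) : GrBMod 𝓗 𝓐 := colim (iterIn M)

/-- The map from an iterate to the colimit. -/
abbrev acIn (M : GrBMod 𝓗 𝓐) (r : ℕ) : (iter 𝓗 𝓐 r).obj M ⟶ acObj M := colimι (iterIn M) r

/-- The action of `acObj` on morphisms. -/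
def acMap {M N : GrBMod 𝓗 𝓐} (f : M ⟶ N) : acObj M ⟶ acObj N :=
  colimDesc (fun r => (iter 𝓗 𝓐 r).map f ≫ acIn N r) fun r x => by
    rw [lin_comp, iterIn_naturality, colimι_succ]
    rfl

theorem acMap_in {M N : GrBMod 𝓗 𝓐} (f : M ⟶ N) (r : ℕ) (x : ((iter 𝓗 𝓐 r).obj M).toMod) :
    lin (acMap f) (lin (acIn M r) x) = lin (acIn N r) (lin ((iter 𝓗 𝓐 r).map f) x) :=
  colimDesc_ι (X := fun r => (iter 𝓗 𝓐 r).obj M) (i := iterIn M)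
    (fun r => (iter 𝓗 𝓐 r).map f ≫ acIn N r) _ r x

variable (𝓗 𝓐) in
/-- The functor sending a graded `A # H`-module to the colimit of the iterates of `step`. -/
def ac : GrBMod 𝓗 𝓐 ⥤ GrBMod 𝓗 𝓐 where
  obj := acObj
  map f := acMap f
  map_id M := colim_hom_ext fun r x => by
    rw [acMap_in, (iter 𝓗 𝓐 r).map_id]
    rfl
  map_comp f g := colim_hom_ext fun r x => by
    rw [lin_comp, acMap_in, acMap_in, acMap_in, (iter 𝓗 𝓐 r).map_comp]
    rfl

variable (𝓗 𝓐) in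
/-- The inclusion of a module in the colimit of the iterates. -/
def acι : 𝟭 (GrBMod 𝓗 𝓐) ⟶ ac 𝓗 𝓐 where
  app M := acIn M 0
  naturality _ _ f := hom_ext fun x => (acMap_in f 0 x).symm

/-- The quotient of the colimit of the iterates by the module. -/
abbrev cellObj (M : GrBMod 𝓗 𝓐) : GrBMod 𝓗 𝓐 := colimQuot (iterIn M)

/-- The action of `cellObj` on morphisms. -/
def cellMap {M N : GrBMod 𝓗 𝓐} (f : M ⟶ N) : cellObj M ⟶ cellObj N :=
  cokerDesc (acMap f ≫ cokerπ (acIn N 0)) fun y => by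
    rw [lin_comp, acMap_in, cokerπ_map]

variable (𝓗 𝓐) in
/-- The functor sending a graded `A # H`-module to the quotient of the colimit of the iterates
by it. -/
def cell : GrBMod 𝓗 𝓐 ⥤ GrBMod 𝓗 𝓐 where
  obj := cellObj
  map f := cellMap f
  map_id M := hom_ext fun x => by
    obtain ⟨x, rfl⟩ := cokerπ_surjective (acIn M 0) x
    exact congrArg (lin (cokerπ (acIn M 0))) (lin_congr ((ac 𝓗 𝓐).map_id M) x)
  map_comp {M N P} f g := hom_ext fun x => by
    obtain ⟨x, rfl⟩ := cokerπ_surjective (acIn M 0) x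
    exact congrArg (lin (cokerπ (acIn P 0))) (lin_congr ((ac 𝓗 𝓐).map_comp f g) x)

variable (𝓗 𝓐) in
/-- The projection from the colimit of the iterates to its quotient. -/
def cellπ : ac 𝓗 𝓐 ⟶ cell 𝓗 𝓐 where
  app M := cokerπ (acIn M 0)
  naturality _ _ _ := rfl

/-- Linear maps from left ideals of `H` to the colimit of the iterates have image in some iterate,
and extend to `H` in the next one. -/
theorem injective_acObj (M : GrBMod 𝓗 𝓐) : Module.Injective H (grResH.obj (acObj M)).toMod := by
  have : IsNoetherianRing H := isNoetherian_of_tower k inferInstance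
  refine Module.Baer.injective fun I g => ?_
  obtain ⟨r, g₀, hg₀⟩ := exists_factor_colim (inclH k H A).toRingHom (inclH_mem 𝓗 𝓐)
    (colimι_injective (isCellular_iterIn M)) g
  obtain ⟨g', hg'⟩ := exists_extension_step _ I g₀
  refine ⟨lin (grResH.map (acIn M (r + 1))) ∘ₗ g', fun x hx => ?_⟩
  change lin (acIn M (r + 1)) (g' x) = _
  rw [hg' ⟨x, hx⟩, ← hg₀]
  exact colimι_succ (iterIn M) r _

/-- A module is acyclic if its restriction to `H` is injective, since injective modules over a
finite dimensional Hopf algebra are projective. -/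
theorem isGrAcyclic_of_injective (M : GrBMod 𝓗 𝓐)
    [Module.Injective H (grResH.obj M).toMod] : IsGrAcyclic M := by
  have : Module.Projective H (grResH.obj M).toMod :=
    projective_of_injective (k := k) (grResH.obj M).toMod
  have hP : Projective (grResH.obj M) := projective_of_module mem_closure_homogeneous _
  let F := CategoryTheory.Quotient.functor (stableRel (GrMod 𝓗))
  refine ⟨F.map (0 : grResH.obj M ⟶ grResH.obj (zero (smashDeg 𝓗 𝓐))), ?_, ?_⟩
  · have h : grResH.map (0 : zero (smashDeg 𝓗 𝓐) ⟶ M) ≫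
        (0 : grResH.obj M ⟶ grResH.obj (zero (smashDeg 𝓗 𝓐))) = 𝟙 _ :=
      hom_ext fun x => Subsingleton.elim (α := PUnit) _ _
    refine (F.map_comp _ _).symm.trans ?_
    rw [h, F.map_id]
  · have h : (0 : grResH.obj M ⟶ grResH.obj (zero (smashDeg 𝓗 𝓐))) ≫
        grResH.map (0 : zero (smashDeg 𝓗 𝓐) ⟶ M) = 0 := hom_ext fun x => rfl
    refine (F.map_comp _ _).symm.trans ?_
    rw [h]
    refine Eq.trans (CategoryTheory.Quotient.sound (stableRel (GrMod 𝓗))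
      (f₁ := (0 : grResH.obj M ⟶ grResH.obj M)) (f₂ := 𝟙 _)
      ⟨grResH.obj M, hP, -𝟙 _, 𝟙 _, by simp⟩) (F.map_id _)

variable (𝓗 𝓐) in
/-- Every graded module embeds functorially in one that is injective over `H`, with a quotient
filtered by modules `A ⊗ V`. -/
theorem exists_injective_envelope : ∃ (a p : GrBMod 𝓗 𝓐 ⥤ GrBMod 𝓗 𝓐) (ι : 𝟭 (GrBMod 𝓗 𝓐) ⟶ a)
    (π : a ⟶ p), ∀ M : GrBMod 𝓗 𝓐, IsGrASplitShortExact (ι.app M) (π.app M) ∧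
      Module.Injective H (grResH.obj (a.obj M)).toMod ∧ HasGrPFiltration (p.obj M) :=
  ⟨ac 𝓗 𝓐, cell 𝓗 𝓐, acι 𝓗 𝓐, cellπ 𝓗 𝓐, fun M =>
    ⟨isGrASplitShortExact_colim (isCellular_iterIn M), injective_acObj M,
      hasGrPFiltration_colimQuot (isCellular_iterIn M)⟩⟩

end Graded

/-! ### Modules without grading -/

section TrivialGrading

variable (k : Type u) [Field k] (R : Type u) [Ring R] [Algebra k R]

/-- The grading of an algebra concentrated in degree `0`. -/
def trivDeg (i : ℤ) : Submodule k R := if i = 0 then ⊤ else ⊥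

theorem mem_trivDeg_zero (r : R) : r ∈ trivDeg k R 0 := by
  rw [trivDeg, if_pos rfl]
  trivial

variable {k R} in
theorem eq_zero_of_mem_trivDeg {i : ℤ} (hi : i ≠ 0) {r : R} (hr : r ∈ trivDeg k R i) : r = 0 := by
  rwa [trivDeg, if_neg hi] at hr

variable {k R} in
/-- What holds for all elements of degree `0` and for zero holds for all homogeneous elements. -/
theorem mem_trivDeg_cases {i : ℤ} {p : ℤ → R → Prop} {r : R} (hr : r ∈ trivDeg k R i)
    (h0 : ∀ r, p 0 r) (hz : ∀ i, p i 0) : p i r := by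
  by_cases hi : i = 0
  · subst hi
    exact h0 r
  · rw [eq_zero_of_mem_trivDeg hi hr]
    exact hz i

instance : GradedAlgebra (trivDeg k R) where
  one_mem := mem_trivDeg_zero k R 1
  mul_mem i j r s hr hs := by
    by_cases hi : i = 0
    · subst hi
      by_cases hj : j = 0
      · subst hj
        exact mem_trivDeg_zero k R _
      · rw [eq_zero_of_mem_trivDeg hj hs, mul_zero]
        exact zero_mem _
    · rw [eq_zero_of_mem_trivDeg hi hr, zero_mul]
      exact zero_mem _
  decompose' r := DirectSum.of (fun i => trivDeg k R i) 0 ⟨r, mem_trivDeg_zero k R r⟩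
  left_inv r := DirectSum.coeAddMonoidHom_of _ _ _
  right_inv x := by
    induction x using DirectSum.induction_on with
    | zero =>
      rw [map_zero]
      exact map_zero (DirectSum.of (fun i => trivDeg k R i) 0)
    | of i x =>
      rw [DirectSum.coeAddMonoidHom_of]
      obtain ⟨x, hx⟩ := x
      by_cases hi : i = 0
      · subst hi
        rfl
      · obtain rfl := eq_zero_of_mem_trivDeg hi hx
        exact (map_zero (DirectSum.of (fun i => trivDeg k R i) 0)).trans
          (map_zero (DirectSum.of (fun i => trivDeg k R i) i)).symm
    | add x y hx hy =>
      rw [map_add]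
      refine Eq.trans ?_ (congrArg₂ _ hx hy)
      exact map_add (DirectSum.of (fun i => trivDeg k R i) 0) ⟨_, mem_trivDeg_zero k R _⟩
        ⟨_, mem_trivDeg_zero k R _⟩

end TrivialGrading

section Ungraded

variable {k : Type u} [Field k] {H : Type u} [Ring H] [HopfAlgebra k H]

instance : IsGradedHopf (trivDeg k H) where
  comul_mem n h hh := by
    refine mem_trivDeg_cases (p := fun n h => Coalgebra.comul (R := k) h ∈
      tensorDeg k (fun i => (trivDeg k H i : Set H)) (fun i => (trivDeg k H i : Set H)) n) hh
      (fun h => ?_) fun n => ?_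
    · rw [← (Coalgebra.Repr.arbitrary k h).eq]
      exact sum_mem fun i _ => Submodule.subset_span
        ⟨0, 0, add_zero 0, _, mem_trivDeg_zero k H _, _, mem_trivDeg_zero k H _, rfl⟩
    · rw [map_zero]
      exact zero_mem _
  counit_eq_zero n hn h hh := by rw [eq_zero_of_mem_trivDeg hn hh, map_zero]
  antipode_mem n h hh := by
    refine mem_trivDeg_cases (p := fun n h => HopfAlgebra.antipode k h ∈ trivDeg k H n) hh
      (fun h => mem_trivDeg_zero k H _) fun n => ?_
    rw [map_zero]
    exact zero_mem _

open GrMod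

/-- If `H` is concentrated in degree `0`, an indecomposable graded `H`-module is concentrated in one
degree, and hence is indecomposable without its grading. -/
theorem isIndecomposable_toMod (V : GrMod (trivDeg k H)) (hV : V.IsIndecomposable) :
    IsIndecomposable V.toMod := by
  have hproj : ∀ (n : ℤ) (h : H) (x : V.toMod), V.proj n (h • x) = h • V.proj n x := fun n h x => by
    have := smul_proj (mem_trivDeg_zero k H h) n x
    rwa [zero_add] at this
  obtain ⟨hne, hind⟩ := hV
  obtain ⟨n, x, hx, hx0⟩ : ∃ n, ∃ x ∈ V.deg n, x ≠ 0 := by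
    by_contra! hcon
    obtain ⟨x, hx⟩ := exists_ne (0 : V.toMod)
    exact hx (eq_zero_of_proj fun n => hcon n _ (proj_mem n x))
  let φ : V.toMod →ₗ[H] V.toMod := { V.proj n with map_smul' := hproj n }
  have hφ : IsIdempotentElem φ := LinearMap.ext fun x => proj_of_mem (proj_mem n x)
  have hc : IsCompl (LinearMap.range φ) (LinearMap.ker φ) :=
    LinearMap.IsIdempotentElem.isCompl hφ
  have hker : LinearMap.ker φ = ⊥ := by
    refine (hind _ _ (isHomogeneous_iff.2 ?_) (isHomogeneous_iff.2 ?_) hc).resolve_left fun h => ?_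
    · rintro m _ ⟨y, rfl⟩
      by_cases hm : n = m
      · subst hm
        exact ⟨φ y, rfl⟩
      · exact ⟨0, (map_zero φ).trans (proj_of_ne hm (proj_mem n y)).symm⟩
    · intro m y hy
      by_cases hm : m = n
      · subst hm
        exact (congrArg φ hy).trans (map_zero φ)
      · exact proj_of_ne hm (proj_mem m y)
    · exact hx0 ((Submodule.mem_bot H).1 (h ▸ ⟨x, proj_of_mem hx⟩))
  have hall : ∀ x, V.proj n x = x := fun x => by
    have : V.proj n x - x ∈ LinearMap.ker φ := by
      rw [LinearMap.mem_ker, map_sub, sub_eq_zero]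
      exact proj_of_mem (proj_mem n x)
    rw [hker, Submodule.mem_bot, sub_eq_zero] at this
    exact this
  have hhom : ∀ p : Submodule H V.toMod, V.IsHomogeneous p := fun p x hx =>
    AddSubgroup.subset_closure ⟨hx, n, mem_deg_of_proj (hall x)⟩
  exact ⟨hne, fun p q => hind p q (hhom p) (hhom q)⟩

variable {A : Type u} [Ring A] [Algebra k A] [Module H A] [IsScalarTower k H A]
  [ModuleAlgebra k H A]

instance : IsGradedAction (trivDeg k H) (trivDeg k A) where
  smul_mem i j h hh a ha := by
    refine mem_trivDeg_cases (p := fun i h => h • a ∈ trivDeg k A (i + j)) hh (fun h => ?_)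
      fun i => ?_
    · refine mem_trivDeg_cases (p := fun j a => h • a ∈ trivDeg k A (0 + j)) ha
        (fun a => mem_trivDeg_zero k A _) fun j => ?_
      rw [smul_zero]
      exact zero_mem _
    · rw [zero_smul]
      exact zero_mem _

theorem IsGrSumOfFree.isSumOfFree {X : Type u} [AddCommGroup X] [Module (SmashProduct k H A) X]
    {D : ℤ → Set X}
    (h : IsGrSumOfFree (trivDeg k H) (trivDeg k A) X D) : IsSumOfFree k H A X := by
  obtain ⟨J, V, hV, e, -⟩ := h
  exact ⟨J, fun j => (V j).toMod, fun j => isIndecomposable_toMod _ (hV j), ⟨e⟩⟩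

theorem HasGrPFiltration.hasPFiltration {P : GrBMod (trivDeg k H) (trivDeg k A)}
    (h : HasGrPFiltration P) : HasPFiltration P.toMod := by
  obtain ⟨F, hF, -, h₁, h₂, h₃, h₄⟩ := h
  refine ⟨F, hF, h₁, fun r => ?_, h₃.isSumOfFree, fun r => (h₄ r).isSumOfFree⟩
  obtain ⟨s, hs, -, hs'⟩ := h₂ r
  exact ⟨s, hs, hs'⟩

theorem mem_smashDeg_triv_cases {i : ℤ} {b : SmashProduct k H A}
    (hb : b ∈ smashDeg (trivDeg k H) (trivDeg k A) i) : i = 0 ∨ b = 0 := by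
  by_cases hi : i = 0
  · exact Or.inl hi
  refine Or.inr ?_
  refine smashDeg_induction (trivDeg k H) (trivDeg k A)
    (p := fun b : SmashProduct k H A => b = 0) rfl ?_ ?_ ?_ hb
  · rintro j l rfl a ha h hh
    by_cases hj : j = 0
    · have hl : l ≠ 0 := fun hl => hi (by rw [hj, hl, add_zero])
      rw [eq_zero_of_mem_trivDeg hl hh]
      exact TensorProduct.tmul_zero _ _
    · rw [eq_zero_of_mem_trivDeg hj ha]
      exact TensorProduct.zero_tmul _ _
  · rintro _ _ rfl rfl
    exact add_zero 0
  · rintro c _ rfl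
    exact smul_zero c

/-- A module as a graded module concentrated in degree `0`. -/
def trivObj (M : BMod k H A) : GrBMod (trivDeg k H) (trivDeg k A) where
  toMod := M
  deg i := if i = 0 then ⊤ else ⊥
  internal := by
    refine isInternal_of_proj _ (fun i => if i = 0 then AddMonoidHom.id M else 0) ?_ ?_ ?_
    · intro i x hx
      by_cases hi : i = 0
      · simp [hi]
      · simp only [if_neg hi] at hx ⊢
        exact ((AddSubgroup.mem_bot).1 hx).symm
    · intro i j hij x hx
      by_cases hi : i = 0
      · rw [if_neg (fun hj => hij (hi.trans hj.symm))]
        rfl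
      · simp only [if_neg hi] at hx
        rw [(AddSubgroup.mem_bot).1 hx, map_zero]
    · intro x
      exact AddSubgroup.subset_closure ⟨0, by simp⟩
  smul_mem := by
    intro i j b m hb hm
    rcases mem_smashDeg_triv_cases hb with rfl | rfl
    · by_cases hj : j = 0
      · simp [hj]
      · rw [if_neg hj] at hm
        rw [(AddSubgroup.mem_bot).1 hm, smul_zero]
        exact zero_mem _
    · rw [zero_smul]
      exact zero_mem _

variable (k H A) in
/-- The functor placing a module in degree `0`. -/
def triv : BMod k H A ⥤ GrBMod (trivDeg k H) (trivDeg k A) where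
  obj := trivObj
  map {M N} f := ofLin (M := trivObj M) (N := trivObj N) f.hom fun i m hm => by
    by_cases hi : i = 0
    · subst hi
      trivial
    · change m ∈ (if i = 0 then ⊤ else ⊥ : AddSubgroup M) at hm
      rw [if_neg hi] at hm
      rw [(AddSubgroup.mem_bot).1 hm]
      exact (map_zero f.hom).symm ▸ zero_mem _

variable (k H A) in
/-- The functor forgetting the grading. -/
def forgetGr : GrBMod (trivDeg k H) (trivDeg k A) ⥤ BMod k H A where
  obj M := M.toMod
  map f := f.1

/-- A module is acyclic if its restriction to `H` is injective. -/
theorem isAcyclic_of_injective [FiniteDimensional k H] (M : BMod k H A)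
    [Module.Injective H (resH.obj M)] : IsAcyclic M := by
  have : Module.Projective H (resH.obj M) := projective_of_injective (k := k) (resH.obj M)
  have hP : Projective (resH.obj M) := ModuleCat.projective_of_categoryTheory_projective _
  let F := CategoryTheory.Quotient.functor (stableRel (ModuleCat.{u} H))
  refine ⟨F.map (0 : resH.obj M ⟶ resH.obj (ModuleCat.of (SmashProduct k H A) PUnit.{u + 1})),
    ?_, ?_⟩
  · have h : resH.map (0 : ModuleCat.of (SmashProduct k H A) PUnit.{u + 1} ⟶ M) ≫
        (0 : resH.obj M ⟶ resH.obj (ModuleCat.of (SmashProduct k H A) PUnit.{u + 1})) = 𝟙 _ :=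
      have : Subsingleton (resH.obj (ModuleCat.of (SmashProduct k H A) PUnit.{u + 1})) :=
        inferInstanceAs (Subsingleton PUnit)
      (ModuleCat.isZero_of_subsingleton _).eq_of_tgt _ _
    refine (F.map_comp _ _).symm.trans ?_
    rw [h, F.map_id]
  · have h : (0 : resH.obj M ⟶ resH.obj (ModuleCat.of (SmashProduct k H A) PUnit.{u + 1})) ≫
        resH.map (0 : ModuleCat.of (SmashProduct k H A) PUnit.{u + 1} ⟶ M) = 0 := Limits.zero_comp
    refine (F.map_comp _ _).symm.trans ?_
    rw [h]
    exact (CategoryTheory.Quotient.sound (stableRel (ModuleCat.{u} H))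
      (f₁ := (0 : resH.obj M ⟶ resH.obj M)) (f₂ := 𝟙 _)
      ⟨resH.obj M, hP, -𝟙 _, 𝟙 _, by simp⟩).trans (F.map_id _)

end Ungraded

end Hopfological

end

open Hopfological
theorem theorem5 (k : Type u) [Field k] (H : Type u) [Ring H] [HopfAlgebra k H]
    [FiniteDimensional k H] (A : Type u) [Ring A] [Algebra k A] [Module H A] [IsScalarTower k H A]
    [ModuleAlgebra k H A] :
    (∃ (a p : BMod k H A ⥤ BMod k H A) (ι : 𝟭 (BMod k H A) ⟶ a) (π : a ⟶ p),
      ∀ M : BMod k H A,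
        IsASplitShortExact (ι.app M) (π.app M) ∧
        IsAcyclic (a.obj M) ∧
        HasPFiltration (p.obj M) ∧
        PropertyP (p.obj M)) ∧
    (∀ (𝓗 : ℤ → Submodule k H) [GradedAlgebra 𝓗] [IsGradedHopf 𝓗]
        (𝓐 : ℤ → Submodule k A) [GradedAlgebra 𝓐] [IsGradedAction 𝓗 𝓐],
      ∃ (a p : GrBMod 𝓗 𝓐 ⥤ GrBMod 𝓗 𝓐) (ι : 𝟭 (GrBMod 𝓗 𝓐) ⟶ a) (π : a ⟶ p),
        ∀ M : GrBMod 𝓗 𝓐,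
          IsGrASplitShortExact (ι.app M) (π.app M) ∧
          IsGrAcyclic (a.obj M) ∧
          HasGrPFiltration (p.obj M) ∧
          GrPropertyP (p.obj M)) := by
  constructor
  -- Without gradings, everything is placed in degree `0` and the gradings are forgotten afterwards.
  · obtain ⟨a, p, ι, π, h⟩ := exists_injective_envelope (trivDeg k H) (trivDeg k A)
    refine ⟨triv k H A ⋙ a ⋙ forgetGr k H A, triv k H A ⋙ p ⋙ forgetGr k H A,
      { app := fun M => (ι.app (trivObj M)).1
        naturality := fun M N f => congrArg Subtype.val (ι.naturality ((triv k H A).map f)) },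
      { app := fun M => (π.app (trivObj M)).1
        naturality := fun M N f => congrArg Subtype.val (π.naturality ((triv k H A).map f)) },
      fun M => ?_⟩
    obtain ⟨⟨h₁, h₂, h₃, s, h₄, -, h₅⟩, hinj, hP⟩ := h (trivObj M)
    have : Module.Injective H (resH.obj (a.obj (trivObj M)).toMod) := hinj
    exact ⟨⟨h₁, h₂, h₃, s, h₄, h₅⟩, isAcyclic_of_injective (a.obj (trivObj M)).toMod,
      hP.hasPFiltration, _, hP.hasPFiltration, ⟨Iso.refl _⟩⟩
  · intro 𝓗 _ _ 𝓐 _ _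
    obtain ⟨a, p, ι, π, h⟩ := exists_injective_envelope 𝓗 𝓐
    refine ⟨a, p, ι, π, fun M => ?_⟩
    obtain ⟨hs, hinj, hP⟩ := h M
    exact ⟨hs, isGrAcyclic_of_injective _, hP, p.obj M, hP, ⟨Iso.refl _⟩⟩
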